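/- **Theorem.** Let $k$ be a field of characteristic $0$, and let $H$ be a $2g$-dimensional symplectic vector space over $k$ with symplectic form $\omega$ and symplectic basis $p_1,\dots,p_g,q_1,\dots,q_g$. For $s\ge 2$ let $H^{\langle s\rangle}\subset H^{\otimes s}$ be the intersection of the kernels of all pairwise contractions $H^{\otimes s}\to H^{\otimes (s-2)}$, $v_1\otimes\cdots\otimes v_s\mapsto \omega(v_i,v_j)\bigotimes_{l\ne i,j}v_l$ $(i\neq j)$. The dihedral group $D_{2s}$ of order $2s$ acts on $H^{\otimes s}$, and hence on $H^{\langle s\rangle}$, by cyclic rotation of the tensor factors (without sign) and by the reversal $v_1\otimes\cdots\otimes v_s\mapsto(-1)^{s+1}v_s\otimes\cdots\otimes v_1$. This action commutes with that of $\mathrm{Sp}(H)$, so the coinvariants $[H^{\langle s\rangle}]_{D_{2s}}$ form a representation of $\mathrm{Sp}(H)$. For a partition $\lambda$ with at most $g$ parts, let $[\lambda]_{\mathrm{Sp}}$ be the irreducible representation of $\mathrm{Sp}(H)$ with highest weight $\lambda$, realized as the subrepresentation of $H^{\otimes|\lambda|}$ generated by $\bigotimes_{j}(p_1\wedge\cdots\wedge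 p_{\lambda'_j})$, where $\lambda'_j$ are the column lengths of $\lambda$ and $p_1\wedge\cdots\wedge p_c$ denotes $\sum_{\sigma}\mathrm{sgn}(\sigma)\,p_{\sigma(1)}\otimes\cdots\otimes p_{\sigma(c)}$. Then, as representations of $\mathrm{Sp}(H)$: 1. if $g\ge 3$, then $[H^{\langle 4\rangle}]_{D_8}\cong[21^2]_{\mathrm{Sp}}$; 2. if $g\ge 5$, then $[H^{\langle 5\rangle}]_{D_{10}}\cong[5]_{\mathrm{Sp}}\oplus[32]_{\mathrm{Sp}}\oplus[2^21]_{\mathrm{Sp}}\oplus[1^5]_{\mathrm{Sp}}$; 3. if $g\ge 4$, then $[H^{\langle 6\rangle}]_{D_{12}}\cong[3^2]_{\mathrm{Sp}}\oplus 2[41^2]_{\mathrm{Sp}}\oplus[321]_{\mathrm{Sp}}\oplus[31^3]_{\mathrm{Sp}}\oplus[2^21^2]_{\mathrm{Sp}}$. In each case the representations $[\lambda]_{\mathrm{Sp}}$ on the right, as realized above, are irreducible. -/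

import Mathlib

open scoped TensorProduct DirectSum

noncomputable section

namespace SpDihedral

universe u v w

section Symplectic

theorem restrict_update_of_eq {ι : Type w} {H : Type v} [DecidableEq ι] {i j : ι} (v : ι → H) (l : ι)
    (hl : l = i ∨ l = j) (x : H) :
    (fun m : {l : ι // l ≠ i ∧ l ≠ j} => Function.update v l x m) = fun m : {l : ι // l ≠ i ∧ l ≠ j} => v m := by
  funext m
  refine Function.update_of_ne ?_ _ _
  rcases hl with rfl | rfl
  exacts [m.2.1, m.2.2]

theorem restrict_update_of_ne {ι : Type w} {H : Type v} [DecidableEq ι] {i j : ι} (v : ι → H) (l : ι)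
    (hl : l ≠ i ∧ l ≠ j) (x : H) :
    (fun m : {l : ι // l ≠ i ∧ l ≠ j} => Function.update v l x m) =
      Function.update (fun m : {l : ι // l ≠ i ∧ l ≠ j} => v m) ⟨l, hl⟩ x := by
  funext m
  by_cases h : m = ⟨l, hl⟩
  · subst h
    simp
  · rw [Function.update_of_ne h, Function.update_of_ne]
    exact fun h' => h (Subtype.ext h')

variable {k : Type u} [Field k] {H : Type v} [AddCommGroup H] [Module k H]

/-- `b` is a symplectic basis `p_1, …, p_g, q_1, …, q_g` of `(H, ω)`, where `p_i = b (Sum.inl i)`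
and `q_i = b (Sum.inr i)`. -/
structure IsSymplecticBasis (ω : LinearMap.BilinForm k H) {g : ℕ}
    (b : Module.Basis (Fin g ⊕ Fin g) k H) : Prop where
  p_p : ∀ i j, ω (b (Sum.inl i)) (b (Sum.inl j)) = 0
  q_q : ∀ i j, ω (b (Sum.inr i)) (b (Sum.inr j)) = 0
  p_q : ∀ i j, ω (b (Sum.inl i)) (b (Sum.inr j)) = if i = j then 1 else 0
  q_p : ∀ i j, ω (b (Sum.inr i)) (b (Sum.inl j)) = if i = j then -1 else 0

/-- The symplectic group `Sp(H)`: the linear automorphisms of `H` that preserve `ω`. -/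
def Sp (ω : LinearMap.BilinForm k H) : Subgroup (H ≃ₗ[k] H) where
  carrier := {f | ∀ x y, ω (f x) (f y) = ω x y}
  mul_mem' {f f'} hf hf' x y := (hf (f' x) (f' y)).trans (hf' x y)
  one_mem' _ _ := rfl
  inv_mem' {f} hf x y := by
    have h := hf (f⁻¹ x) (f⁻¹ y)
    rw [← LinearEquiv.mul_apply, ← LinearEquiv.mul_apply, mul_inv_cancel] at h
    exact h.symm

/-- The diagonal action of `Sp(H)` on the tensor power `⨂_{i : ι} H`. -/
def tensorRep (ω : LinearMap.BilinForm k H) (ι : Type w) :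
    Representation k (Sp ω) (⨂[k] _ : ι, H) where
  toFun f := PiTensorProduct.map fun _ => ((f : H ≃ₗ[k] H) : H →ₗ[k] H)
  map_one' := PiTensorProduct.map_one
  map_mul' f f' := PiTensorProduct.map_mul (fun _ => ((f : H ≃ₗ[k] H) : H →ₗ[k] H))
    (fun _ => ((f' : H ≃ₗ[k] H) : H →ₗ[k] H))

@[simp]
theorem tensorRep_tprod (ω : LinearMap.BilinForm k H) (ι : Type w) (f : Sp ω) (v : ι → H) :
    tensorRep ω ι f (PiTensorProduct.tprod k v) =
      PiTensorProduct.tprod k fun i => (f : H ≃ₗ[k] H) (v i) :=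
  PiTensorProduct.map_tprod _ _

/-- The contraction of the tensor slots `i` and `j`:
`⨂_l v_l ↦ ω(v_i, v_j) ⨂_{l ≠ i, j} v_l`. -/
def contraction (ω : LinearMap.BilinForm k H) {ι : Type w} {i j : ι} (hij : i ≠ j) :
    (⨂[k] _ : ι, H) →ₗ[k] (⨂[k] _ : {l : ι // l ≠ i ∧ l ≠ j}, H) :=
  PiTensorProduct.lift
    { toFun := fun v =>
        ω (v i) (v j) • PiTensorProduct.tprod k fun l : {l : ι // l ≠ i ∧ l ≠ j} => v l
      map_update_add' := by
        intro _ v l x y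
        by_cases hi : l = i
        · subst hi
          simp only [restrict_update_of_eq (i := l) (j := j) v l (Or.inl rfl), Function.update_self,
            Function.update_of_ne hij.symm, map_add, LinearMap.add_apply, add_smul]
        by_cases hj : l = j
        · subst hj
          simp only [restrict_update_of_eq (i := i) (j := l) v l (Or.inr rfl), Function.update_self,
            Function.update_of_ne hij, map_add, add_smul]
        simp only [restrict_update_of_ne v l ⟨hi, hj⟩, Function.update_of_ne (Ne.symm hi),
          Function.update_of_ne (Ne.symm hj), MultilinearMap.map_update_add, smul_add]
      map_update_smul' := by
        intro _ v l c x
        by_cases hi : l = i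
        · subst hi
          simp only [restrict_update_of_eq (i := l) (j := j) v l (Or.inl rfl), Function.update_self,
            Function.update_of_ne hij.symm, map_smul, LinearMap.smul_apply, smul_assoc]
        by_cases hj : l = j
        · subst hj
          simp only [restrict_update_of_eq (i := i) (j := l) v l (Or.inr rfl), Function.update_self,
            Function.update_of_ne hij, map_smul, smul_assoc]
        simp only [restrict_update_of_ne v l ⟨hi, hj⟩, Function.update_of_ne (Ne.symm hi),
          Function.update_of_ne (Ne.symm hj), MultilinearMap.map_update_smul, smul_comm c] }

@[simp]
theorem contraction_tprod (ω : LinearMap.BilinForm k H) {ι : Type w} {i j : ι} (hij : i ≠ j)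
    (v : ι → H) :
    contraction ω hij (PiTensorProduct.tprod k v) =
      ω (v i) (v j) • PiTensorProduct.tprod k fun l : {l : ι // l ≠ i ∧ l ≠ j} => v l :=
  PiTensorProduct.lift.tprod _

/-- The intersection of the kernels of all pairwise contractions on `⨂_{i : ι} H`. -/
def traceless (ω : LinearMap.BilinForm k H) (ι : Type w) : Submodule k (⨂[k] _ : ι, H) :=
  ⨅ (i : ι) (j : ι) (hij : i ≠ j), LinearMap.ker (contraction ω hij)

theorem mem_traceless {ω : LinearMap.BilinForm k H} {ι : Type w} {x : ⨂[k] _ : ι, H} :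
    x ∈ traceless ω ι ↔ ∀ (i j : ι) (hij : i ≠ j), contraction ω hij x = 0 := by
  simp [traceless]

theorem contraction_tensorRep (ω : LinearMap.BilinForm k H) {ι : Type w} {i j : ι} (hij : i ≠ j)
    (f : Sp ω) (x : ⨂[k] _ : ι, H) :
    contraction ω hij (tensorRep ω ι f x) = tensorRep ω _ f (contraction ω hij x) := by
  have h : contraction ω hij ∘ₗ tensorRep ω ι f = tensorRep ω _ f ∘ₗ contraction ω hij := by
    ext v
    simp [f.2 (v i) (v j)]
  exact LinearMap.congr_fun h x

/-- The `Sp(H)`-representation on the traceless tensors in `⨂_{i : ι} H`. -/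
def tracelessSp (ω : LinearMap.BilinForm k H) (ι : Type w) :
    Representation k (Sp ω) (traceless ω ι) :=
  (tensorRep ω ι).subrepresentation (traceless ω ι) (by
    intro f x hx
    rw [Submodule.mem_comap, mem_traceless]
    intro i j hij
    rw [contraction_tensorRep, mem_traceless.1 hx i j hij, map_zero])

end Symplectic

section Dihedral

/-- The dihedral group of order `2s` acting on `s` cyclically ordered positions: `r i` rotates
`x ↦ x + i`, and `sr i` reflects `x ↦ -(x + i)`. In particular `sr 1` is the order reversal
`x ↦ s - 1 - x`. -/
def dihedralPerm (s : ℕ) : DihedralGroup s →* Equiv.Perm (ZMod s) where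
  toFun
    | .r i => Equiv.addRight i
    | .sr i => (Equiv.addRight i).trans (Equiv.neg (ZMod s))
  map_one' := by
    ext x
    change x + 0 = x
    exact add_zero x
  map_mul' a c := by
    rcases a with i | i <;> rcases c with j | j <;> ext x <;>
      simp [DihedralGroup.r_mul_r, DihedralGroup.r_mul_sr, DihedralGroup.sr_mul_r,
        DihedralGroup.sr_mul_sr] <;> ring

/-- The twist: rotations have sign `1` and reflections have sign `(-1)^(s+1)`, so that it is trivial
for odd `s` and the nontrivial character `r ↦ 1`, `sr ↦ -1` for even `s`. -/
def dihedralSign (s : ℕ) : DihedralGroup s →* ℤˣ where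
  toFun
    | .r _ => 1
    | .sr _ => (-1) ^ (s + 1)
  map_one' := rfl
  map_mul' a c := by
    rcases a with i | i <;> rcases c with j | j <;>
      simp [DihedralGroup.r_mul_r, DihedralGroup.r_mul_sr, DihedralGroup.sr_mul_r,
        DihedralGroup.sr_mul_sr, ← mul_pow]

/-- The dihedral group acting on `H^{⊗s}` by permuting the tensor factors, with the twist; the
reversal `sr 1` acts by `v_1 ⊗ ⋯ ⊗ v_s ↦ (-1)^(s+1) v_s ⊗ ⋯ ⊗ v_1`. -/
def dihedralTensorRep (k : Type u) [Field k] (H : Type v) [AddCommGroup H] [Module k H] (s : ℕ) :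
    Representation k (DihedralGroup s) (⨂[k] _ : ZMod s, H) where
  toFun a := ((dihedralSign s a : ℤ) : k) •
    (PiTensorProduct.reindex k (fun _ : ZMod s => H) (dihedralPerm s a)).toLinearMap
  map_one' := by
    ext v
    simp only [map_one, Units.val_one, Int.cast_one, one_smul, LinearMap.compMultilinearMap_apply,
      LinearEquiv.coe_coe, PiTensorProduct.reindex_tprod]
    rfl
  map_mul' a c := by
    ext v
    simp only [map_mul, Units.val_mul, Int.cast_mul, mul_smul, LinearMap.compMultilinearMap_apply,
      LinearMap.smul_apply, Module.End.mul_apply, LinearEquiv.coe_coe, map_smul,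
      PiTensorProduct.reindex_tprod]
    rw [smul_comm]
    rfl

variable {k : Type u} [Field k] {H : Type v} [AddCommGroup H] [Module k H]

@[simp]
theorem dihedralTensorRep_tprod (s : ℕ) (a : DihedralGroup s) (v : ZMod s → H) :
    dihedralTensorRep k H s a (PiTensorProduct.tprod k v) =
      ((dihedralSign s a : ℤ) : k) •
        PiTensorProduct.tprod k fun i => v ((dihedralPerm s a).symm i) := by
  simp [dihedralTensorRep, PiTensorProduct.reindex_tprod]

theorem tensorRep_dihedralTensorRep (ω : LinearMap.BilinForm k H) (s : ℕ) (f : Sp ω)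
    (a : DihedralGroup s) (x : ⨂[k] _ : ZMod s, H) :
    tensorRep ω (ZMod s) f (dihedralTensorRep k H s a x) =
      dihedralTensorRep k H s a (tensorRep ω (ZMod s) f x) := by
  have h : tensorRep ω (ZMod s) f ∘ₗ dihedralTensorRep k H s a =
      dihedralTensorRep k H s a ∘ₗ tensorRep ω (ZMod s) f := by
    ext v
    simp
  exact LinearMap.congr_fun h x

theorem contraction_dihedralTensorRep (ω : LinearMap.BilinForm k H) (s : ℕ) (a : DihedralGroup s)
    {i j : ZMod s} (hij : dihedralPerm s a i ≠ dihedralPerm s a j) (hij' : i ≠ j)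
    (x : ⨂[k] _ : ZMod s, H) :
    contraction ω hij (dihedralTensorRep k H s a x) =
      ((dihedralSign s a : ℤ) : k) • PiTensorProduct.reindex k (fun _ => H)
        ((dihedralPerm s a).subtypeEquiv fun l => by simp) (contraction ω hij' x) := by
  have h : contraction ω hij ∘ₗ dihedralTensorRep k H s a =
      ((dihedralSign s a : ℤ) : k) • (PiTensorProduct.reindex k (fun _ => H)
        ((dihedralPerm s a).subtypeEquiv fun l => by simp)).toLinearMap ∘ₗ
          contraction ω hij' := by
    ext v
    simp only [LinearMap.compMultilinearMap_apply, LinearMap.comp_apply, dihedralTensorRep_tprod,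
      map_smul, contraction_tprod, LinearMap.smul_apply, LinearEquiv.coe_coe,
      PiTensorProduct.reindex_tprod]
    have hv : ∀ l, v ((dihedralPerm s a).symm (dihedralPerm s a l)) = v l := fun l =>
      congrArg v (Equiv.symm_apply_apply _ l)
    have hω : ω (v ((dihedralPerm s a).symm (dihedralPerm s a i)))
        (v ((dihedralPerm s a).symm (dihedralPerm s a j))) = ω (v i) (v j) :=
      congrArg₂ (fun x y => ω x y) (hv i) (hv j)
    exact congrArg (fun c : k => ((dihedralSign s a : ℤ) : k) • c •
      PiTensorProduct.tprod k fun l : {l // l ≠ dihedralPerm s a i ∧ l ≠ dihedralPerm s a j} =>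
        v ((dihedralPerm s a).symm l)) hω
  exact LinearMap.congr_fun h x

theorem dihedralTensorRep_mem_traceless (ω : LinearMap.BilinForm k H) (s : ℕ)
    (a : DihedralGroup s) {x : ⨂[k] _ : ZMod s, H} (hx : x ∈ traceless ω (ZMod s)) :
    dihedralTensorRep k H s a x ∈ traceless ω (ZMod s) := by
  rw [mem_traceless]
  intro i j hij
  obtain ⟨i, rfl⟩ := (dihedralPerm s a).surjective i
  obtain ⟨j, rfl⟩ := (dihedralPerm s a).surjective j
  have hij' : i ≠ j := fun h => hij (congrArg _ h)
  rw [contraction_dihedralTensorRep ω s a hij hij', mem_traceless.1 hx i j hij', map_zero,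
    smul_zero]

/-- The (twisted) dihedral action on `H^{⟨s⟩}`. -/
def tracelessDihedral (ω : LinearMap.BilinForm k H) (s : ℕ) :
    Representation k (DihedralGroup s) (traceless ω (ZMod s)) :=
  (dihedralTensorRep k H s).subrepresentation (traceless ω (ZMod s))
    fun a _ hx => dihedralTensorRep_mem_traceless ω s a hx

theorem tracelessSp_comm (ω : LinearMap.BilinForm k H) (s : ℕ) (f : Sp ω) (a : DihedralGroup s)
    (x : traceless ω (ZMod s)) :
    tracelessSp ω (ZMod s) f (tracelessDihedral ω s a x) =
      tracelessDihedral ω s a (tracelessSp ω (ZMod s) f x) :=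
  Subtype.ext (tensorRep_dihedralTensorRep ω s f a x)

/-- The `Sp(H)`-representation on the dihedral coinvariants `[H^{⟨s⟩}]_{D_{2s}}`, induced from
that on `H^{⟨s⟩}`. -/
def dihedralCoinvariants (ω : LinearMap.BilinForm k H) (s : ℕ) :
    Representation k (Sp ω) (tracelessDihedral ω s).Coinvariants :=
  (tracelessSp ω (ZMod s)).quotient (Representation.Coinvariants.ker (tracelessDihedral ω s)) (by
    intro f
    refine Submodule.span_le.2 ?_
    rintro _ ⟨⟨a, x⟩, rfl⟩
    refine Representation.Coinvariants.mem_ker_of_eq a (tracelessSp ω (ZMod s) f x) _ ?_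
    simp only [map_sub, tracelessSp_comm])

@[simp]
theorem dihedralCoinvariants_mk (ω : LinearMap.BilinForm k H) (s : ℕ) (f : Sp ω)
    (x : traceless ω (ZMod s)) :
    dihedralCoinvariants ω s f (Representation.Coinvariants.mk _ x) =
      Representation.Coinvariants.mk _ (tracelessSp ω (ZMod s) f x) := rfl

end Dihedral

section Irreducible

variable {k : Type u} [Field k] {H : Type v} [AddCommGroup H] [Module k H]

/-- The permutations of the cells of a Young diagram that preserve each column. -/
def columnGroup (μ : YoungDiagram) : Subgroup (Equiv.Perm μ.cells) where
  carrier := {σ | ∀ c, (σ c).1.2 = c.1.2}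
  mul_mem' {σ τ} hσ hτ c := (hσ (τ c)).trans (hτ c)
  one_mem' _ := rfl
  inv_mem' {σ} hσ c := by
    have h := hσ (σ⁻¹ c)
    rw [← Equiv.Perm.mul_apply, mul_inv_cancel] at h
    exact h.symm

/-- The highest weight vector of weight `μ` in `⨂_{cells of μ} H`: the tensor product, over the
columns of `μ`, of the antisymmetrizations `p_1 ∧ ⋯ ∧ p_c`, where `c` is the length of the column.
The cell in row `i` (counted from `0`) carries the basis vector `b (Sum.inl i)`. The definition is
meant for diagrams with at most `g` rows, and gives `0` for longer ones. -/
def highestWeightVector {g : ℕ} (b : Module.Basis (Fin g ⊕ Fin g) k H) (μ : YoungDiagram) :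
    ⨂[k] _ : μ.cells, H :=
  open Classical in
  ∑ σ : columnGroup μ, ((Equiv.Perm.sign (σ : Equiv.Perm μ.cells) : ℤ) : k) •
    PiTensorProduct.tprod k fun c : μ.cells =>
      if h : ((σ : Equiv.Perm μ.cells) c).1.1 < g then b (Sum.inl ⟨_, h⟩) else 0

/-- The subrepresentation of `⨂_{cells of μ} H` generated by the highest weight vector. -/
def irrepSub (ω : LinearMap.BilinForm k H) {g : ℕ} (b : Module.Basis (Fin g ⊕ Fin g) k H)
    (μ : YoungDiagram) : Subrepresentation (tensorRep ω μ.cells) where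
  toSubmodule := Submodule.span k
    (Set.range fun f : Sp ω => tensorRep ω μ.cells f (highestWeightVector b μ))
  apply_mem_toSubmodule f x hx := by
    induction hx using Submodule.span_induction with
    | mem x hx =>
      obtain ⟨f', rfl⟩ := hx
      refine Submodule.subset_span ⟨f * f', ?_⟩
      simp only [map_mul, Module.End.mul_apply]
    | zero => simp
    | add x y _ _ hx hy => simpa using Submodule.add_mem _ hx hy
    | smul c x _ hx => simpa using Submodule.smul_mem _ c hx

/-- `[μ]_{Sp}`, the irreducible representation of `Sp(H)` with highest weight `μ`, for `μ` with at
most `g` rows. -/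
def irrep (ω : LinearMap.BilinForm k H) {g : ℕ} (b : Module.Basis (Fin g ⊕ Fin g) k H)
    (μ : YoungDiagram) : Representation k (Sp ω) (irrepSub ω b μ).toSubmodule :=
  (irrepSub ω b μ).toRepresentation

/-- The direct sum of the representations `[μ]_{Sp}` over a list of partitions, which are counted
with their multiplicity in the list. -/
def irrepSum (ω : LinearMap.BilinForm k H) {g : ℕ} (b : Module.Basis (Fin g ⊕ Fin g) k H)
    (L : List YoungDiagram) :
    Representation k (Sp ω) (⨁ i : Fin L.length, (irrepSub ω b (L.get i)).toSubmodule) :=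
  Representation.directSum fun i => irrep ω b (L.get i)

end Irreducible

/-- The Young diagram with the given list of row lengths. -/
abbrev part (w : List ℕ) (hw : w.SortedGE := by decide) : YoungDiagram :=
  YoungDiagram.ofRowLens w hw

end SpDihedral

end

open SpDihedral

namespace SpDihedral

open Function

section Words

variable {ι L R : Type*} [Fintype ι] [DecidableEq ι] [DecidableEq L] [CommRing R]

/-- The function on words obtained by letting the elementary operator `j ↦ i` act as a
derivation. -/
def raise (i j : L) (x : (ι → L) → R) (w : ι → L) : R :=
  ∑ a, if w a = i then x (update w a j) else 0

theorem raise_map {S : Type*} [CommRing S] (φ : R →+ S) (i j : L) (x : (ι → L) → R) (w : ι → L) :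
    φ (raise i j x w) = raise i j (fun w => φ (x w)) w := by
  simp only [raise, map_sum]
  exact Finset.sum_congr rfl fun a _ => by split_ifs <;> simp

variable [Fintype L]

theorem sum_update_eq (a : ι) (i j : L) (x y : (ι → L) → R) :
    ∑ w, (if w a = i then x (update w a j) * y w else 0) =
      ∑ w, if w a = j then x w * y (update w a i) else 0 := by
  rw [← Finset.sum_filter, ← Finset.sum_filter]
  refine Finset.sum_nbij' (fun w => update w a j) (fun w => update w a i) ?_ ?_ ?_ ?_ ?_
  · simp
  · simp
  · intro w hw
    have : w a = i := by simpa using hw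
    subst this
    simp
  · intro w hw
    have : w a = j := by simpa using hw
    subst this
    simp
  · intro w hw
    have : w a = i := by simpa using hw
    subst this
    simp

theorem sum_raise_mul (i j : L) (x y : (ι → L) → R) :
    ∑ w, raise i j x w * y w = ∑ w, x w * raise j i y w := by
  simp only [raise, Finset.sum_mul, Finset.mul_sum, ite_mul, mul_ite, zero_mul, mul_zero]
  rw [Finset.sum_comm, Finset.sum_comm (s := Finset.univ (α := ι → L)) (t := Finset.univ (α := ι))]
  exact Finset.sum_congr rfl fun a _ => sum_update_eq a i j x y

omit [DecidableEq L] in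
theorem sum_sum_update (a : ι) (F : (ι → L) → R) :
    ∑ w : ι → L, ∑ m, F (update w a m) = Fintype.card L * ∑ w, F w := by
  have h : ∑ w : ι → L, ∑ m, F (update w a m) = ∑ w : ι → L, ∑ _m : L, F w := by
    rw [← Fintype.sum_prod_type', ← Fintype.sum_prod_type']
    refine Finset.sum_nbij' (fun p => (update p.1 a p.2, p.1 a)) (fun p => (update p.1 a p.2, p.1 a))
      ?_ ?_ ?_ ?_ ?_ <;> simp
  rw [h]
  simp [Finset.mul_sum]

/-- The number of occurrences of a letter in a word. -/
def cnt (w : ι → L) (i : L) : ℕ := (Finset.univ.filter fun a => w a = i).card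

omit [DecidableEq ι] [Fintype L] in
theorem sum_if_eq_cnt (w : ι → L) (i : L) (c : R) :
    ∑ a, (if w a = i then c else 0) = cnt w i * c := by
  rw [← Finset.sum_filter, Finset.sum_const, cnt, nsmul_eq_mul]

omit [Fintype ι] [DecidableEq L] [Fintype L] in
theorem update_update_swap {i j : L} {w : ι → L} {a b : ι} (hab : a ≠ b) (ha : w a = i)
    (hb : w b = j) : update (update w a j) b i = w ∘ Equiv.swap a b := by
  funext c
  by_cases hcb : c = b
  · subst hcb; simp [ha]
  by_cases hca : c = a
  · subst hca; simp [hab, hb]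
  simp [hcb, hca, Equiv.swap_apply_of_ne_of_ne hca hcb]

omit [Fintype L] in
theorem raise_raise {i j : L} (hij : i ≠ j) (x : (ι → L) → R) (w : ι → L) :
    raise j i (raise i j x) w = cnt w j * x w +
      ∑ a, ∑ b, if w a = j ∧ w b = i then x (w ∘ Equiv.swap a b) else 0 := by
  rw [← sum_if_eq_cnt, ← Finset.sum_add_distrib, raise]
  refine Finset.sum_congr rfl fun a _ => ?_
  by_cases ha : w a = j
  · simp only [ha, if_true, true_and, raise]
    rw [Fintype.sum_eq_add_sum_compl a, Fintype.sum_eq_add_sum_compl (a := a)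
      (f := fun b => if w b = i then x (w ∘ Equiv.swap a b) else 0)]
    have h1 : update w a j = w := by rw [← ha, update_eq_self]
    have h2 : ¬ j = i := fun h => hij h.symm
    simp only [update_self, if_true, update_idem, h1, ha, h2, if_false, zero_add]
    congr 1
    refine Finset.sum_congr rfl fun b hb => ?_
    have hba : b ≠ a := by simpa using hb
    rw [update_of_ne hba]
    split_ifs with h
    · rw [update_update_swap hba.symm ha h]
    · rfl
  · simp [ha]

end Words

section Positivity

variable {ι : Type*} [Fintype ι] [DecidableEq ι] {g : ℕ}

/-- Vanishing of the contractions, in coordinates. -/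
def WordTraceless {R : Type*} [CommRing R] (x : (ι → Fin g ⊕ Fin g) → R) : Prop :=
  ∀ a b, a ≠ b → ∀ w, ∑ i, x (update (update w a (Sum.inl i)) b (Sum.inr i)) =
    ∑ i, x (update (update w a (Sum.inr i)) b (Sum.inl i))

theorem sum_raise_mul_raise (x : (ι → Fin g ⊕ Fin g) → ℚ) :
    ∑ k : Fin g, ∑ l : Fin g, ∑ w, raise (Sum.inl l) (Sum.inr k) x w *
        raise (Sum.inl k) (Sum.inr l) x w =
      (∑ a, ∑ w, ∑ k, if w a = Sum.inl k then x (update w a (Sum.inr k)) ^ 2 else 0) +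
      ∑ a, ∑ b ∈ {a}ᶜ, ∑ w, ∑ k, ∑ l, if w a = Sum.inl l ∧ w b = Sum.inl k then
        x (update w a (Sum.inr k)) * x (update w b (Sum.inr l)) else 0 := by
  have key : ∀ k l : Fin g, ∀ w, raise (Sum.inl l) (Sum.inr k) x w *
        raise (Sum.inl k) (Sum.inr l) x w = ∑ a, ∑ b,
          if w a = Sum.inl l ∧ w b = Sum.inl k then
        x (update w a (Sum.inr k)) * x (update w b (Sum.inr l)) else 0 := by
    intro k l w
    simp only [raise, Finset.sum_mul_sum, ite_mul, mul_ite, zero_mul, mul_zero, ← ite_and, and_comm]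
  simp only [key]
  rw [← Finset.sum_add_distrib]
  have hcomm : ∀ G : Fin g → Fin g → (ι → Fin g ⊕ Fin g) → ι → ℚ,
      ∑ k, ∑ l, ∑ w, ∑ a, G k l w a = ∑ a, ∑ w, ∑ k, ∑ l, G k l w a := by
    intro G
    calc ∑ k, ∑ l, ∑ w, ∑ a, G k l w a = ∑ k, ∑ l, ∑ a, ∑ w, G k l w a :=
          Finset.sum_congr rfl fun k _ => Finset.sum_congr rfl fun l _ => Finset.sum_comm
      _ = ∑ k, ∑ a, ∑ l, ∑ w, G k l w a :=
          Finset.sum_congr rfl fun k _ => Finset.sum_comm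
      _ = ∑ a, ∑ k, ∑ l, ∑ w, G k l w a := Finset.sum_comm
      _ = ∑ a, ∑ k, ∑ w, ∑ l, G k l w a :=
          Finset.sum_congr rfl fun k _ => Finset.sum_congr rfl fun l _ => Finset.sum_comm
      _ = _ := Finset.sum_congr rfl fun k _ => Finset.sum_comm
  rw [hcomm]
  refine Finset.sum_congr rfl fun a _ => ?_
  have h3 : ∑ b ∈ {a}ᶜ, ∑ w : ι → Fin g ⊕ Fin g, ∑ k, ∑ l,
      (if w a = Sum.inl l ∧ w b = Sum.inl k then
        x (update w a (Sum.inr k)) * x (update w b (Sum.inr l)) else 0) =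
      ∑ w : ι → Fin g ⊕ Fin g, ∑ k, ∑ l, ∑ b ∈ {a}ᶜ,
      (if w a = Sum.inl l ∧ w b = Sum.inl k then
        x (update w a (Sum.inr k)) * x (update w b (Sum.inr l)) else 0) := by
    rw [Finset.sum_comm]
    refine Finset.sum_congr rfl fun w _ => ?_
    rw [Finset.sum_comm]
    exact Finset.sum_congr rfl fun k _ => Finset.sum_comm
  rw [h3, ← Finset.sum_add_distrib]
  refine Finset.sum_congr rfl fun w _ => ?_
  rw [← Finset.sum_add_distrib]
  refine Finset.sum_congr rfl fun k _ => ?_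
  have h4 : (if w a = Sum.inl k then x (update w a (Sum.inr k)) ^ 2 else 0) =
      ∑ l, if w a = Sum.inl l ∧ w a = Sum.inl k then
        x (update w a (Sum.inr k)) * x (update w a (Sum.inr l)) else 0 := by
    rw [Finset.sum_eq_single k]
    · simp [sq]
    · intro l _ hl
      rw [if_neg]
      rintro ⟨h, h'⟩
      exact hl (Sum.inl_injective (h.symm.trans h'))
    · simp
  rw [h4, ← Finset.sum_add_distrib]
  refine Finset.sum_congr rfl fun l _ => ?_
  rw [Fintype.sum_eq_add_sum_compl a]

theorem sum_cross_nonneg {x : (ι → Fin g ⊕ Fin g) → ℚ} (hT : WordTraceless x) {a b : ι}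
    (hab : a ≠ b) :
    0 ≤ ∑ w, ∑ k, ∑ l, if w a = Sum.inl l ∧ w b = Sum.inl k then
        x (update w a (Sum.inr k)) * x (update w b (Sum.inr l)) else 0 := by
  rcases isEmpty_or_nonempty (Fin g ⊕ Fin g) with hg | hg
  · have : IsEmpty (Fin g) := ⟨fun i => hg.elim (Sum.inl i)⟩
    simp
  set F : (ι → Fin g ⊕ Fin g) → ℚ := fun w => ∑ k, ∑ l, if w a = Sum.inl l ∧ w b = Sum.inl k then
        x (update w a (Sum.inr k)) * x (update w b (Sum.inr l)) else 0 with hF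
  have h1 := sum_sum_update b (fun w => ∑ m, F (update w a m))
  rw [sum_sum_update a F] at h1
  have h2 : ∀ w, ∑ n, ∑ m, F (update (update w b n) a m) =
      (∑ i, x (update (update w a (Sum.inl i)) b (Sum.inr i))) ^ 2 := by
    intro w
    have h3 : ∀ n m, F (update (update w b n) a m) = ∑ k, ∑ l,
        if m = Sum.inl l ∧ n = Sum.inl k then
          x (update (update w a (Sum.inr k)) b (Sum.inl k)) *
          x (update (update w a (Sum.inl l)) b (Sum.inr l)) else 0 := by
      intro n m
      simp only [hF, update_self, update_of_ne hab.symm]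
      refine Finset.sum_congr rfl fun k _ => Finset.sum_congr rfl fun l _ => ?_
      split_ifs with h
      · rw [h.1, h.2, update_idem, update_comm hab, update_comm hab.symm, update_idem,
          update_comm hab.symm]
      · rfl
    simp only [h3, Fintype.sum_sum_type, reduceCtorEq, false_and, and_false, if_false,
      Finset.sum_const_zero, add_zero, Sum.inl.injEq]
    have h4 : ∀ n m : Fin g, (∑ k, ∑ l, if m = l ∧ n = k then
          x (update (update w a (Sum.inr k)) b (Sum.inl k)) *
          x (update (update w a (Sum.inl l)) b (Sum.inr l)) else 0) =
          x (update (update w a (Sum.inr n)) b (Sum.inl n)) *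
          x (update (update w a (Sum.inl m)) b (Sum.inr m)) := by
      intro n m
      simp [ite_and]
    simp only [h4]
    rw [← Finset.sum_mul_sum, ← hT a b hab, sq]
  simp only [h2] at h1
  have h5 : 0 ≤ (Fintype.card (Fin g ⊕ Fin g) : ℚ) * (Fintype.card (Fin g ⊕ Fin g) * ∑ w, F w) := by
    rw [← h1]
    exact Finset.sum_nonneg fun w _ => sq_nonneg _
  have h6 : (0 : ℚ) < Fintype.card (Fin g ⊕ Fin g) := by exact_mod_cast Fintype.card_pos
  exact nonneg_of_mul_nonneg_right (nonneg_of_mul_nonneg_right h5 h6) h6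

theorem eq_zero_of_raise_symm_rat {x : (ι → Fin g ⊕ Fin g) → ℚ} (hT : WordTraceless x)
    (hE : ∀ k l w, raise (Sum.inl l) (Sum.inr k) x w + raise (Sum.inl k) (Sum.inr l) x w = 0)
    {w : ι → Fin g ⊕ Fin g} {a : ι} {k : Fin g} (hw : w a = Sum.inr k) : x w = 0 := by
  have h1 := sum_raise_mul_raise x
  have h2 : ∑ k : Fin g, ∑ l : Fin g, ∑ w, raise (Sum.inl l) (Sum.inr k) x w *
        raise (Sum.inl k) (Sum.inr l) x w ≤ 0 := by
    refine Finset.sum_nonpos fun k _ => Finset.sum_nonpos fun l _ => Finset.sum_nonpos fun w _ => ?_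
    rw [eq_neg_of_add_eq_zero_right (hE k l w)]
    nlinarith [sq_nonneg (raise (Sum.inl l) (Sum.inr k) x w)]
  have h3 : 0 ≤ ∑ a, ∑ b ∈ {a}ᶜ, ∑ w, ∑ k, ∑ l, if w a = Sum.inl l ∧ w b = Sum.inl k then
        x (update w a (Sum.inr k)) * x (update w b (Sum.inr l)) else 0 :=
    Finset.sum_nonneg fun a _ => Finset.sum_nonneg fun b hb =>
      sum_cross_nonneg hT (by simpa [eq_comm] using hb)
  have h0 : ∀ a, ∀ w : ι → Fin g ⊕ Fin g, ∀ k,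
      0 ≤ if w a = Sum.inl k then x (update w a (Sum.inr k)) ^ 2 else 0 := by
    intro a w k
    split_ifs
    · positivity
    · rfl
  have h4 : (∑ a, ∑ w, ∑ k, if w a = Sum.inl k then x (update w a (Sum.inr k)) ^ 2 else 0) = 0 :=
    le_antisymm (by linarith) (Finset.sum_nonneg fun a _ => Finset.sum_nonneg fun w _ =>
      Finset.sum_nonneg fun k _ => h0 a w k)
  rw [Finset.sum_eq_zero_iff_of_nonneg fun a _ => Finset.sum_nonneg fun w _ =>
      Finset.sum_nonneg fun k _ => h0 a w k] at h4
  have h5 := h4 a (Finset.mem_univ _)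
  rw [Finset.sum_eq_zero_iff_of_nonneg fun w _ => Finset.sum_nonneg fun k _ => h0 a w k] at h5
  have h6 := h5 (update w a (Sum.inl k)) (Finset.mem_univ _)
  rw [Finset.sum_eq_zero_iff_of_nonneg fun k _ => h0 a _ k] at h6
  have h7 := h6 k (Finset.mem_univ _)
  rw [update_self, if_pos rfl, update_idem, ← hw, update_eq_self] at h7
  exact pow_eq_zero_iff (two_ne_zero) |>.1 h7

/-- A scalar killed by all `ℚ`-linear functionals vanishes. -/
theorem eq_zero_of_forall_rat {k : Type*} [Field k] [CharZero k] {c : k}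
    (h : ∀ φ : k →ₗ[ℚ] ℚ, φ c = 0) : c = 0 :=
  (Module.forall_dual_apply_eq_zero_iff ℚ c).1 h

theorem eq_zero_of_raise_symm {k : Type*} [Field k] [CharZero k]
    {x : (ι → Fin g ⊕ Fin g) → k} (hT : WordTraceless x)
    (hE : ∀ m l w, raise (Sum.inl l) (Sum.inr m) x w + raise (Sum.inl m) (Sum.inr l) x w = 0)
    {w : ι → Fin g ⊕ Fin g} {a : ι} {m : Fin g} (hw : w a = Sum.inr m) : x w = 0 := by
  refine eq_zero_of_forall_rat fun φ => eq_zero_of_raise_symm_rat (x := fun w => φ (x w)) ?_ ?_ hw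
  · intro a b hab w
    rw [← map_sum, ← map_sum, hT a b hab w]
  · intro m l w
    have h := congrArg φ (hE m l w)
    rw [map_add, map_zero] at h
    rw [← h]
    exact congrArg₂ _ (raise_map φ.toAddMonoidHom _ _ _ _).symm
      (raise_map φ.toAddMonoidHom _ _ _ _).symm

end Positivity

section Highest

variable {ι : Type*} [Fintype ι] [DecidableEq ι] {g : ℕ}

theorem cnt_update {w : ι → Fin g} {a : ι} {i j : Fin g} (ha : w a = i) (m : Fin g) :
    cnt (update w a j) m + (if m = i then 1 else 0) = cnt w m + if m = j then 1 else 0 := by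
  subst ha
  simp only [cnt, Finset.card_filter]
  rw [Fintype.sum_eq_add_sum_compl a, Fintype.sum_eq_add_sum_compl a (fun b => if w b = m then 1 else 0)]
  have h : ∑ b ∈ {a}ᶜ, (if update w a j b = m then 1 else 0) =
      ∑ b ∈ {a}ᶜ, if w b = m then 1 else 0 :=
    Finset.sum_congr rfl fun b hb => by rw [update_of_ne (by simpa using hb)]
  rw [h, update_self]
  simp only [eq_comm (a := m)]
  ring

theorem cnt_update_eq {w w' : ι → Fin g} {a a' : ι} {i j : Fin g} (ha : w a = i) (ha' : w' a' = i)
    (h : cnt w = cnt w') : cnt (update w a j) = cnt (update w' a' j) := by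
  funext m
  have h1 := cnt_update (j := j) ha m
  have h2 := cnt_update (j := j) ha' m
  rw [h] at h1
  omega

/-- A function on words in the letters `Fin g` is highest if it is killed by all raising
operators. -/
def IsHighest {R : Type*} [CommRing R] (x : (ι → Fin g) → R) : Prop :=
  ∀ i j, i < j → ∀ w, raise i j x w = 0

theorem IsHighest.weight {R : Type*} [CommRing R] {x : (ι → Fin g) → R} (hx : IsHighest x)
    (ν : Fin g → ℕ) : IsHighest fun w => if cnt w = ν then x w else 0 := by
  intro i j hij w
  simp only [raise]
  by_cases h : ∃ a, w a = i ∧ cnt (update w a j) = ν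
  · obtain ⟨a, ha, hν⟩ := h
    refine Eq.trans ?_ (hx i j hij w)
    refine Finset.sum_congr rfl fun b _ => ?_
    split_ifs with hb hc
    · rfl
    · exact absurd ((cnt_update_eq hb ha rfl).trans hν) hc
    · rfl
  · push Not at h
    refine Finset.sum_eq_zero fun a _ => ?_
    split_ifs with ha hν
    · exact absurd hν (h a ha)
    · rfl
    · rfl

theorem sum_swap_comm (x : (ι → Fin g) → ℚ) (i j : Fin g) (w : ι → Fin g) :
    ∑ a, ∑ b, (if w a = j ∧ w b = i then x (w ∘ Equiv.swap a b) else 0) =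
      ∑ a, ∑ b, if w a = i ∧ w b = j then x (w ∘ Equiv.swap a b) else 0 := by
  rw [Finset.sum_comm]
  refine Finset.sum_congr rfl fun a _ => Finset.sum_congr rfl fun b _ => ?_
  simp only [and_comm, Equiv.swap_comm a b]

theorem IsHighest.cnt_le_rat {x : (ι → Fin g) → ℚ} (hx : IsHighest x) {w : ι → Fin g}
    (hw : x w ≠ 0) {i j : Fin g} (hij : i < j) : cnt w j ≤ cnt w i := by
  set ν := cnt w with hν
  set y : (ι → Fin g) → ℚ := fun w => if cnt w = ν then x w else 0 with hy
  have hyh : IsHighest y := hx.weight ν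
  have h1 := sum_raise_mul j i y (raise j i y)
  have h2 : ∀ v, raise i j (raise j i y) v = ((ν i : ℚ) - ν j) * y v := by
    intro v
    have e1 := raise_raise hij.ne y v
    have e2 := raise_raise hij.ne' y v
    rw [sum_swap_comm] at e1
    have e3 : raise j i (raise i j y) v = 0 := by
      simp only [raise]
      exact Finset.sum_eq_zero fun a _ => by
        split_ifs
        · exact hyh i j hij _
        · rfl
    rw [e2]
    rw [e3] at e1
    by_cases hv : cnt v = ν
    · rw [← hv]; linear_combination -e1
    · have : y v = 0 := if_neg hv
      rw [this] at e1 ⊢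
      linear_combination -e1
  simp only [h2] at h1
  have h3 : 0 ≤ ((ν i : ℚ) - ν j) * ∑ v, y v * y v := by
    rw [Finset.mul_sum]
    have : ∀ v, ((ν i : ℚ) - ν j) * (y v * y v) = y v * (((ν i : ℚ) - ν j) * y v) := fun v => by ring
    simp only [this]
    rw [← h1]
    exact Finset.sum_nonneg fun v _ => mul_self_nonneg _
  have h4 : 0 < ∑ v, y v * y v := by
    refine Finset.sum_pos' (fun v _ => mul_self_nonneg _) ⟨w, Finset.mem_univ _, ?_⟩
    have : y w = x w := if_pos rfl
    rw [this]
    exact mul_self_pos.2 hw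
  have h5 := nonneg_of_mul_nonneg_left h3 h4
  have h6 : (ν j : ℚ) ≤ ν i := by linarith
  exact_mod_cast h6

theorem IsHighest.cnt_antitone {k : Type*} [Field k] [CharZero k] {x : (ι → Fin g) → k}
    (hx : IsHighest x) {w : ι → Fin g} (hw : x w ≠ 0) : Antitone (cnt w) := by
  intro i j hij
  rcases hij.eq_or_lt with rfl | hij
  · rfl
  by_contra h
  refine hw (eq_zero_of_forall_rat fun φ => ?_)
  by_contra h'
  refine h (IsHighest.cnt_le_rat (x := fun w => φ (x w)) ?_ h' hij)
  intro i j hij w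
  refine (raise_map φ.toAddMonoidHom i j x w).symm.trans ?_
  rw [hx i j hij w, map_zero]

/-- The sum of all transpositions of positions (each counted twice, and with the trivial ones). -/
def swapSum {L R : Type*} [CommRing R] (x : (ι → L) → R) (w : ι → L) : R :=
  ∑ a, ∑ b, x (w ∘ Equiv.swap a b)

/-- The eigenvalue of `swapSum` on a highest function of a given weight. -/
def casimir (ν : Fin g → ℕ) : ℤ := ∑ i, (ν i : ℤ) * (ν i - 2 * (i : ℕ))

theorem IsHighest.swapSum_eq {k : Type*} [Field k] {x : (ι → Fin g) → k}
    (hx : IsHighest x) (w : ι → Fin g) : swapSum x w = casimir (cnt w) * x w := by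
  have h1 : ∀ i j, i < j → ∑ a, ∑ b, (if w a = j ∧ w b = i then x (w ∘ Equiv.swap a b) else 0) =
      - (cnt w j * x w) := by
    intro i j hij
    have e1 := raise_raise hij.ne x w
    have e3 : raise j i (raise i j x) w = 0 := by
      simp only [raise]
      exact Finset.sum_eq_zero fun a _ => by
        split_ifs
        · exact hx i j hij _
        · rfl
    rw [e3] at e1
    linear_combination -e1
  have h2 : ∀ a b, x (w ∘ Equiv.swap a b) =
      (∑ i, if w a = i then (if w b = i then x w else 0) else 0) +
      ((∑ i, ∑ j, if i < j then (if w a = j ∧ w b = i then x (w ∘ Equiv.swap a b) else 0) else 0) +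
      ∑ i, ∑ j, if i < j then (if w b = j ∧ w a = i then x (w ∘ Equiv.swap b a) else 0) else 0) := by
    intro a b
    have key : ∀ (p q : Fin g) (c : k), (∑ i, ∑ j, if i < j then (if p = j ∧ q = i then c else 0) else 0)
        = if q < p then c else 0 := by
      intro p q c
      rw [Finset.sum_eq_single q, Finset.sum_eq_single p]
      · simp
      · intro j _ hj; simp [hj.symm]
      · simp
      · intro i _ hi; simp [hi.symm]
      · simp
    rw [key, key, Equiv.swap_comm b a]
    simp only [Finset.sum_ite_eq, Finset.mem_univ, if_true]
    rcases lt_trichotomy (w a) (w b) with h | h | h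
    · simp [h, h.ne', h.not_gt]
    · have h3 : w ∘ Equiv.swap a b = w := by
        funext c
        by_cases hcb : c = b
        · subst hcb; simp [h]
        by_cases hca : c = a
        · subst hca; simp [h]
        simp [Equiv.swap_apply_of_ne_of_ne hca hcb]
      simp [h, h3]
    · simp [h, h.ne, h.not_gt]
  have h3 : ∑ a, ∑ b, (∑ i, if w a = i then (if w b = i then x w else 0) else 0) =
      ∑ i, (cnt w i : k) * (cnt w i * x w) := by
    have : ∀ a, ∑ b, (∑ i, if w a = i then (if w b = i then x w else 0) else 0) =
        ∑ i, if w a = i then (cnt w i * x w) else 0 := by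
      intro a
      rw [Finset.sum_comm]
      refine Finset.sum_congr rfl fun i _ => ?_
      split_ifs
      · rw [sum_if_eq_cnt]
      · simp
    simp only [this]
    rw [Finset.sum_comm]
    exact Finset.sum_congr rfl fun i _ => sum_if_eq_cnt _ _ _
  have h4 : ∑ a, ∑ b, (∑ i, ∑ j,
      if i < j then (if w a = j ∧ w b = i then x (w ∘ Equiv.swap a b) else 0) else 0) =
      - ∑ j : Fin g, (j : ℕ) * (cnt w j * x w) := by
    calc _ = ∑ a, ∑ j, ∑ i, ∑ b, 
          (if i < j then (if w a = j ∧ w b = i then x (w ∘ Equiv.swap a b) else 0) else 0) := by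
          refine Finset.sum_congr rfl fun a _ => ?_
          calc _ = ∑ b, ∑ j, ∑ i, (if i < j then
                (if w a = j ∧ w b = i then x (w ∘ Equiv.swap a b) else 0) else 0) :=
                Finset.sum_congr rfl fun b _ => Finset.sum_comm
            _ = ∑ j, ∑ b, ∑ i, (if i < j then
                (if w a = j ∧ w b = i then x (w ∘ Equiv.swap a b) else 0) else 0) :=
                Finset.sum_comm
            _ = _ := Finset.sum_congr rfl fun j _ => Finset.sum_comm
      _ = ∑ j, ∑ i, ∑ a, ∑ b, 
          (if i < j then (if w a = j ∧ w b = i then x (w ∘ Equiv.swap a b) else 0) else 0) := by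
          rw [Finset.sum_comm]
          exact Finset.sum_congr rfl fun j _ => Finset.sum_comm
      _ = ∑ j, ∑ i, if i < j then -(cnt w j * x w) else 0 := by
          refine Finset.sum_congr rfl fun j _ => Finset.sum_congr rfl fun i _ => ?_
          split_ifs with h
          · exact h1 i j h
          · simp
      _ = _ := by
          rw [← Finset.sum_neg_distrib]
          refine Finset.sum_congr rfl fun j _ => ?_
          rw [← Finset.sum_filter, Finset.sum_const]
          have : (Finset.univ.filter fun i => i < j).card = (j : ℕ) := by
            rw [show (Finset.univ.filter fun i => i < j) = Finset.Iio j by ext; simp, Fin.card_Iio]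
          rw [this, nsmul_eq_mul]
          ring
  have h5 : ∑ a, ∑ b, (∑ i, ∑ j,
      if i < j then (if w b = j ∧ w a = i then x (w ∘ Equiv.swap b a) else 0) else 0) =
      - ∑ j : Fin g, (j : ℕ) * (cnt w j * x w) := by
    rw [← h4, Finset.sum_comm]
  rw [swapSum, Finset.sum_congr rfl fun a _ => Finset.sum_congr rfl fun b _ => h2 a b]
  simp_rw [Finset.sum_add_distrib (s := (Finset.univ : Finset ι))]
  rw [h3, h4, h5, casimir]
  push_cast
  rw [Finset.sum_mul, ← sub_eq_zero]
  simp only [← Finset.sum_neg_distrib, ← Finset.sum_add_distrib, ← Finset.sum_sub_distrib]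
  exact Finset.sum_eq_zero fun i _ => by ring

/-- `casimir` strictly decreases along the dominance order on antitone weights. -/
theorem eq_of_casimir_eq {μ ν : Fin g → ℕ} (hμ : Antitone μ) (hν : Antitone ν)
    (hle : ∀ m : ℕ, ∑ i ∈ Finset.univ.filter (fun i : Fin g => i.1 < m), ν i ≤
      ∑ i ∈ Finset.univ.filter (fun i : Fin g => i.1 < m), μ i)
    (hsum : ∑ i, ν i = ∑ i, μ i) (hc : casimir ν = casimir μ) : ν = μ := by
  set M : ℕ → ℤ := fun i => if h : i < g then μ ⟨i, h⟩ else 0 with hM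
  set N : ℕ → ℤ := fun i => if h : i < g then ν ⟨i, h⟩ else 0 with hN
  have hMa : ∀ i, M (i + 1) ≤ M i := by
    intro i
    simp only [hM]
    split_ifs with h1 h2
    · exact_mod_cast hμ (by simp)
    · omega
    · positivity
    · rfl
  have hNa : ∀ i, N (i + 1) ≤ N i := by
    intro i
    simp only [hN]
    split_ifs with h1 h2
    · exact_mod_cast hν (by simp)
    · omega
    · positivity
    · rfl
  have hpart : ∀ (f : Fin g → ℕ) (m : ℕ), m ≤ g →
      ((∑ i with Fin.val i < m, f i : ℕ) : ℤ) =
        ∑ i ∈ Finset.range m, if h : i < g then (f ⟨i, h⟩ : ℤ) else 0 := by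
    intro f m hm
    push_cast
    refine Finset.sum_bij (fun i _ => (i : ℕ)) ?_ ?_ ?_ ?_
    · simp
    · intro a _ b _ h; exact Fin.ext h
    · intro b hb
      have hb : b < m := by simpa using hb
      exact ⟨⟨b, by omega⟩, by simpa using hb, rfl⟩
    · intro a _; simp
  set D : ℕ → ℤ := fun n => ∑ i ∈ Finset.range n, (M i - N i) with hD
  have hD0 : ∀ n ≤ g, 0 ≤ D n := by
    intro n hn
    have h1 := hpart μ n hn
    have h2 := hpart ν n hn
    have h3 := hle n
    simp only [hD, Finset.sum_sub_distrib]
    simp only [hM, hN]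
    rw [← h1, ← h2]
    omega
  have hDg : D g = 0 := by
    simp only [hD, Finset.sum_sub_distrib, hM, hN]
    rw [← hpart μ g le_rfl, ← hpart ν g le_rfl]
    have : (Finset.univ.filter fun i : Fin g => (i : ℕ) < g) = Finset.univ := by ext i; simp
    rw [this, hsum, sub_self]
  set S : ℕ → ℤ := fun n => ∑ i ∈ Finset.range n, (M i - N i) * (M i + N i - 2 * i) with hS
  have hSg : S g = 0 := by
    have h1 : S g = casimir μ - casimir ν := by
      simp only [hS, casimir, ← Finset.sum_sub_distrib]
      rw [Finset.sum_range]
      refine Finset.sum_congr rfl fun i _ => ?_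
      simp only [hM, hN, Fin.is_lt, dif_pos]
      ring
    rw [h1, hc, sub_self]
  have key : ∀ n ≤ g, 2 * ∑ i ∈ Finset.range n, D (i + 1) ≤ S n - D n * (M n + N n - 2 * n) := by
    intro n
    induction n with
    | zero => simp [hD, hS]
    | succ n ih =>
      intro hn
      have h1 := ih (by omega)
      have h2 := hD0 (n + 1) hn
      have h3 : D (n + 1) = D n + (M n - N n) := Finset.sum_range_succ _ _
      have h4 : S (n + 1) = S n + (M n - N n) * (M n + N n - 2 * n) := Finset.sum_range_succ _ _
      rw [Finset.sum_range_succ, h4]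
      have h5 := hMa n
      have h6 := hNa n
      have h7 : D (n + 1) * 2 ≤ D (n + 1) * ((M n + N n - 2 * n) -
          (M (n + 1) + N (n + 1) - 2 * ((n + 1 : ℕ) : ℤ))) := by
        refine mul_le_mul_of_nonneg_left ?_ h2
        push_cast
        linarith
      rw [h3] at h7 ⊢
      linarith
  have h1 := key g le_rfl
  rw [hSg, hDg] at h1
  have h2 : ∀ i ∈ Finset.range g, 0 ≤ D (i + 1) := fun i hi => hD0 _ (by simpa using hi)
  have h3 : ∑ i ∈ Finset.range g, D (i + 1) = 0 :=
    le_antisymm (by linarith) (Finset.sum_nonneg h2)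
  rw [Finset.sum_eq_zero_iff_of_nonneg h2] at h3
  have hDz : ∀ n ≤ g, D n = 0 := by
    intro n hn
    rcases n with _ | n
    · simp [hD]
    · exact h3 n (by simpa using hn)
  funext i
  have h4 : D (i + 1) = D i + (M i - N i) := Finset.sum_range_succ _ _
  rw [hDz _ i.2, hDz _ i.2.le] at h4
  simp only [hM, hN, Fin.is_lt, dif_pos, Fin.eta] at h4
  omega

end Highest

section Coordinates

variable {k H : Type*} [Field k] [AddCommGroup H] [Module k H] {g : ℕ}
  (b : Module.Basis (Fin g ⊕ Fin g) k H) {ι : Type*} [Fintype ι]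

/-- The coordinates of a tensor, indexed by the words in the basis. -/
noncomputable def coord : (⨂[k] _ : ι, H) →ₗ[k] (ι → Fin g ⊕ Fin g) → k :=
  (Basis.piTensorProduct fun _ : ι => b).equivFun.toLinearMap

@[simp]
theorem coord_tprod (v : ι → H) (w : ι → Fin g ⊕ Fin g) :
    coord b (PiTensorProduct.tprod k v) w = ∏ a, b.repr (v a) (w a) :=
  Basis.piTensorProduct_repr_tprod_apply (fun _ : ι => b) v w

theorem coord_injective : Function.Injective (coord (k := k) b (ι := ι)) :=
  (Basis.piTensorProduct fun _ : ι => b).equivFun.injective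

theorem eq_zero_of_coord {x : ⨂[k] _ : ι, H} (h : ∀ w, coord b x w = 0) : x = 0 :=
  coord_injective b (by rw [map_zero]; exact funext h)

theorem coord_reindex {ι' : Type*} [Fintype ι'] (e : ι ≃ ι') (x : ⨂[k] _ : ι, H)
    (w : ι' → Fin g ⊕ Fin g) :
    coord b (PiTensorProduct.reindex k (fun _ => H) e x) w = coord b x (w ∘ e) := by
  have h : (LinearMap.proj w ∘ₗ coord b) ∘ₗ
      (PiTensorProduct.reindex k (fun _ => H) e).toLinearMap =
      LinearMap.proj (w ∘ e) ∘ₗ coord b (ι := ι) := by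
    ext v
    simp only [LinearMap.compMultilinearMap_apply, LinearMap.comp_apply, LinearEquiv.coe_coe,
      PiTensorProduct.reindex_tprod, LinearMap.proj_apply]
    refine (coord_tprod b _ _).trans ?_
    rw [coord_tprod, ← e.symm.prod_comp]
    simp
  exact LinearMap.congr_fun h x

variable [DecidableEq ι]

/-- The action of an endomorphism on a tensor power as a derivation. -/
noncomputable def deriv (E : H →ₗ[k] H) : (⨂[k] _ : ι, H) →ₗ[k] ⨂[k] _ : ι, H :=
  ∑ a, PiTensorProduct.map (update (fun _ => LinearMap.id) a E)

theorem coord_deriv (E : H →ₗ[k] H) (x : ⨂[k] _ : ι, H) (w : ι → Fin g ⊕ Fin g) :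
    coord b (deriv E x) w = ∑ a, ∑ l, b.repr (E (b l)) (w a) * coord b x (update w a l) := by
  have h : (LinearMap.proj w ∘ₗ coord b) ∘ₗ deriv E = ∑ a, ∑ l, b.repr (E (b l)) (w a) •
      (LinearMap.proj (update w a l) ∘ₗ coord b (ι := ι)) := by
    ext v
    simp only [deriv, LinearMap.compMultilinearMap_apply, LinearMap.comp_apply,
      LinearMap.sum_apply, LinearMap.smul_apply, LinearMap.proj_apply, PiTensorProduct.map_tprod,
      map_sum, coord_tprod, smul_eq_mul]
    refine Finset.sum_congr rfl fun a _ => ?_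
    have h1 : ∀ l, ∏ c, b.repr (v c) (update w a l c) =
        b.repr (v a) l * ∏ c ∈ {a}ᶜ, b.repr (v c) (w c) := by
      intro l
      rw [Fintype.prod_eq_mul_prod_compl a, update_self]
      exact congrArg _ (Finset.prod_congr rfl fun c hc => by
        rw [update_of_ne (by simpa using hc)])
    rw [Fintype.prod_eq_mul_prod_compl a, update_self]
    have h2 : ∏ c ∈ {a}ᶜ, b.repr ((update (fun _ => LinearMap.id) a E : ι → H →ₗ[k] H) c (v c))
        (w c) = ∏ c ∈ {a}ᶜ, b.repr (v c) (w c) :=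
      Finset.prod_congr rfl fun c hc => by
        rw [update_of_ne (by simpa using hc), LinearMap.id_apply]
    rw [h2]
    simp only [h1, ← mul_assoc, ← Finset.sum_mul]
    congr 1
    conv_lhs => rw [← b.sum_repr (v a)]
    simp only [map_sum, map_smul, Finsupp.coe_finsetSum, Finset.sum_apply, Finsupp.smul_apply,
      smul_eq_mul, mul_comm]
  have := LinearMap.congr_fun h x
  simpa [LinearMap.sum_apply, Finset.sum_apply] using this

theorem coord_contraction (ω : LinearMap.BilinForm k H) {i j : ι} (hij : i ≠ j)
    (x : ⨂[k] _ : ι, H) (w : ι → Fin g ⊕ Fin g) :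
    coord b (contraction ω hij x) (fun l => w l) =
      ∑ m, ∑ n, ω (b m) (b n) * coord b x (update (update w i m) j n) := by
  have h : (LinearMap.proj (fun l : {l // l ≠ i ∧ l ≠ j} => w l) ∘ₗ coord b) ∘ₗ
      contraction ω hij = ∑ m, ∑ n, ω (b m) (b n) •
      (LinearMap.proj (update (update w i m) j n) ∘ₗ coord b (ι := ι)) := by
    ext v
    simp only [LinearMap.compMultilinearMap_apply, LinearMap.comp_apply,
      LinearMap.sum_apply, LinearMap.smul_apply, LinearMap.proj_apply, contraction_tprod,
      map_smul, coord_tprod, smul_eq_mul]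
    have h1 : ∀ m n, ∏ c, b.repr (v c) (update (update w i m) j n c) =
        b.repr (v i) m * b.repr (v j) n * ∏ c : {l // l ≠ i ∧ l ≠ j}, b.repr (v c) (w c) := by
      intro m n
      rw [Fintype.prod_eq_mul_prod_compl j, update_self,
        ← Finset.mul_prod_erase _ _ (by simpa using hij : i ∈ ({j}ᶜ : Finset ι)),
        update_of_ne hij, update_self]
      rw [Finset.prod_congr (s₂ := ({j}ᶜ : Finset ι).erase i) rfl
        (g := fun c => b.repr (v c) (w c)) fun c hc => ?_]
      · rw [← Finset.prod_subtype (p := fun l => l ≠ i ∧ l ≠ j) (({j}ᶜ : Finset ι).erase i)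
          (by simp) (fun c => b.repr (v c) (w c))]
        ring
      · have hc : c ≠ i ∧ c ≠ j := by simpa using hc
        rw [update_of_ne hc.2, update_of_ne hc.1]
    simp only [h1, ← mul_assoc, ← Finset.sum_mul]
    congr 1
    conv_lhs => rw [← b.sum_repr (v i), ← b.sum_repr (v j)]
    simp only [map_sum, map_smul, LinearMap.sum_apply, LinearMap.smul_apply, smul_eq_mul,
      Finset.mul_sum]
    rw [Finset.sum_comm]
    exact Finset.sum_congr rfl fun m _ => Finset.sum_congr rfl fun n _ => by ring
  have := LinearMap.congr_fun h x
  simpa [LinearMap.sum_apply, Finset.sum_apply] using this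

theorem wordTraceless_of_mem {ω : LinearMap.BilinForm k H} (hb : IsSymplecticBasis ω b)
    {x : ⨂[k] _ : ι, H} (hx : x ∈ traceless ω ι) : WordTraceless (coord b x) := by
  intro i j hij w
  have h := coord_contraction b ω hij x w
  rw [mem_traceless.1 hx i j hij, map_zero] at h
  simp only [Fintype.sum_sum_type, hb.p_p, hb.q_q, hb.p_q, hb.q_p, zero_mul, ite_mul, one_mul,
    Finset.sum_const_zero, Finset.sum_ite_eq, Finset.mem_univ, if_true, zero_add,
    add_zero, Pi.zero_apply, neg_mul, Finset.sum_add_distrib, Finset.sum_neg_distrib] at h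
  exact (sub_eq_zero.1 ((sub_eq_neg_add _ _).trans h.symm))

end Coordinates

section Symplectic

variable {k H : Type*} [Field k] [AddCommGroup H] [Module k H] {g : ℕ}
  {b : Module.Basis (Fin g ⊕ Fin g) k H} {ω : LinearMap.BilinForm k H}

theorem IsSymplecticBasis.neg_flip (hb : IsSymplecticBasis ω b) (x y : H) : ω x y = -ω y x := by
  have h : ω = -ω.flip := by
    refine b.ext fun i => b.ext fun j => ?_
    rcases i with i | i <;> rcases j with j | j <;>
      simp [hb.p_p, hb.q_q, hb.p_q, hb.q_p, eq_comm]
    all_goals split_ifs <;> simp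
  exact LinearMap.congr_fun₂ h x y

theorem IsSymplecticBasis.self_eq_zero [CharZero k] (hb : IsSymplecticBasis ω b) (x : H) :
    ω x x = 0 :=
  self_eq_neg.1 (hb.neg_flip x x)

/-- The endomorphism `h ↦ ω(u, h) v + ω(v, h) u` in the symplectic Lie algebra. -/
def sympEnd (ω : LinearMap.BilinForm k H) (u v : H) : H →ₗ[k] H :=
  (ω u).smulRight v + (ω v).smulRight u

theorem sympEnd_apply (u v h : H) : sympEnd ω u v h = ω u h • v + ω v h • u := rfl

theorem sympEnd_sympEnd [CharZero k] (hb : IsSymplecticBasis ω b) {u v : H} (huv : ω u v = 0)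
    (h : H) : sympEnd ω u v (sympEnd ω u v h) = 0 := by
  have hvu : ω v u = 0 := by rw [hb.neg_flip, huv, neg_zero]
  simp [sympEnd_apply, huv, hvu, hb.self_eq_zero]

/-- The symplectic automorphism `1 + t E` for `E = sympEnd ω u v` with `E ^ 2 = 0`. -/
def sympUnipotent [CharZero k] (hb : IsSymplecticBasis ω b) {u v : H} (huv : ω u v = 0) (t : k) :
    Sp ω :=
  ⟨LinearEquiv.ofLinearMap (LinearMap.id + t • sympEnd ω u v) (LinearMap.id - t • sympEnd ω u v)
    (by ext h; simp [sympEnd_sympEnd hb huv]) (by ext h; simp [sympEnd_sympEnd hb huv]), by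
    intro x y
    have hvu : ω v u = 0 := by rw [hb.neg_flip, huv, neg_zero]
    simp only [LinearEquiv.coe_ofLinearMap, LinearMap.add_apply, LinearMap.id_apply,
      LinearMap.smul_apply, sympEnd_apply, map_add, map_smul, smul_eq_mul, huv, hvu,
      hb.self_eq_zero, hb.neg_flip x u, hb.neg_flip x v]
    ring⟩

theorem coeff_mem_of_forall_sum_pow_mem [Infinite k] {V : Type*} [AddCommGroup V] [Module k V]
    (Y : Submodule k V) (n : ℕ) (y : ℕ → V)
    (h : ∀ t : k, ∑ m ∈ Finset.range n, t ^ m • y m ∈ Y) {m : ℕ} (hm : m < n) : y m ∈ Y := by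
  by_contra hy
  obtain ⟨φ, hφ, hY⟩ := Submodule.exists_dual_map_eq_bot_of_notMem hy inferInstance
  have hY' : ∀ v ∈ Y, φ v = 0 := by
    intro v hv
    have : φ v ∈ Y.map φ := Submodule.mem_map_of_mem hv
    rwa [hY, Submodule.mem_bot] at this
  set p : Polynomial k := ∑ m ∈ Finset.range n, Polynomial.monomial m (φ (y m)) with hp
  have hp0 : p = 0 := by
    refine Polynomial.funext fun t => ?_
    have h1 := hY' _ (h t)
    simp only [map_sum, map_smul, smul_eq_mul] at h1
    simp only [hp, Polynomial.eval_finsetSum, Polynomial.eval_monomial, Polynomial.eval_zero]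
    rw [← h1]
    exact Finset.sum_congr rfl fun m _ => mul_comm _ _
  have h2 : p.coeff m = φ (y m) := by
    simp [hp, Polynomial.coeff_monomial, hm]
  rw [hp0, Polynomial.coeff_zero] at h2
  exact hφ h2.symm

variable {I : Type*} {ι : I → Type*} [∀ i, Fintype (ι i)] [∀ i, DecidableEq (ι i)]

theorem map_id_add_smul {ι : Type*} [Fintype ι] [DecidableEq ι] (E : H →ₗ[k] H) (t : k)
    {s : ℕ} (hs : Fintype.card ι ≤ s) :
    PiTensorProduct.map (fun _ : ι => LinearMap.id + t • E) =
      ∑ m ∈ Finset.range (s + 1), t ^ m • ∑ A : Finset ι with A.card = m,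
        PiTensorProduct.map (A.piecewise (fun _ => E) fun _ => LinearMap.id) := by
  have h1 : PiTensorProduct.map (fun _ : ι => LinearMap.id + t • E) =
      ∑ A : Finset ι, t ^ A.card •
        PiTensorProduct.map (A.piecewise (fun _ => E) fun _ => LinearMap.id) := by
    have h2 := (PiTensorProduct.mapMultilinear k (fun _ : ι => H) (fun _ : ι => H)).map_add_univ
      (fun _ => t • E) (fun _ => LinearMap.id)
    have h3 : (fun _ : ι => LinearMap.id + t • E) = (fun _ => t • E) + fun _ => LinearMap.id := by
      funext i; exact add_comm _ _
    rw [h3]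
    refine h2.trans (Finset.sum_congr rfl fun A _ => ?_)
    have h4 := (PiTensorProduct.mapMultilinear k (fun _ : ι => H)
      (fun _ : ι => H)).map_piecewise_smul (fun _ => t)
      (A.piecewise (fun _ => E) fun _ => LinearMap.id) A
    rw [Finset.prod_const] at h4
    refine Eq.trans (congrArg _ ?_) h4
    funext i
    by_cases hi : i ∈ A <;> simp [hi]
  rw [h1, ← Finset.sum_fiberwise_of_maps_to (s := Finset.univ) (t := Finset.range (s + 1))
    (g := Finset.card)]
  · refine Finset.sum_congr rfl fun m _ => ?_
    rw [Finset.smul_sum]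
    exact Finset.sum_congr rfl fun A hA => by rw [(Finset.mem_filter.1 hA).2]
  · intro A _
    exact Finset.mem_range.2 (Nat.lt_succ_of_le ((Finset.card_le_univ A).trans hs))

theorem deriv_mem [CharZero k] (hb : IsSymplecticBasis ω b) {s : ℕ}
    (hs : ∀ i, Fintype.card (ι i) ≤ s) (Y : Submodule k (∀ i, ⨂[k] _ : ι i, H))
    (hY : ∀ (f : Sp ω), ∀ y ∈ Y, (fun i => tensorRep ω (ι i) f (y i)) ∈ Y) {u v : H}
    (huv : ω u v = 0) {y : ∀ i, ⨂[k] _ : ι i, H} (hy : y ∈ Y) :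
    (fun i => deriv (sympEnd ω u v) (y i)) ∈ Y := by
  rcases Nat.eq_zero_or_pos s with rfl | hs0
  · have : (fun i => deriv (sympEnd ω u v) (y i)) = 0 := by
      funext i
      have : IsEmpty (ι i) := Fintype.card_eq_zero_iff.1 (Nat.le_zero.1 (hs i))
      simp [deriv]
    rw [this]
    exact Y.zero_mem
  have h1 := coeff_mem_of_forall_sum_pow_mem Y (s + 1) (fun m i => ∑ A : Finset (ι i) with A.card = m,
        PiTensorProduct.map (A.piecewise (fun _ => sympEnd ω u v) fun _ => LinearMap.id) (y i))
    (fun t => by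
      have h2 := hY (sympUnipotent hb huv t) y hy
      convert h2 using 1
      funext i
      have h3 := LinearMap.congr_fun (map_id_add_smul (sympEnd ω u v) t (hs i)) (y i)
      refine Eq.trans ?_ h3.symm
      simp [LinearMap.sum_apply, Finset.sum_apply]) (m := 1) (by omega)
  convert h1 using 1
  funext i
  rw [deriv, LinearMap.sum_apply]
  have h4 : (Finset.univ.filter fun A : Finset (ι i) => A.card = 1) =
      Finset.univ.map ⟨fun a => {a}, Finset.singleton_injective⟩ := by
    ext A
    simp [Finset.card_eq_one, eq_comm]
  rw [h4, Finset.sum_map]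
  refine Finset.sum_congr rfl fun a _ => ?_
  simp [Finset.piecewise_singleton]

end Symplectic

section Highest

variable {k H : Type*} [Field k] [AddCommGroup H] [Module k H] {g : ℕ}
  {b : Module.Basis (Fin g ⊕ Fin g) k H} {ω : LinearMap.BilinForm k H}

theorem coord_deriv_p_p (hb : IsSymplecticBasis ω b) {ι : Type*} [Fintype ι] [DecidableEq ι]
    (m l : Fin g) (x : ⨂[k] _ : ι, H) (w : ι → Fin g ⊕ Fin g) :
    coord b (deriv (sympEnd ω (b (Sum.inl m)) (b (Sum.inl l))) x) w =
      raise (Sum.inl l) (Sum.inr m) (coord b x) w +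
        raise (Sum.inl m) (Sum.inr l) (coord b x) w := by
  rw [coord_deriv, raise, raise, ← Finset.sum_add_distrib]
  refine Finset.sum_congr rfl fun a _ => ?_
  simp only [sympEnd_apply, map_add, map_smul, Fintype.sum_sum_type, hb.p_p, hb.p_q, zero_smul,
    Finsupp.coe_zero, Pi.zero_apply, zero_mul, Finset.sum_const_zero, zero_add,
    ite_smul, one_smul, Module.Basis.repr_self, Finsupp.add_apply, add_mul, Finset.sum_add_distrib]
  congr 1
  · rw [Finset.sum_eq_single m]
    · simp [Finsupp.single_apply, eq_comm]
    · intro n _ hn; simp [hn.symm]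
    · simp
  · rw [Finset.sum_eq_single l]
    · simp [Finsupp.single_apply, eq_comm]
    · intro n _ hn; simp [hn.symm]
    · simp

theorem coord_deriv_p_q (hb : IsSymplecticBasis ω b) {ι : Type*} [Fintype ι] [DecidableEq ι]
    (i j : Fin g) (x : ⨂[k] _ : ι, H) (w : ι → Fin g ⊕ Fin g) :
    coord b (deriv (sympEnd ω (b (Sum.inl i)) (b (Sum.inr j))) x) w =
      raise (Sum.inr j) (Sum.inr i) (coord b x) w -
        raise (Sum.inl i) (Sum.inl j) (coord b x) w := by
  rw [coord_deriv, raise, raise, ← Finset.sum_sub_distrib]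
  refine Finset.sum_congr rfl fun a _ => ?_
  simp only [sympEnd_apply, map_add, map_smul, Fintype.sum_sum_type, hb.p_p, hb.p_q, hb.q_p,
    hb.q_q, zero_smul, add_zero, zero_add, ite_smul, one_smul, neg_smul, Module.Basis.repr_self]
  rw [Finset.sum_eq_single j, Finset.sum_eq_single i]
  · simp [Finsupp.single_apply, eq_comm, sub_eq_neg_add]
  · intro n _ hn; simp [hn.symm]
  · simp
  · intro n _ hn; simp [hn.symm]
  · simp

/-- The height of a basis vector, for the order `p_1 > ⋯ > p_g > q_g > ⋯ > q_1`. -/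
def letterHeight : Fin g ⊕ Fin g → ℕ
  | Sum.inl i => 2 * g - i
  | Sum.inr i => i

theorem letterHeight_le (l : Fin g ⊕ Fin g) : letterHeight l ≤ 2 * g := by
  rcases l with i | i
  · exact Nat.sub_le _ _
  · have := i.2
    simp only [letterHeight]
    omega

theorem exists_of_raise_ne_zero {ι : Type*} [Fintype ι] [DecidableEq ι] {i j : Fin g ⊕ Fin g}
    (hij : letterHeight j < letterHeight i) {x : (ι → Fin g ⊕ Fin g) → k} {n : ℕ}
    (hx : ∀ w, x w ≠ 0 → n ≤ ∑ a, letterHeight (w a)) {w : ι → Fin g ⊕ Fin g}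
    (hw : raise i j x w ≠ 0) : n + 1 ≤ ∑ a, letterHeight (w a) := by
  obtain ⟨a, -, ha⟩ := Finset.exists_ne_zero_of_sum_ne_zero hw
  have hai : w a = i := by
    by_contra h
    simp [h] at ha
  rw [if_pos hai] at ha
  have h1 := hx _ ha
  rw [Fintype.sum_eq_add_sum_compl a] at h1 ⊢
  have h2 : ∑ c ∈ {a}ᶜ, letterHeight (update w a j c) = ∑ c ∈ {a}ᶜ, letterHeight (w c) :=
    Finset.sum_congr rfl fun c hc => by rw [update_of_ne (by simpa using hc)]
  rw [h2, update_self] at h1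
  rw [hai]
  omega

/-- A tensor is a highest vector if it only involves the vectors `p_i` and is killed by the
raising operators. -/
structure IsHighestVector {ι : Type*} [Fintype ι] [DecidableEq ι]
    (b : Module.Basis (Fin g ⊕ Fin g) k H) (x : ⨂[k] _ : ι, H) : Prop where
  eq_zero : ∀ w a m, w a = Sum.inr m → coord b x w = 0
  isHighest : IsHighest fun w : ι → Fin g => coord b x fun a => Sum.inl (w a)

/-- The pairs of basis vectors that give the raising operators. -/
def IsRaisingPair (u v : Fin g ⊕ Fin g) : Prop :=
  (∃ m l, u = Sum.inl m ∧ v = Sum.inl l) ∨ ∃ i j, i < j ∧ u = Sum.inl i ∧ v = Sum.inr j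

theorem IsRaisingPair.pairing (hb : IsSymplecticBasis ω b) {u v : Fin g ⊕ Fin g}
    (h : IsRaisingPair u v) : ω (b u) (b v) = 0 := by
  rcases h with ⟨m, l, rfl, rfl⟩ | ⟨i, j, hij, rfl, rfl⟩
  · exact hb.p_p _ _
  · rw [hb.p_q, if_neg hij.ne]

theorem IsRaisingPair.height (hb : IsSymplecticBasis ω b) {ι : Type*} [Fintype ι] [DecidableEq ι]
    {u v : Fin g ⊕ Fin g} (h : IsRaisingPair u v) {x : ⨂[k] _ : ι, H} {n : ℕ}
    (hx : ∀ w, coord b x w ≠ 0 → n ≤ ∑ a, letterHeight (w a)) {w : ι → Fin g ⊕ Fin g}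
    (hw : coord b (deriv (sympEnd ω (b u) (b v)) x) w ≠ 0) :
    n + 1 ≤ ∑ a, letterHeight (w a) := by
  have h2 : ∀ m l : Fin g, letterHeight (Sum.inr m : Fin g ⊕ Fin g) <
      letterHeight (Sum.inl l : Fin g ⊕ Fin g) := by
    intro m l
    have h1 := m.2
    have h2 := l.2
    simp only [letterHeight]
    omega
  rcases h with ⟨m, l, rfl, rfl⟩ | ⟨i, j, hij, rfl, rfl⟩
  · rw [coord_deriv_p_p hb] at hw
    by_cases h1 : raise (Sum.inl l) (Sum.inr m) (coord b x) w = 0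
    · rw [h1, zero_add] at hw
      exact exists_of_raise_ne_zero (h2 _ _) hx hw
    · exact exists_of_raise_ne_zero (h2 _ _) hx h1
  · rw [coord_deriv_p_q hb] at hw
    have hij' : (i : ℕ) < j := hij
    have hj := j.2
    by_cases h1 : raise (Sum.inr j) (Sum.inr i) (coord b x) w = 0
    · rw [h1, zero_sub] at hw
      refine exists_of_raise_ne_zero ?_ hx (neg_ne_zero.1 hw)
      simp only [letterHeight]
      omega
    · refine exists_of_raise_ne_zero ?_ hx h1
      simpa only [letterHeight]

theorem isHighestVector_of_deriv_eq_zero [CharZero k] (hb : IsSymplecticBasis ω b)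
    {ι : Type*} [Fintype ι] [DecidableEq ι] {x : ⨂[k] _ : ι, H} (hx : x ∈ traceless ω ι)
    (h : ∀ u v, IsRaisingPair u v → deriv (sympEnd ω (b u) (b v)) x = 0) :
    IsHighestVector b x := by
  have h0 : ∀ w a m, w a = Sum.inr m → coord b x w = 0 := fun w a m hw =>
    eq_zero_of_raise_symm (wordTraceless_of_mem b hb hx) (fun m l w => by
      rw [← coord_deriv_p_p hb, h _ _ (Or.inl ⟨m, l, rfl, rfl⟩), map_zero, Pi.zero_apply]) hw
  refine ⟨h0, fun i j hij w => ?_⟩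
  have h1 := coord_deriv_p_q hb i j x (fun a => Sum.inl (w a))
  rw [h _ _ (Or.inr ⟨i, j, hij, rfl, rfl⟩), map_zero, Pi.zero_apply] at h1
  have h2 : raise (Sum.inr j) (Sum.inr i) (coord b x) (fun a => Sum.inl (w a)) = 0 := by
    simp [raise]
  rw [h2, zero_sub, eq_comm, neg_eq_zero] at h1
  rw [← h1, raise, raise]
  refine Finset.sum_congr rfl fun a _ => ?_
  simp only [Sum.inl.injEq]
  split_ifs
  · refine congrArg _ (funext fun c => ?_)
    by_cases hc : c = a
    · subst hc; simp
    · simp [hc]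
  · rfl

theorem exists_isHighestVector [CharZero k] (hb : IsSymplecticBasis ω b) {I : Type*}
    {ι : I → Type*} [∀ i, Fintype (ι i)] [∀ i, DecidableEq (ι i)] {s : ℕ}
    (hs : ∀ i, Fintype.card (ι i) ≤ s) (Y : Submodule k (∀ i, ⨂[k] _ : ι i, H))
    (hY : ∀ (f : Sp ω), ∀ y ∈ Y, (fun i => tensorRep ω (ι i) f (y i)) ∈ Y)
    (ht : ∀ y ∈ Y, ∀ i, y i ∈ traceless ω (ι i)) (hne : Y ≠ ⊥) :
    ∃ y ∈ Y, y ≠ 0 ∧ ∀ i, IsHighestVector b (y i) := by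
  by_contra! hcon
  have step : ∀ n : ℕ, ∃ y ∈ Y, y ≠ 0 ∧
      ∀ i w, coord b (y i) w ≠ 0 → n ≤ ∑ a, letterHeight (w a) := by
    intro n
    induction n with
    | zero =>
      obtain ⟨y, hy, hy0⟩ := Y.ne_bot_iff.1 hne
      exact ⟨y, hy, hy0, fun _ _ _ => Nat.zero_le _⟩
    | succ n ih =>
      obtain ⟨y, hy, hy0, hn⟩ := ih
      obtain ⟨i, hi⟩ := hcon y hy hy0
      have : ∃ u v, IsRaisingPair u v ∧ deriv (sympEnd ω (b u) (b v)) (y i) ≠ 0 := by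
        by_contra! h
        exact hi (isHighestVector_of_deriv_eq_zero hb (ht y hy i) h)
      obtain ⟨u, v, huv, hne⟩ := this
      refine ⟨_, deriv_mem hb hs Y hY (huv.pairing hb) hy, fun h => hne (congrFun h i), ?_⟩
      intro j w hw
      exact huv.height hb (hn j) hw
  obtain ⟨y, -, hy0, hn⟩ := step (s * (2 * g) + 1)
  refine hy0 (funext fun i => eq_zero_of_coord b fun w => ?_)
  by_contra hw
  have h1 := hn i w hw
  have h2 : ∑ a, letterHeight (w a) ≤ s * (2 * g) := by
    calc ∑ a, letterHeight (w a) ≤ ∑ _a : ι i, 2 * g :=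
          Finset.sum_le_sum fun a _ => letterHeight_le _
      _ = Fintype.card (ι i) * (2 * g) := by simp
      _ ≤ _ := Nat.mul_le_mul_right _ (hs i)
  omega

theorem exists_isHighestVector_of_stable [CharZero k] (hb : IsSymplecticBasis ω b) {ι : Type*}
    [Fintype ι] [DecidableEq ι] (Y : Submodule k (⨂[k] _ : ι, H))
    (hY : ∀ (f : Sp ω), ∀ y ∈ Y, tensorRep ω ι f y ∈ Y) (ht : Y ≤ traceless ω ι) (hne : Y ≠ ⊥) :
    ∃ y ∈ Y, y ≠ 0 ∧ IsHighestVector b y := by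
  obtain ⟨y, hy, hy0, h⟩ := exists_isHighestVector hb (I := Unit) (ι := fun _ => ι)
    (fun _ => le_rfl) (Y.comap (LinearMap.proj ()))
    (fun f y hy => hY f _ hy) (fun y hy _ => ht hy) (by
      obtain ⟨y, hy, hy0⟩ := Y.ne_bot_iff.1 hne
      exact (Submodule.ne_bot_iff _).2 ⟨fun _ => y, hy, fun h => hy0 (congrFun h ())⟩)
  exact ⟨y (), hy, fun h => hy0 (funext fun _ => h), h ()⟩

end Highest

section Columns

variable {μ : YoungDiagram} {g : ℕ}

/-- The word that numbers the cells of a Young diagram by their rows. -/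
def rowWord (hμ : ∀ c : μ.cells, c.1.1 < g) (c : μ.cells) : Fin g := ⟨c.1.1, hμ c⟩

/-- Functions on words that are antisymmetric in the columns of a Young diagram. -/
def IsColumnAntisymm {L k : Type*} [CommRing k] (x : (μ.cells → L) → k) : Prop :=
  ∀ σ ∈ columnGroup μ, ∀ w, x (w ∘ σ) = (Equiv.Perm.sign σ : ℤ) * x w

theorem swap_mem_columnGroup {c c' : μ.cells} (h : c.1.2 = c'.1.2) :
    Equiv.swap c c' ∈ columnGroup μ := by
  intro d
  rcases eq_or_ne d c with rfl | h1
  · simp [h]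
  rcases eq_or_ne d c' with rfl | h2
  · simp [h]
  rw [Equiv.swap_apply_of_ne_of_ne h1 h2]

theorem IsColumnAntisymm.injOn {L k : Type*} [Field k] [CharZero k] {x : (μ.cells → L) → k}
    (hx : IsColumnAntisymm x) {w : μ.cells → L} (hw : x w ≠ 0) {c c' : μ.cells}
    (hcol : c.1.2 = c'.1.2) (hwc : w c = w c') : c = c' := by
  by_contra hne
  have h1 := hx _ (swap_mem_columnGroup hcol) w
  have h2 : w ∘ Equiv.swap c c' = w := by
    funext d
    rcases eq_or_ne d c with rfl | h1
    · simp [hwc]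
    rcases eq_or_ne d c' with rfl | h2
    · simp [hwc]
    simp [Equiv.swap_apply_of_ne_of_ne h1 h2]
  rw [h2, Equiv.Perm.sign_swap hne] at h1
  simp only [Units.val_neg, Units.val_one, Int.cast_neg, Int.cast_one, neg_mul, one_mul] at h1
  exact hw (self_eq_neg.1 h1)

theorem sum_cnt_lt {ι : Type*} [Fintype ι] [DecidableEq ι] (w : ι → Fin g) (m : ℕ) :
    ∑ i ∈ Finset.univ.filter (fun i : Fin g => i.1 < m), cnt w i =
      (Finset.univ.filter fun c => (w c : ℕ) < m).card := by
  rw [Finset.card_eq_sum_card_fiberwise (f := w) (t := Finset.univ.filter fun i : Fin g => i.1 < m)]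
  · refine Finset.sum_congr rfl fun i hi => ?_
    rw [cnt, Finset.filter_filter]
    congr 1
    ext c
    have : i.1 < m := (Finset.mem_filter.1 hi).2
    simp only [Finset.mem_filter, Finset.mem_univ, true_and]
    constructor
    · rintro rfl; exact ⟨this, rfl⟩
    · exact fun h => h.2
  · intro c hc
    simpa using hc

theorem sum_cnt {ι : Type*} [Fintype ι] [DecidableEq ι] (w : ι → Fin g) :
    ∑ i, cnt w i = Fintype.card ι := by
  have h := sum_cnt_lt w g
  simpa using h

theorem card_column_le (w : μ.cells → Fin g)
    (hw : ∀ c c' : μ.cells, c.1.2 = c'.1.2 → w c = w c' → c = c') (j m : ℕ) :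
    (Finset.univ.filter fun c : μ.cells => c.1.2 = j ∧ (w c : ℕ) < m).card ≤
      (Finset.univ.filter fun c : μ.cells => c.1.2 = j ∧ c.1.1 < m).card := by
  by_cases h : ∃ c : μ.cells, c.1.2 = j ∧ m ≤ c.1.1
  · obtain ⟨c, hc, hm⟩ := h
    have h1 : (Finset.univ.filter fun c : μ.cells => c.1.2 = j ∧ (w c : ℕ) < m).card ≤ m := by
      rw [← Finset.card_range m]
      refine Finset.card_le_card_of_injOn (fun c => (w c : ℕ)) ?_ ?_
      · intro c hc
        simpa using (Finset.mem_filter.1 hc).2.2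
      · intro c hc c' hc' h
        have e1 := (Finset.mem_filter.1 hc).2.1
        have e2 := (Finset.mem_filter.1 hc').2.1
        exact hw c c' (e1.trans e2.symm) (Fin.ext h)
    have h2 : m ≤ (Finset.univ.filter fun c : μ.cells => c.1.2 = j ∧ c.1.1 < m).card := by
      conv_lhs => rw [← Fintype.card_fin m]
      rw [← Finset.card_univ]
      have hmem : ∀ i : Fin m, ((i : ℕ), j) ∈ μ.cells := by
        intro i
        have hcc := c.2
        rw [YoungDiagram.mem_cells] at hcc ⊢
        refine μ.up_left_mem (i2 := c.1.1) (j2 := c.1.2) (i.2.le.trans hm) hc.ge hcc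
      refine Finset.card_le_card_of_injOn (fun i : Fin m => (⟨((i : ℕ), j), hmem i⟩ : μ.cells)) ?_ ?_
      · intro i _
        simp
      · intro i _ i' _ h
        simpa [Fin.ext_iff] using h
    exact h1.trans h2
  · push Not at h
    refine Finset.card_le_card fun c hc => ?_
    have hc := (Finset.mem_filter.1 hc).2
    exact Finset.mem_filter.2 ⟨Finset.mem_univ _, hc.1, h c hc.1⟩

theorem card_lt_eq_sum_columns (P : μ.cells → Prop) [DecidablePred P] :
    (Finset.univ.filter P).card = ∑ j ∈ Finset.univ.image (fun c : μ.cells => c.1.2),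
      (Finset.univ.filter fun c : μ.cells => c.1.2 = j ∧ P c).card := by
  rw [Finset.card_eq_sum_card_fiberwise (f := fun c : μ.cells => c.1.2)
    (t := Finset.univ.image (fun c : μ.cells => c.1.2))]
  · refine Finset.sum_congr rfl fun j _ => ?_
    rw [Finset.filter_filter]
    simp only [and_comm]
  · intro c _
    simp

theorem sum_cnt_le_rowWord (hμ : ∀ c : μ.cells, c.1.1 < g) (w : μ.cells → Fin g)
    (hw : ∀ c c' : μ.cells, c.1.2 = c'.1.2 → w c = w c' → c = c') (m : ℕ) :
    ∑ i ∈ Finset.univ.filter (fun i : Fin g => i.1 < m), cnt w i ≤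
      ∑ i ∈ Finset.univ.filter (fun i : Fin g => i.1 < m), cnt (rowWord hμ) i := by
  rw [sum_cnt_lt, sum_cnt_lt, card_lt_eq_sum_columns, card_lt_eq_sum_columns]
  exact Finset.sum_le_sum fun j _ => card_column_le w hw j m

theorem exists_perm_of_cnt_eq (hμ : ∀ c : μ.cells, c.1.1 < g) (w : μ.cells → Fin g)
    (hw : ∀ c c' : μ.cells, c.1.2 = c'.1.2 → w c = w c' → c = c')
    (hcnt : cnt w = cnt (rowWord hμ)) : ∃ σ ∈ columnGroup μ, w = rowWord hμ ∘ σ := by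
  have hmem : ∀ c : μ.cells, ((w c : ℕ), c.1.2) ∈ μ.cells := by
    intro c
    by_contra hc
    have h1 : ∀ m, ∑ j ∈ Finset.univ.image (fun c : μ.cells => c.1.2),
        (Finset.univ.filter fun c : μ.cells => c.1.2 = j ∧ (w c : ℕ) < m).card =
        ∑ j ∈ Finset.univ.image (fun c : μ.cells => c.1.2),
        (Finset.univ.filter fun c : μ.cells => c.1.2 = j ∧ c.1.1 < m).card := by
      intro m
      have e1 := sum_cnt_lt w m
      have e2 := sum_cnt_lt (rowWord hμ) m
      rw [hcnt, e2, card_lt_eq_sum_columns, card_lt_eq_sum_columns] at e1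
      exact e1.symm
    have h2 := (Finset.sum_eq_sum_iff_of_le fun j _ => card_column_le w hw j (w c)).1 (h1 (w c))
      c.1.2 (by simp)
    have h3 : ∀ d : μ.cells, d.1.2 = c.1.2 → d.1.1 < w c := by
      intro d hd
      by_contra h
      refine hc ?_
      have hdd := d.2
      rw [YoungDiagram.mem_cells] at hdd ⊢
      exact μ.up_left_mem (i2 := d.1.1) (j2 := d.1.2) (not_lt.1 h) hd.ge hdd
    have h4 : (Finset.univ.filter fun d : μ.cells => d.1.2 = c.1.2 ∧ (w d : ℕ) < w c).card <
        (Finset.univ.filter fun d : μ.cells => d.1.2 = c.1.2 ∧ d.1.1 < w c).card := by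
      refine Finset.card_lt_card ((Finset.ssubset_iff_of_subset fun d hd => ?_).2 ⟨c, ?_, ?_⟩)
      · have hd := (Finset.mem_filter.1 hd).2.1
        exact Finset.mem_filter.2 ⟨Finset.mem_univ _, hd, h3 d hd⟩
      · exact Finset.mem_filter.2 ⟨Finset.mem_univ _, rfl, h3 c rfl⟩
      · simp
    omega
  have hinj : Injective fun c : μ.cells => (⟨((w c : ℕ), c.1.2), hmem c⟩ : μ.cells) := by
    intro c c' h
    have h := congrArg Subtype.val h
    simp only [Prod.mk.injEq] at h
    exact hw c c' h.2 (Fin.ext h.1)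
  refine ⟨Equiv.ofBijective _ (Finite.injective_iff_bijective.1 hinj), fun c => rfl, ?_⟩
  funext c
  exact Fin.ext rfl

theorem cnt_rowWord_antitone (hμ : ∀ c : μ.cells, c.1.1 < g) : Antitone (cnt (rowWord hμ)) := by
  intro i j hij
  have hmem : ∀ c : μ.cells, rowWord hμ c = j → ((i : ℕ), c.1.2) ∈ μ.cells := by
    intro c hc
    have hcc := c.2
    rw [YoungDiagram.mem_cells] at hcc ⊢
    have h1 : c.1.1 = j := congrArg Fin.val hc
    exact μ.up_left_mem (i2 := c.1.1) (j2 := c.1.2) (by rw [h1]; exact hij) le_rfl hcc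
  refine Finset.card_le_card_of_injOn
    (fun c : μ.cells => if hc : rowWord hμ c = j then ⟨((i : ℕ), c.1.2), hmem c hc⟩ else c) ?_ ?_
  · intro c hc
    have hc : rowWord hμ c = j := (Finset.mem_filter.1 hc).2
    simp only [hc, dif_pos]
    exact Finset.mem_filter.2 ⟨Finset.mem_univ _, rfl⟩
  · intro c hc c' hc' h
    have hc : rowWord hμ c = j := (Finset.mem_filter.1 hc).2
    have hc' : rowWord hμ c' = j := (Finset.mem_filter.1 hc').2
    have h1 : c.1.1 = j := congrArg Fin.val hc
    have h1' : c'.1.1 = j := congrArg Fin.val hc'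
    simp only [hc, hc', dif_pos] at h
    have h := congrArg Subtype.val h
    simp only [Prod.mk.injEq, true_and] at h
    exact Subtype.ext (Prod.ext (h1.trans h1'.symm) h)

theorem raise_comp_perm {ι L k : Type*} [Fintype ι] [DecidableEq ι] [DecidableEq L] [CommRing k]
    (i j : L) (x : (ι → L) → k) (σ : Equiv.Perm ι) (w : ι → L) :
    raise i j x (w ∘ σ) = raise i j (fun w => x (w ∘ σ)) w := by
  refine Eq.trans (Finset.sum_congr rfl fun a _ => ?_) (Equiv.sum_comp σ _)
  simp only [comp_apply]
  split_ifs
  · refine congrArg x (funext fun c => ?_)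
    rcases eq_or_ne c a with rfl | h
    · simp
    · simp [h]
  · rfl

theorem IsColumnAntisymm.isHighest {k : Type*} [Field k] [CharZero k]
    {x : (μ.cells → Fin g) → k} (hμ : ∀ c : μ.cells, c.1.1 < g) (hx : IsColumnAntisymm x)
    (hwt : ∀ w, x w ≠ 0 → cnt w = cnt (rowWord hμ)) : IsHighest x := by
  intro i j hij w
  by_contra hne
  have hanti : IsColumnAntisymm (raise i j x) := by
    intro σ hσ w
    rw [raise_comp_perm]
    simp only [raise, Finset.mul_sum, mul_ite, mul_zero, hx σ hσ]
  have h1 := sum_cnt_le_rowWord hμ w (fun c c' => hanti.injOn hne) (i + 1)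
  obtain ⟨a, -, ha⟩ := Finset.exists_ne_zero_of_sum_ne_zero hne
  have hai : w a = i := by
    by_contra h
    simp [h] at ha
  rw [if_pos hai] at ha
  rw [← hwt _ ha, sum_cnt_lt, sum_cnt_lt] at h1
  have h2 : (Finset.univ.filter fun c => (update w a j c : ℕ) < i + 1).card <
      (Finset.univ.filter fun c => (w c : ℕ) < i + 1).card := by
    have hij' : (i : ℕ) < j := hij
    refine Finset.card_lt_card ((Finset.ssubset_iff_of_subset fun c hc => ?_).2 ⟨a, ?_, ?_⟩)
    · have hc := (Finset.mem_filter.1 hc).2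
      refine Finset.mem_filter.2 ⟨Finset.mem_univ _, ?_⟩
      rcases eq_or_ne c a with rfl | h
      · rw [hai]; omega
      · rwa [update_of_ne h] at hc
    · simp [hai]
    · simp only [Finset.mem_filter, Finset.mem_univ, update_self, true_and]
      omega
  omega

theorem IsColumnAntisymm.cnt_eq {k : Type*} [Field k] [CharZero k]
    {x : (μ.cells → Fin g) → k} (hμ : ∀ c : μ.cells, c.1.1 < g) (hx : IsColumnAntisymm x)
    (hh : IsHighest x) (hc : ∀ w, swapSum x w = casimir (cnt (rowWord hμ)) * x w)
    {w : μ.cells → Fin g} (hw : x w ≠ 0) : cnt w = cnt (rowWord hμ) := by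
  refine eq_of_casimir_eq (cnt_rowWord_antitone hμ) (hh.cnt_antitone hw)
    (sum_cnt_le_rowWord hμ w fun c c' => hx.injOn hw) (by rw [sum_cnt, sum_cnt]) ?_
  have h1 := hh.swapSum_eq w
  rw [hc w] at h1
  exact_mod_cast (mul_right_cancel₀ hw h1).symm

end Columns

section Irreducible

variable {k H : Type*} [Field k] [AddCommGroup H] [Module k H] {g : ℕ}
  {b : Module.Basis (Fin g ⊕ Fin g) k H} {ω : LinearMap.BilinForm k H} {μ : YoungDiagram}

theorem highestWeightVector_eq (hμ : ∀ c : μ.cells, c.1.1 < g) : highestWeightVector b μ =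
    ∑ᶠ σ : columnGroup μ, ((Equiv.Perm.sign (σ : Equiv.Perm μ.cells) : ℤ) : k) •
      PiTensorProduct.tprod k fun c : μ.cells => b (Sum.inl (rowWord hμ (σ.1 c))) := by
  classical
  rw [finsum_eq_sum_of_fintype, highestWeightVector]
  refine Finset.sum_congr rfl fun σ _ => ?_
  congr 2
  funext c
  rw [dif_pos (hμ _)]
  rfl

theorem coord_highestWeightVector (hμ : ∀ c : μ.cells, c.1.1 < g) (w : μ.cells → Fin g ⊕ Fin g) :
    coord b (highestWeightVector b μ) w = ∑ᶠ σ : columnGroup μ,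
      if w = fun c => Sum.inl (rowWord hμ (σ.1 c)) then (Equiv.Perm.sign σ.1 : ℤ) else 0 := by
  classical
  rw [highestWeightVector_eq hμ, finsum_eq_sum_of_fintype, finsum_eq_sum_of_fintype]
  simp only [map_sum, map_smul, Finset.sum_apply, Pi.smul_apply, coord_tprod, smul_eq_mul]
  push_cast
  refine Finset.sum_congr rfl fun σ _ => ?_
  simp only [Module.Basis.repr_self, Finsupp.single_apply]
  rw [Finset.prod_ite_zero]
  simp only [Finset.mem_univ, true_imp_iff, Finset.prod_const_one]
  simp only [funext_iff, eq_comm, mul_ite, mul_one, mul_zero]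

end Irreducible

section Irreducible

variable {k H : Type*} [Field k] [AddCommGroup H] [Module k H] {g : ℕ}
  {b : Module.Basis (Fin g ⊕ Fin g) k H} {ω : LinearMap.BilinForm k H} {μ : YoungDiagram}

theorem exists_eq_inl {ι : Type*} {w : ι → Fin g ⊕ Fin g} (h : ¬∃ a m, w a = Sum.inr m) :
    ∃ w' : ι → Fin g, w = fun a => Sum.inl (w' a) := by
  have : ∀ a, ∃ i, w a = Sum.inl i := by
    intro a
    rcases h' : w a with i | m
    · exact ⟨i, rfl⟩
    · exact absurd ⟨a, m, h'⟩ h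
  choose w' hw' using this
  exact ⟨w', funext hw'⟩

theorem coord_highestWeightVector_rowWord (hμ : ∀ c : μ.cells, c.1.1 < g) :
    coord b (highestWeightVector b μ) (fun c => Sum.inl (rowWord hμ c)) = 1 := by
  rw [coord_highestWeightVector hμ, finsum_eq_single _ (1 : columnGroup μ)]
  · simp
  · intro σ hσ
    rw [if_neg]
    intro h
    refine hσ (Subtype.ext (Equiv.ext fun c => Subtype.ext (Prod.ext ?_ (σ.2 c))))
    exact (congrArg Fin.val (Sum.inl_injective (congrFun h c))).symm

theorem exists_of_coord_highestWeightVector_ne_zero (hμ : ∀ c : μ.cells, c.1.1 < g)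
    {w : μ.cells → Fin g ⊕ Fin g} (hw : coord b (highestWeightVector b μ) w ≠ 0) :
    ∃ σ : Equiv.Perm μ.cells, w = fun c => Sum.inl (rowWord hμ (σ c)) := by
  by_contra! h
  refine hw ?_
  rw [coord_highestWeightVector hμ]
  simp [h]

theorem coord_highestWeightVector_comp (hμ : ∀ c : μ.cells, c.1.1 < g)
    {σ : Equiv.Perm μ.cells} (hσ : σ ∈ columnGroup μ) (w : μ.cells → Fin g ⊕ Fin g) :
    coord b (highestWeightVector b μ) (w ∘ σ) =
      (Equiv.Perm.sign σ : ℤ) * coord b (highestWeightVector b μ) w := by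
  classical
  rw [coord_highestWeightVector hμ, coord_highestWeightVector hμ, ← Int.cast_mul,
    finsum_eq_sum_of_fintype, finsum_eq_sum_of_fintype, Finset.mul_sum,
    ← Equiv.sum_comp (Equiv.mulRight (⟨σ, hσ⟩ : columnGroup μ))]
  refine congrArg _ (Finset.sum_congr rfl fun τ _ => ?_)
  have h : w ∘ σ = (fun c => Sum.inl (rowWord hμ
      (((Equiv.mulRight (⟨σ, hσ⟩ : columnGroup μ)) τ).1 c))) ↔
      w = fun c => Sum.inl (rowWord hμ (τ.1 c)) := by
    constructor
    · intro h
      funext c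
      have := congrFun h (σ⁻¹ c)
      simpa using this
    · rintro rfl
      rfl
  simp only [h, mul_ite, mul_zero]
  split_ifs
  · simp [mul_comm]
  · rfl

theorem highestWeightVector_mem_traceless (hb : IsSymplecticBasis ω b)
    (hμ : ∀ c : μ.cells, c.1.1 < g) : highestWeightVector b μ ∈ traceless ω μ.cells := by
  classical
  rw [highestWeightVector_eq hμ, finsum_eq_sum_of_fintype]
  refine Submodule.sum_mem _ fun σ _ => Submodule.smul_mem _ _ ?_
  rw [mem_traceless]
  intro i j hij
  rw [contraction_tprod, hb.p_p, zero_smul]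

theorem isHighestVector_highestWeightVector [CharZero k] (hμ : ∀ c : μ.cells, c.1.1 < g) :
    IsHighestVector b (highestWeightVector b μ) := by
  constructor
  · intro w a m hw
    by_contra h
    obtain ⟨σ, rfl⟩ := exists_of_coord_highestWeightVector_ne_zero hμ h
    cases hw
  · refine IsColumnAntisymm.isHighest hμ ?_ ?_
    · intro σ hσ w
      exact coord_highestWeightVector_comp hμ hσ (fun c => Sum.inl (w c))
    · intro w hw
      obtain ⟨σ, h⟩ := exists_of_coord_highestWeightVector_ne_zero hμ hw
      have h1 : w = rowWord hμ ∘ σ := funext fun c => Sum.inl_injective (congrFun h c)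
      subst h1
      funext i
      exact Finset.card_equiv σ (by simp)

/-- The sum of all transpositions, acting on a tensor power. -/
noncomputable def swapTensor (k H : Type*) [Field k] [AddCommGroup H] [Module k H]
    (ι : Type*) [Fintype ι] [DecidableEq ι] : (⨂[k] _ : ι, H) →ₗ[k] ⨂[k] _ : ι, H :=
  ∑ a, ∑ c, (PiTensorProduct.reindex k (fun _ => H) (Equiv.swap a c)).toLinearMap

theorem coord_swapTensor {ι : Type*} [Fintype ι] [DecidableEq ι] (x : ⨂[k] _ : ι, H)
    (w : ι → Fin g ⊕ Fin g) : coord b (swapTensor k H ι x) w = swapSum (coord b x) w := by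
  simp only [swapTensor, LinearMap.sum_apply, map_sum, Finset.sum_apply, swapSum,
    LinearEquiv.coe_coe]
  exact Finset.sum_congr rfl fun a _ => Finset.sum_congr rfl fun c _ => coord_reindex b _ _ _

theorem tensorRep_reindex {ι ι' : Type*} (f : Sp ω) (e : ι ≃ ι') (x : ⨂[k] _ : ι, H) :
    tensorRep ω ι' f (PiTensorProduct.reindex k (fun _ => H) e x) =
      PiTensorProduct.reindex k (fun _ => H) e (tensorRep ω ι f x) :=
  PiTensorProduct.map_reindex (fun _ : ι => ((f : H ≃ₗ[k] H) : H →ₗ[k] H)) e x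

theorem swapTensor_tensorRep {ι : Type*} [Fintype ι] [DecidableEq ι] (f : Sp ω)
    (x : ⨂[k] _ : ι, H) :
    swapTensor k H ι (tensorRep ω ι f x) = tensorRep ω ι f (swapTensor k H ι x) := by
  simp only [swapTensor, LinearMap.sum_apply, map_sum, LinearEquiv.coe_coe]
  exact Finset.sum_congr rfl fun a _ => Finset.sum_congr rfl fun c _ =>
    (tensorRep_reindex f _ x).symm

theorem swapTensor_highestWeightVector [CharZero k] (hμ : ∀ c : μ.cells, c.1.1 < g) :
    swapTensor k H μ.cells (highestWeightVector b μ) =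
      ((casimir (cnt (rowWord hμ)) : ℤ) : k) • highestWeightVector b μ := by
  refine coord_injective b (funext fun w => ?_)
  rw [coord_swapTensor, map_smul, Pi.smul_apply, smul_eq_mul]
  have hv := isHighestVector_highestWeightVector (b := b) hμ
  by_cases hw : ∃ a m, w a = Sum.inr m
  · obtain ⟨a, m, ha⟩ := hw
    rw [hv.eq_zero w a m ha, mul_zero]
    refine Finset.sum_eq_zero fun c _ => Finset.sum_eq_zero fun d _ => ?_
    exact hv.eq_zero _ (Equiv.swap c d a) m (by simpa using ha)
  · obtain ⟨w', rfl⟩ := exists_eq_inl hw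
    have h1 := hv.isHighest.swapSum_eq w'
    refine h1.trans ?_
    by_cases h0 : coord b (highestWeightVector b μ) (fun a => Sum.inl (w' a)) = 0
    · rw [h0, mul_zero, mul_zero]
    · obtain ⟨σ, h⟩ := exists_of_coord_highestWeightVector_ne_zero hμ h0
      have h1 : w' = rowWord hμ ∘ σ := funext fun c => Sum.inl_injective (congrFun h c)
      have h2 : cnt w' = cnt (rowWord hμ) := by
        subst h1
        funext i
        exact Finset.card_equiv σ (by simp)
      rw [h2]

theorem highestWeightVector_mem_irrepSub (ω : LinearMap.BilinForm k H)
    (b : Module.Basis (Fin g ⊕ Fin g) k H) (μ : YoungDiagram) :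
    highestWeightVector b μ ∈ (irrepSub ω b μ).toSubmodule :=
  Submodule.subset_span ⟨1, by simp⟩

theorem irrepSub_le {Y : Submodule k (⨂[k] _ : μ.cells, H)}
    (hY : ∀ (f : Sp ω), ∀ y ∈ Y, tensorRep ω _ f y ∈ Y) (h : highestWeightVector b μ ∈ Y) :
    (irrepSub ω b μ).toSubmodule ≤ Y := by
  refine Submodule.span_le.2 ?_
  rintro _ ⟨f, rfl⟩
  exact hY f _ h

theorem irrepSub_le_traceless (hb : IsSymplecticBasis ω b) (hμ : ∀ c : μ.cells, c.1.1 < g) :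
    (irrepSub ω b μ).toSubmodule ≤ traceless ω μ.cells :=
  irrepSub_le (fun f y hy => ((tracelessSp ω μ.cells f) ⟨y, hy⟩).2)
    (highestWeightVector_mem_traceless hb hμ)

theorem IsHighestVector.eq_smul [CharZero k] (hμ : ∀ c : μ.cells, c.1.1 < g)
    {y : ⨂[k] _ : μ.cells, H} (hy : IsHighestVector b y)
    (hyμ : y ∈ (irrepSub ω b μ).toSubmodule) :
    y = coord b y (fun c => Sum.inl (rowWord hμ c)) • highestWeightVector b μ := by
  have hswap : swapTensor k H μ.cells y = ((casimir (cnt (rowWord hμ)) : ℤ) : k) • y := by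
    refine irrepSub_le (Y := LinearMap.ker (swapTensor k H μ.cells -
      ((casimir (cnt (rowWord hμ)) : ℤ) : k) • LinearMap.id)) ?_ ?_ hyμ |> fun h => by
        simpa [sub_eq_zero] using h
    · intro f y hy
      simp only [LinearMap.mem_ker, LinearMap.sub_apply, LinearMap.smul_apply, LinearMap.id_apply,
        sub_eq_zero] at hy ⊢
      rw [swapTensor_tensorRep, hy, map_smul]
    · simp only [LinearMap.mem_ker, LinearMap.sub_apply, LinearMap.smul_apply, LinearMap.id_apply,
        sub_eq_zero]
      exact swapTensor_highestWeightVector hμ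
  have hanti : ∀ σ ∈ columnGroup μ, ∀ w, coord b y (w ∘ σ) =
      (Equiv.Perm.sign σ : ℤ) * coord b y w := by
    intro σ hσ w
    have h1 : PiTensorProduct.reindex k (fun _ => H) σ y =
        ((Equiv.Perm.sign σ : ℤ) : k) • y := by
      refine irrepSub_le (Y := LinearMap.ker
        ((PiTensorProduct.reindex k (fun _ : μ.cells => H) σ).toLinearMap -
        ((Equiv.Perm.sign σ : ℤ) : k) • LinearMap.id)) ?_ ?_ hyμ |> fun h => by
          simpa [sub_eq_zero] using h
      · intro f y hy
        simp only [LinearMap.mem_ker, LinearMap.sub_apply, LinearMap.smul_apply,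
          LinearMap.id_apply, sub_eq_zero, LinearEquiv.coe_coe] at hy ⊢
        rw [← map_smul, ← hy]
        exact (tensorRep_reindex f σ y).symm
      · simp only [LinearMap.mem_ker, LinearMap.sub_apply, LinearMap.smul_apply,
          LinearMap.id_apply, sub_eq_zero, LinearEquiv.coe_coe]
        refine coord_injective b (funext fun w => ?_)
        rw [map_smul, Pi.smul_apply, smul_eq_mul, ← coord_highestWeightVector_comp hμ hσ]
        exact coord_reindex b _ _ _
    have h2 := coord_reindex b σ y w
    rw [← h2]
    have h3 := congrFun (congrArg (coord b) h1) w
    rw [map_smul, Pi.smul_apply, smul_eq_mul] at h3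
    exact h3
  set x : (μ.cells → Fin g) → k := fun w => coord b y fun a => Sum.inl (w a) with hx
  have hxa : IsColumnAntisymm x := fun σ hσ w => hanti σ hσ fun a => Sum.inl (w a)
  have hxc : ∀ w, swapSum x w = casimir (cnt (rowWord hμ)) * x w := by
    intro w
    have h1 := coord_swapTensor (b := b) y fun a => Sum.inl (w a)
    rw [hswap, map_smul, Pi.smul_apply, smul_eq_mul] at h1
    exact h1.symm
  have hv := isHighestVector_highestWeightVector (b := b) hμ
  refine coord_injective b (funext fun w => ?_)
  rw [map_smul, Pi.smul_apply, smul_eq_mul]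
  by_cases hw : ∃ a m, w a = Sum.inr m
  · obtain ⟨a, m, ha⟩ := hw
    rw [hv.eq_zero w a m ha, hy.eq_zero w a m ha, mul_zero]
  obtain ⟨w', rfl⟩ := exists_eq_inl hw
  have key : ∀ σ ∈ columnGroup μ, ∀ z : ⨂[k] _ : μ.cells, H,
      (∀ σ ∈ columnGroup μ, ∀ w, coord b z (w ∘ σ) = (Equiv.Perm.sign σ : ℤ) * coord b z w) →
      coord b z (fun a => Sum.inl ((rowWord hμ ∘ σ) a)) =
        (Equiv.Perm.sign σ : ℤ) * coord b z fun a => Sum.inl (rowWord hμ a) :=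
    fun σ hσ z hz => hz σ hσ fun a => Sum.inl (rowWord hμ a)
  by_cases h0 : ∃ σ ∈ columnGroup μ, w' = rowWord hμ ∘ σ
  · obtain ⟨σ, hσ, rfl⟩ := h0
    rw [key σ hσ y hanti, key σ hσ _ fun σ hσ w => coord_highestWeightVector_comp hμ hσ w,
      coord_highestWeightVector_rowWord hμ]
    ring
  · have h1 : ∀ z : (μ.cells → Fin g) → k, IsColumnAntisymm z →
        (∀ w, z w ≠ 0 → cnt w = cnt (rowWord hμ)) → z w' = 0 := by
      intro z hz hc
      by_contra hne
      exact h0 (exists_perm_of_cnt_eq hμ w' (fun c c' => hz.injOn hne) (hc w' hne))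
    have h2 : x w' = 0 := h1 x hxa fun w hw => hxa.cnt_eq hμ hy.isHighest hxc hw
    have h3 : coord b (highestWeightVector b μ) (fun a => Sum.inl (w' a)) = 0 := by
      refine h1 (fun w => coord b (highestWeightVector b μ) fun a => Sum.inl (w a)) ?_ ?_
      · exact fun σ hσ w => coord_highestWeightVector_comp hμ hσ fun a => Sum.inl (w a)
      · intro w hw
        obtain ⟨σ, h⟩ := exists_of_coord_highestWeightVector_ne_zero hμ hw
        have h1 : w = rowWord hμ ∘ σ := funext fun c => Sum.inl_injective (congrFun h c)
        subst h1
        funext i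
        exact Finset.card_equiv σ (by simp)
    rw [h3, mul_zero]
    exact h2

theorem highestWeightVector_ne_zero (hμ : ∀ c : μ.cells, c.1.1 < g) :
    highestWeightVector b μ ≠ 0 := by
  intro h
  have h1 := coord_highestWeightVector_rowWord (b := b) hμ
  rw [h, map_zero, Pi.zero_apply] at h1
  exact zero_ne_one h1

theorem irrep_isIrreducible [CharZero k] (hb : IsSymplecticBasis ω b)
    (hμ : ∀ c : μ.cells, c.1.1 < g) : (irrep ω b μ).IsIrreducible := by
  have hv := highestWeightVector_mem_irrepSub ω b μ
  refine { exists_pair_ne := ⟨⊥, ⊤, fun h => ?_⟩, eq_bot_or_eq_top := fun Y => ?_ }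
  · have h1 : (⟨_, hv⟩ : (irrepSub ω b μ).toSubmodule) ∈
        (⊥ : Subrepresentation (irrep ω b μ)).toSubmodule := by
      rw [h]; exact Submodule.mem_top
    exact highestWeightVector_ne_zero hμ (congrArg Subtype.val ((Submodule.mem_bot k).1 h1))
  · by_cases hY : Y.toSubmodule = ⊥
    · exact Or.inl (Subrepresentation.toSubmodule_injective hY)
    refine Or.inr (Subrepresentation.toSubmodule_injective ?_)
    have hstab : ∀ (f : Sp ω), ∀ y ∈ Y.toSubmodule.map (irrepSub ω b μ).toSubmodule.subtype,
        tensorRep ω _ f y ∈ Y.toSubmodule.map (irrepSub ω b μ).toSubmodule.subtype := by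
      rintro f _ ⟨y, hy, rfl⟩
      exact ⟨irrep ω b μ f y, Y.apply_mem_toSubmodule f hy, rfl⟩
    obtain ⟨y, hy, hy0, hyh⟩ := exists_isHighestVector_of_stable hb
      (Y.toSubmodule.map (irrepSub ω b μ).toSubmodule.subtype) hstab
      ((Submodule.map_subtype_le _ _).trans (irrepSub_le_traceless hb hμ))
      (fun h => hY (Submodule.map_injective_of_injective (Submodule.subtype_injective _)
        (h.trans (Submodule.map_bot _).symm)))
    have h1 := hyh.eq_smul hμ (Submodule.map_subtype_le _ _ hy)
    have hc : coord b y (fun c => Sum.inl (rowWord hμ c)) ≠ 0 := by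
      intro h
      rw [h, zero_smul] at h1
      exact hy0 h1
    have h2 : highestWeightVector b μ ∈ Y.toSubmodule.map (irrepSub ω b μ).toSubmodule.subtype := by
      rw [h1] at hy
      exact (Submodule.smul_mem_iff _ hc).1 hy
    have h3 := irrepSub_le hstab h2
    refine (Submodule.eq_top_iff').2 fun x => ?_
    obtain ⟨z, hz, hzx⟩ := h3 x.2
    have : z = x := Subtype.ext hzx
    rwa [← this]

end Irreducible

section Form

variable {k H : Type*} [Field k] [AddCommGroup H] [Module k H] {g : ℕ}
  {b : Module.Basis (Fin g ⊕ Fin g) k H} {ω : LinearMap.BilinForm k H}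

/-- The bilinear form on a tensor power induced by `ω`. -/
noncomputable def tensorForm (ω : LinearMap.BilinForm k H) (ι : Type*) [Finite ι] :
    LinearMap.BilinForm k (⨂[k] _ : ι, H) :=
  PiTensorProduct.dualDistrib ∘ₗ PiTensorProduct.map fun _ => ω

theorem tensorForm_tprod {ι : Type*} [Fintype ι] (u v : ι → H) :
    tensorForm ω ι (PiTensorProduct.tprod k u) (PiTensorProduct.tprod k v) =
      ∏ a, ω (u a) (v a) := by
  rw [tensorForm, LinearMap.comp_apply, PiTensorProduct.map_tprod,
    PiTensorProduct.dualDistrib_apply]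

theorem tensorForm_tensorRep {ι : Type*} [Fintype ι] (f : Sp ω) (x y : ⨂[k] _ : ι, H) :
    tensorForm ω ι (tensorRep ω ι f x) (tensorRep ω ι f y) = tensorForm ω ι x y := by
  have h : (tensorForm ω ι).compl₁₂ (tensorRep ω ι f) (tensorRep ω ι f) = tensorForm ω ι := by
    ext u v
    simp [tensorForm_tprod, f.2 _ _]
  exact LinearMap.congr_fun₂ h x y

/-- The complex structure `p_i ↦ q_i`, `q_i ↦ -p_i`. -/
noncomputable def basisRotation (b : Module.Basis (Fin g ⊕ Fin g) k H) : H →ₗ[k] H :=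
  b.constr k (Sum.elim (fun i => b (Sum.inr i)) fun i => -b (Sum.inl i))

theorem basisRotation_inl (i : Fin g) : basisRotation b (b (Sum.inl i)) = b (Sum.inr i) := by
  simp [basisRotation]

theorem basisRotation_inr (i : Fin g) : basisRotation b (b (Sum.inr i)) = -b (Sum.inl i) := by
  simp [basisRotation]

theorem basisRotation_basisRotation : basisRotation b ∘ₗ basisRotation b = -LinearMap.id := by
  refine b.ext fun i => ?_
  rcases i with i | i <;> simp [basisRotation_inl, basisRotation_inr]

/-- `basisRotation` as an element of the symplectic group. -/
noncomputable def rotationSp (hb : IsSymplecticBasis ω b) : Sp ω :=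
  ⟨LinearEquiv.ofLinearMap (basisRotation b) (-basisRotation b)
    (by rw [LinearMap.comp_neg, basisRotation_basisRotation, neg_neg])
    (by rw [LinearMap.neg_comp, basisRotation_basisRotation, neg_neg]), by
    intro x y
    have h : ω.compl₁₂ (basisRotation b) (basisRotation b) = ω := by
      refine b.ext fun i => b.ext fun j => ?_
      rcases i with i | i <;> rcases j with j | j <;>
        simp [basisRotation_inl, basisRotation_inr, hb.p_p, hb.q_q, hb.p_q, hb.q_p]
      all_goals split_ifs <;> simp
    exact LinearMap.congr_fun₂ h x y⟩

theorem rotationSp_apply (hb : IsSymplecticBasis ω b) (x : H) :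
    (rotationSp hb : H ≃ₗ[k] H) x = basisRotation b x := rfl

theorem pairing_basisRotation (hb : IsSymplecticBasis ω b) (h : H) (l : Fin g ⊕ Fin g) :
    ω h (basisRotation b (b l)) = b.repr h l := by
  have : ω.flip (basisRotation b (b l)) = b.coord l := by
    refine b.ext fun i => ?_
    rcases i with i | i <;> rcases l with l | l <;>
      simp [basisRotation_inl, basisRotation_inr, hb.p_p, hb.q_q, hb.p_q, hb.q_p,
        Finsupp.single_apply]
    split_ifs <;> simp
  exact LinearMap.congr_fun this h

theorem tensorForm_rotation_basis (hb : IsSymplecticBasis ω b) {ι : Type*} [Fintype ι]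
    (x : ⨂[k] _ : ι, H) (w : ι → Fin g ⊕ Fin g) :
    tensorForm ω ι x (tensorRep ω ι (rotationSp hb) (PiTensorProduct.tprod k fun a => b (w a))) =
      coord b x w := by
  have h : LinearMap.flip (tensorForm ω ι)
      (tensorRep ω ι (rotationSp hb) (PiTensorProduct.tprod k fun a => b (w a))) =
      LinearMap.proj w ∘ₗ coord b := by
    ext v
    simp only [LinearMap.compMultilinearMap_apply, LinearMap.flip_apply, tensorRep_tprod,
      tensorForm_tprod, rotationSp_apply, pairing_basisRotation hb, LinearMap.comp_apply,
      LinearMap.proj_apply, coord_tprod]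
  exact LinearMap.congr_fun h x

theorem tensorForm_rotation (hb : IsSymplecticBasis ω b) {ι : Type*} [Fintype ι] [DecidableEq ι]
    (x y : ⨂[k] _ : ι, H) :
    tensorForm ω ι x (tensorRep ω ι (rotationSp hb) y) = ∑ w, coord b x w * coord b y w := by
  conv_lhs => rw [← (Basis.piTensorProduct fun _ : ι => b).sum_equivFun y]
  simp only [map_sum, map_smul, Basis.piTensorProduct_apply, tensorForm_rotation_basis hb,
    smul_eq_mul]
  exact Finset.sum_congr rfl fun w _ => mul_comm _ _

end Form

section Rational

theorem sum_eq_zero_of_orthogonal {k : Type*} [Field k] [CharZero k] {W : Type*} [Fintype W]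
    {n : ℕ} (u : Fin n → W → ℚ) (c : Fin n → k)
    (h : ∀ j, ∑ w, (u j w : k) * ∑ i, c i * (u i w : k) = 0) (w : W) :
    ∑ i, c i * (u i w : k) = 0 := by
  refine eq_zero_of_forall_rat fun φ => ?_
  have hq : ∀ (q : ℚ) (a : k), φ ((q : k) * a) = q * φ a := by
    intro q a
    rw [← smul_eq_mul (q : ℚ), ← map_smul, Algebra.smul_def]
    rfl
  have h1 : ∀ w, φ (∑ i, c i * (u i w : k)) = ∑ i, u i w * φ (c i) := by
    intro w
    rw [map_sum]
    exact Finset.sum_congr rfl fun i _ => by rw [mul_comm, hq]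
  have h2 : ∀ j, ∑ w, u j w * ∑ i, u i w * φ (c i) = 0 := by
    intro j
    rw [← map_zero φ, ← h j, map_sum]
    exact Finset.sum_congr rfl fun w _ => by rw [hq, h1]
  have h3 : ∑ w, (∑ i, u i w * φ (c i)) ^ 2 = 0 := by
    have : ∀ w, (∑ i, u i w * φ (c i)) ^ 2 =
        ∑ j, φ (c j) * (u j w * ∑ i, u i w * φ (c i)) := by
      intro w
      rw [sq]
      conv_lhs => enter [1]; rw [Finset.sum_congr rfl fun i _ => mul_comm (u i w) (φ (c i))]
      rw [Finset.sum_mul]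
      exact Finset.sum_congr rfl fun j _ => by ring
    simp only [this]
    rw [Finset.sum_comm]
    refine Finset.sum_eq_zero fun j _ => ?_
    rw [← Finset.mul_sum, h2, mul_zero]
  rw [h1]
  rw [Finset.sum_eq_zero_iff_of_nonneg fun w _ => sq_nonneg _] at h3
  exact pow_eq_zero_iff two_ne_zero |>.1 (h3 w (Finset.mem_univ _))

end Rational

section Average

variable {k H : Type*} [Field k] [AddCommGroup H] [Module k H] {g : ℕ}
  {b : Module.Basis (Fin g ⊕ Fin g) k H} {ω : LinearMap.BilinForm k H} {s : ℕ} [NeZero s]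

theorem coord_dihedralTensorRep (d : DihedralGroup s) (x : ⨂[k] _ : ZMod s, H)
    (w : ZMod s → Fin g ⊕ Fin g) : coord b (dihedralTensorRep k H s d x) w =
      ((dihedralSign s d : ℤ) : k) * coord b x (w ∘ dihedralPerm s d) := by
  have h : dihedralTensorRep k H s d x = ((dihedralSign s d : ℤ) : k) •
    PiTensorProduct.reindex k (fun _ : ZMod s => H) (dihedralPerm s d) x := rfl
  rw [h, map_smul, Pi.smul_apply, smul_eq_mul]
  exact congrArg _ (coord_reindex b _ _ _)

variable (k H s) in
/-- The average over the dihedral group. -/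
noncomputable def dihedralAverage : (⨂[k] _ : ZMod s, H) →ₗ[k] ⨂[k] _ : ZMod s, H :=
  (Fintype.card (DihedralGroup s) : k)⁻¹ • ∑ d, dihedralTensorRep k H s d

theorem dihedralAverage_apply (x : ⨂[k] _ : ZMod s, H) : dihedralAverage k H s x =
    (Fintype.card (DihedralGroup s) : k)⁻¹ • ∑ d, dihedralTensorRep k H s d x := by
  simp [dihedralAverage, LinearMap.sum_apply]

theorem dihedralAverage_dihedralTensorRep (d : DihedralGroup s) (x : ⨂[k] _ : ZMod s, H) :
    dihedralAverage k H s (dihedralTensorRep k H s d x) = dihedralAverage k H s x := by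
  rw [dihedralAverage_apply, dihedralAverage_apply, ← Equiv.sum_comp (Equiv.mulRight d)
    fun d => dihedralTensorRep k H s d x]
  simp only [Equiv.coe_mulRight, map_mul, Module.End.mul_apply]

theorem dihedralTensorRep_dihedralAverage (d : DihedralGroup s) (x : ⨂[k] _ : ZMod s, H) :
    dihedralTensorRep k H s d (dihedralAverage k H s x) = dihedralAverage k H s x := by
  rw [dihedralAverage_apply, map_smul, map_sum, ← Equiv.sum_comp (Equiv.mulLeft d)
    fun d => dihedralTensorRep k H s d x]
  simp only [Equiv.coe_mulLeft, map_mul, Module.End.mul_apply]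

theorem dihedralAverage_eq_self [CharZero k] {x : ⨂[k] _ : ZMod s, H}
    (hx : ∀ d, dihedralTensorRep k H s d x = x) : dihedralAverage k H s x = x := by
  rw [dihedralAverage_apply]
  simp only [hx, Finset.sum_const, Finset.card_univ, ← Nat.cast_smul_eq_nsmul k, smul_smul]
  rw [inv_mul_cancel₀ (Nat.cast_ne_zero.2 Fintype.card_ne_zero), one_smul]

theorem tensorRep_dihedralAverage (f : Sp ω) (x : ⨂[k] _ : ZMod s, H) :
    tensorRep ω _ f (dihedralAverage k H s x) = dihedralAverage k H s (tensorRep ω _ f x) := by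
  simp only [dihedralAverage_apply, map_smul, map_sum, tensorRep_dihedralTensorRep]

theorem dihedralAverage_mem_traceless {x : ⨂[k] _ : ZMod s, H} (hx : x ∈ traceless ω (ZMod s)) :
    dihedralAverage k H s x ∈ traceless ω (ZMod s) := by
  rw [dihedralAverage_apply]
  exact Submodule.smul_mem _ _ (Submodule.sum_mem _ fun d _ =>
    dihedralTensorRep_mem_traceless ω s d hx)

theorem mk_eq_zero_of_average (x : traceless ω (ZMod s))
    (h : Representation.Coinvariants.mk (tracelessDihedral ω s) x = 0) :
    dihedralAverage k H s x = 0 := by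
  have h1 := Representation.Coinvariants.lift_mk (ρ := tracelessDihedral ω s)
    (dihedralAverage k H s ∘ₗ (traceless ω (ZMod s)).subtype) (fun d => by
      ext x
      exact dihedralAverage_dihedralTensorRep d _) x
  rw [h, map_zero] at h1
  exact h1.symm

theorem mk_average [CharZero k] (x : traceless ω (ZMod s)) :
    Representation.Coinvariants.mk (tracelessDihedral ω s)
      ⟨dihedralAverage k H s x, dihedralAverage_mem_traceless x.2⟩ =
    Representation.Coinvariants.mk (tracelessDihedral ω s) x := by
  have h : (⟨dihedralAverage k H s x, dihedralAverage_mem_traceless x.2⟩ :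
      traceless ω (ZMod s)) = (Fintype.card (DihedralGroup s) : k)⁻¹ •
        ∑ d, tracelessDihedral ω s d x := by
    refine Subtype.ext ?_
    simp only [dihedralAverage_apply, Submodule.coe_smul, Submodule.coe_sum]
    rfl
  rw [h, map_smul, map_sum]
  simp only [Representation.Coinvariants.mk_self_apply, Finset.sum_const, Finset.card_univ,
    ← Nat.cast_smul_eq_nsmul k, smul_smul]
  rw [inv_mul_cancel₀ (Nat.cast_ne_zero.2 Fintype.card_ne_zero), one_smul]

end Average

section Decomposition

variable {k H : Type*} [Field k] [AddCommGroup H] [Module k H] {g : ℕ}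
  {b : Module.Basis (Fin g ⊕ Fin g) k H} {ω : LinearMap.BilinForm k H} {s : ℕ} [NeZero s]

/-- The dihedral average of a highest weight vector whose cells are placed on the cycle. -/
noncomputable def averagedVector (b : Module.Basis (Fin g ⊕ Fin g) k H) {μ : YoungDiagram}
    (φ : μ.cells ≃ ZMod s) : ⨂[k] _ : ZMod s, H :=
  dihedralAverage k H s (PiTensorProduct.reindex k (fun _ => H) φ (highestWeightVector b μ))

omit [NeZero s] in
theorem reindex_mem_traceless (hb : IsSymplecticBasis ω b) {μ : YoungDiagram}
    (hμ : ∀ c : μ.cells, c.1.1 < g) (φ : μ.cells ≃ ZMod s) {x : ⨂[k] _ : μ.cells, H}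
    (hx : x ∈ (irrepSub ω b μ).toSubmodule) :
    PiTensorProduct.reindex k (fun _ => H) φ x ∈ traceless ω (ZMod s) := by
  classical
  refine irrepSub_le (Y := (traceless ω (ZMod s)).comap
    (PiTensorProduct.reindex k (fun _ : μ.cells => H) φ).toLinearMap) ?_ ?_ hx
  · intro f y hy
    have h1 := ((tracelessSp ω (ZMod s) f) ⟨_, hy⟩).2
    have h2 := tensorRep_reindex f φ y
    exact (congrArg (· ∈ traceless ω (ZMod s)) h2).mp h1
  · rw [Submodule.mem_comap, highestWeightVector_eq hμ, finsum_eq_sum_of_fintype, map_sum]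
    refine Submodule.sum_mem _ fun σ _ => ?_
    rw [map_smul]
    refine Submodule.smul_mem _ _ ?_
    have h3 := PiTensorProduct.reindex_tprod (R := k) (s := fun _ : μ.cells => H) φ
      (fun c : μ.cells => b (Sum.inl (rowWord hμ (σ.1 c))))
    refine (congrArg (· ∈ traceless ω (ZMod s)) h3).mpr ?_
    rw [mem_traceless]
    intro i j hij
    rw [contraction_tprod]
    exact (congrArg (· • _) (hb.p_p _ _)).trans (zero_smul k _)

theorem coord_averagedVector {μ : YoungDiagram} (φ : μ.cells ≃ ZMod s)
    (w : ZMod s → Fin g ⊕ Fin g) : coord b (averagedVector b φ) w =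
      (Fintype.card (DihedralGroup s) : k)⁻¹ * ∑ d, ((dihedralSign s d : ℤ) : k) *
        coord b (highestWeightVector b μ) (fun c => w (dihedralPerm s d (φ c))) := by
  rw [averagedVector, dihedralAverage_apply, map_smul, Pi.smul_apply, smul_eq_mul, map_sum,
    Finset.sum_apply]
  refine congrArg _ (Finset.sum_congr rfl fun d _ => ?_)
  rw [coord_dihedralTensorRep]
  exact congrArg _ (coord_reindex b φ _ _)

theorem exists_rat_coord_averagedVector [CharZero k] {μ : YoungDiagram}
    (hμ : ∀ c : μ.cells, c.1.1 < g) (φ : μ.cells ≃ ZMod s) :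
    ∃ u : (ZMod s → Fin g ⊕ Fin g) → ℚ, ∀ w, coord b (averagedVector b φ) w = (u w : k) := by
  have h : ∀ w : μ.cells → Fin g ⊕ Fin g, ∃ n : ℤ,
      coord b (highestWeightVector b μ) w = (n : k) :=
    fun w => ⟨_, coord_highestWeightVector hμ w⟩
  choose n hn using h
  refine ⟨fun w => (Fintype.card (DihedralGroup s) : ℚ)⁻¹ * ∑ d, ((dihedralSign s d : ℤ) : ℚ) *
        n (fun c => w (dihedralPerm s d (φ c))), fun w => ?_⟩
  rw [coord_averagedVector]
  push_cast
  simp only [hn]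

variable (L : List YoungDiagram) (φ : ∀ i : Fin L.length, (L.get i).cells ≃ ZMod s)

/-- The map from a sum of irreducible representations to the tensors on the cycle. -/
noncomputable def cyclePlacement (ω : LinearMap.BilinForm k H)
    (b : Module.Basis (Fin g ⊕ Fin g) k H) (L : List YoungDiagram)
    (φ : ∀ i : Fin L.length, (L.get i).cells ≃ ZMod s) :
    (⨁ i : Fin L.length, (irrepSub ω b (L.get i)).toSubmodule) →ₗ[k] ⨂[k] _ : ZMod s, H :=
  DirectSum.toModule k _ _ fun i =>
    (PiTensorProduct.reindex k (fun _ : (L.get i).cells => H) (φ i)).toLinearMap ∘ₗ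
      (irrepSub ω b (L.get i)).toSubmodule.subtype

omit [NeZero s] in
theorem cyclePlacement_lof (i : Fin L.length) (x : (irrepSub ω b (L.get i)).toSubmodule) :
    cyclePlacement ω b L φ (DirectSum.lof k _ _ i x) =
      PiTensorProduct.reindex k (fun _ => H) (φ i) x.1 := by
  rw [cyclePlacement, DirectSum.toModule_lof]
  rfl

omit [NeZero s] in
theorem tensorRep_cyclePlacement (f : Sp ω)
    (x : ⨁ i : Fin L.length, (irrepSub ω b (L.get i)).toSubmodule) :
    tensorRep ω _ f (cyclePlacement ω b L φ x) =
      cyclePlacement ω b L φ (irrepSum ω b L f x) := by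
  have h : tensorRep ω _ f ∘ₗ cyclePlacement ω b L φ =
      cyclePlacement ω b L φ ∘ₗ irrepSum ω b L f := by
    refine DirectSum.linearMap_ext _ fun i => LinearMap.ext fun x => ?_
    simp only [LinearMap.comp_apply, cyclePlacement_lof]
    have h1 : irrepSum ω b L f (DirectSum.lof k _ _ i x) =
        DirectSum.lof k _ _ i (irrep ω b (L.get i) f x) := by
      rw [irrepSum, Representation.directSum_apply, DirectSum.lmap_lof]
    rw [h1, cyclePlacement_lof]
    exact tensorRep_reindex f (φ i) x.1
  exact LinearMap.congr_fun h x

omit [NeZero s] in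
theorem cyclePlacement_mem_traceless (hb : IsSymplecticBasis ω b)
    (hL : ∀ i : Fin L.length, ∀ c : (L.get i).cells, c.1.1 < g)
    (x : ⨁ i : Fin L.length, (irrepSub ω b (L.get i)).toSubmodule) :
    cyclePlacement ω b L φ x ∈ traceless ω (ZMod s) := by
  induction x using DirectSum.induction_on with
  | zero => rw [map_zero]; exact Submodule.zero_mem _
  | of i x =>
    have := cyclePlacement_lof (ω := ω) (b := b) L φ i x
    exact this ▸ reindex_mem_traceless hb (hL i) (φ i) x.2
  | add x y hx hy => rw [map_add]; exact Submodule.add_mem _ hx hy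

omit [NeZero s] in
theorem cyclePlacement_eq_sum (x : ⨁ i : Fin L.length, (irrepSub ω b (L.get i)).toSubmodule) :
    cyclePlacement ω b L φ x =
      ∑ i, PiTensorProduct.reindex k (fun _ => H) (φ i) (x i).1 := by
  induction x using DirectSum.induction_on with
  | zero => simp
  | of i x =>
    refine (cyclePlacement_lof (ω := ω) (b := b) L φ i x).trans ?_
    rw [Finset.sum_eq_single i]
    · rw [DirectSum.of_eq_same]
    · intro j _ hj
      rw [DirectSum.of_eq_of_ne _ _ _ hj]
      simp
    · simp
  | add x y hx hy =>
    rw [map_add, hx, hy, ← Finset.sum_add_distrib]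
    exact Finset.sum_congr rfl fun i _ => by simp

variable [CharZero k]

theorem cyclePlacement_injective (hb : IsSymplecticBasis ω b)
    (hL : ∀ i : Fin L.length, ∀ c : (L.get i).cells, c.1.1 < g)
    (hind : ∀ c : Fin L.length → k, ∑ i, c i • averagedVector b (φ i) = 0 → c = 0)
    (x : ⨁ i : Fin L.length, (irrepSub ω b (L.get i)).toSubmodule)
    (hx : dihedralAverage k H s (cyclePlacement ω b L φ x) = 0) : x = 0 := by
  set K : Submodule k (⨁ i : Fin L.length, (irrepSub ω b (L.get i)).toSubmodule) :=
    LinearMap.ker (dihedralAverage k H s ∘ₗ cyclePlacement ω b L φ) with hK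
  set ψ : (⨁ i : Fin L.length, (irrepSub ω b (L.get i)).toSubmodule) →ₗ[k]
      ∀ i : Fin L.length, ⨂[k] _ : (L.get i).cells, H :=
    LinearMap.pi fun i => (irrepSub ω b (L.get i)).toSubmodule.subtype ∘ₗ
      DirectSum.component k _ _ i with hψ
  have hψa : ∀ x i, ψ x i = (x i).1 := fun x i => rfl
  have hψi : ∀ x, ψ x = 0 → x = 0 := by
    intro x hx
    refine DFinsupp.ext fun i => Subtype.ext ?_
    exact (hψa x i).symm.trans (congrFun hx i)
  by_contra hx0
  have hcell : ∀ i : Fin L.length, Fintype.card (L.get i).cells ≤ s := by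
    intro i
    rw [Fintype.card_congr (φ i), ZMod.card]
  obtain ⟨y, ⟨z, hz, rfl⟩, hy0, hyh⟩ := exists_isHighestVector hb hcell (K.map ψ) (by
      rintro f _ ⟨z, hz, rfl⟩
      refine ⟨irrepSum ω b L f z, ?_, ?_⟩
      · have hz' : dihedralAverage k H s (cyclePlacement ω b L φ z) = 0 := hz
        change dihedralAverage k H s (cyclePlacement ω b L φ (irrepSum ω b L f z)) = 0
        rw [← tensorRep_cyclePlacement, ← tensorRep_dihedralAverage, hz', map_zero]
      · funext i
        rfl)
    (by
      rintro _ ⟨z, hz, rfl⟩ i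
      exact irrepSub_le_traceless hb (hL i) (z i).2)
    (by
      intro h
      have : ψ x ∈ K.map ψ := Submodule.mem_map_of_mem hx
      rw [h, Submodule.mem_bot] at this
      exact hx0 (hψi x this))
  have h1 : ∀ i, (z i).1 = coord b (z i).1 (fun c => Sum.inl (rowWord (hL i) c)) •
      highestWeightVector b (L.get i) := fun i => (hyh i).eq_smul (hL i) (z i).2
  have hz' : dihedralAverage k H s (cyclePlacement ω b L φ z) = 0 := hz
  have h2 := hind (fun i => coord b (z i).1 (fun c => Sum.inl (rowWord (hL i) c))) (by
    rw [← hz', cyclePlacement_eq_sum, map_sum]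
    refine Finset.sum_congr rfl fun i _ => ?_
    rw [averagedVector, ← map_smul, ← map_smul, ← h1])
  refine hy0 (funext fun i => ?_)
  rw [hψa, h1, show coord b (z i).1 (fun c => Sum.inl (rowWord (hL i) c)) = 0 from congrFun h2 i,
    zero_smul]
  rfl

theorem exists_cyclePlacement_eq (hb : IsSymplecticBasis ω b)
    (hL : ∀ i : Fin L.length, ∀ c : (L.get i).cells, c.1.1 < g)
    (hspan : ∀ x : ⨂[k] _ : ZMod s, H, IsHighestVector b x →
      (∀ d, dihedralTensorRep k H s d x = x) →
      ∃ c : Fin L.length → k, x = ∑ i, c i • averagedVector b (φ i))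
    {y : ⨂[k] _ : ZMod s, H} (hy : y ∈ traceless ω (ZMod s))
    (hyd : ∀ d, dihedralTensorRep k H s d y = y) :
    ∃ x, dihedralAverage k H s (cyclePlacement ω b L φ x) = y := by
  set Z := LinearMap.range (dihedralAverage k H s ∘ₗ cyclePlacement ω b L φ) with hZ
  set W : Submodule k (⨂[k] _ : ZMod s, H) :=
    traceless ω (ZMod s) ⊓ LinearMap.ker (dihedralAverage k H s - LinearMap.id) with hW
  have hWm : ∀ x, x ∈ W ↔ x ∈ traceless ω (ZMod s) ∧ ∀ d, dihedralTensorRep k H s d x = x := by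
    intro x
    simp only [hW, Submodule.mem_inf, LinearMap.mem_ker, LinearMap.sub_apply, LinearMap.id_apply,
      sub_eq_zero]
    refine and_congr_right fun _ => ⟨fun h d => ?_, dihedralAverage_eq_self⟩
    rw [← h, dihedralTensorRep_dihedralAverage]
  have hZW : Z ≤ W := by
    rintro _ ⟨x, rfl⟩
    exact (hWm _).2 ⟨dihedralAverage_mem_traceless (cyclePlacement_mem_traceless L φ hb hL x),
      fun d => dihedralTensorRep_dihedralAverage d _⟩
  have hZs : ∀ (f : Sp ω), ∀ z ∈ Z, tensorRep ω _ f z ∈ Z := by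
    rintro f _ ⟨x, rfl⟩
    refine ⟨irrepSum ω b L f x, ?_⟩
    simp only [LinearMap.comp_apply]
    rw [tensorRep_dihedralAverage, tensorRep_cyclePlacement]
  have hu : ∀ i, averagedVector b (φ i) ∈ Z := fun i =>
    ⟨DirectSum.lof k _ _ i ⟨_, highestWeightVector_mem_irrepSub ω b (L.get i)⟩, by
      rw [LinearMap.comp_apply, cyclePlacement_lof, averagedVector]⟩
  set B := tensorForm ω (ZMod s) with hB
  set P : Submodule k (⨂[k] _ : ZMod s, H) :=
    W ⊓ ⨅ z : Z, LinearMap.ker (B z.1) with hP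
  have hPm : ∀ x, x ∈ P ↔ x ∈ W ∧ ∀ z ∈ Z, B z x = 0 := by
    intro x
    simp [hP]
  have hPs : ∀ (f : Sp ω), ∀ x ∈ P, tensorRep ω _ f x ∈ P := by
    intro f x hx
    rw [hPm, hWm] at hx ⊢
    refine ⟨⟨(tracelessSp ω (ZMod s) f ⟨x, hx.1.1⟩).2, fun d => ?_⟩, fun z hz => ?_⟩
    · rw [← tensorRep_dihedralTensorRep, hx.1.2]
    · have h1 := hx.2 _ (hZs f⁻¹ z hz)
      rw [← tensorForm_tensorRep f, ← Module.End.mul_apply, ← map_mul, mul_inv_cancel, map_one]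
        at h1
      exact h1
  have hPbot : P = ⊥ := by
    by_contra hne
    obtain ⟨x, hx, hx0, hxh⟩ := exists_isHighestVector_of_stable hb P hPs
      (inf_le_left.trans inf_le_left) hne
    obtain ⟨c, hc⟩ := hspan x hxh ((hWm x).1 ((hPm x).1 hx).1).2
    choose u hu' using fun i => exists_rat_coord_averagedVector (b := b) (hL i) (φ i)
    have hxw : ∀ w, coord b x w = ∑ i, c i * (u i w : k) := by
      intro w
      rw [hc, map_sum, Finset.sum_apply]
      simp only [map_smul, Pi.smul_apply, smul_eq_mul, hu']
    refine hx0 (eq_zero_of_coord b fun w => ?_)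
    rw [hxw]
    refine sum_eq_zero_of_orthogonal u c (fun j => ?_) w
    have h1 := ((hPm _).1 (hPs (rotationSp hb) x hx)).2 _ (hu j)
    rw [hB, tensorForm_rotation hb] at h1
    simpa only [hxw, hu'] using h1
  have hfin : Module.Finite k (⨂[k] _ : ZMod s, H) :=
    Module.Finite.of_basis (Basis.piTensorProduct fun _ : ZMod s => b)
  have hZeq : Z = W := by
    refine Submodule.eq_of_le_of_finrank_le hZW ?_
    rw [← Subspace.dual_finrank_eq (V := Z)]
    refine LinearMap.finrank_le_finrank_of_injective
      (f := (LinearMap.flip B).domRestrict₁₂ W Z) ?_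
    rw [← LinearMap.ker_eq_bot, LinearMap.ker_eq_bot']
    intro x hx
    have : x.1 ∈ P := (hPm _).2 ⟨x.2, fun z hz => LinearMap.congr_fun hx ⟨z, hz⟩⟩
    rw [hPbot, Submodule.mem_bot] at this
    exact Subtype.ext this
  have hyZ : y ∈ Z := by
    rw [hZeq]
    exact (hWm y).2 ⟨hy, hyd⟩
  exact hyZ

theorem nonempty_equiv_irrepSum (hb : IsSymplecticBasis ω b)
    (hL : ∀ i : Fin L.length, ∀ c : (L.get i).cells, c.1.1 < g)
    (hind : ∀ c : Fin L.length → k, ∑ i, c i • averagedVector b (φ i) = 0 → c = 0)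
    (hspan : ∀ x : ⨂[k] _ : ZMod s, H, IsHighestVector b x →
      (∀ d, dihedralTensorRep k H s d x = x) →
      ∃ c : Fin L.length → k, x = ∑ i, c i • averagedVector b (φ i)) :
    Nonempty ((dihedralCoinvariants ω s).Equiv (irrepSum ω b L)) := by
  set F : (⨁ i : Fin L.length, (irrepSub ω b (L.get i)).toSubmodule) →ₗ[k]
      (tracelessDihedral ω s).Coinvariants :=
    Representation.Coinvariants.mk (tracelessDihedral ω s) ∘ₗ
      (cyclePlacement ω b L φ).codRestrict (traceless ω (ZMod s))
        (cyclePlacement_mem_traceless L φ hb hL) with hF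
  have hFs : ∀ f : Sp ω, F ∘ₗ irrepSum ω b L f = dihedralCoinvariants ω s f ∘ₗ F := by
    intro f
    refine LinearMap.ext fun x => ?_
    simp only [hF, LinearMap.comp_apply, dihedralCoinvariants_mk]
    exact congrArg _ (Subtype.ext (tensorRep_cyclePlacement L φ f x).symm)
  have hFi : Function.Injective F := by
    intro x y hxy
    have h0 : F (x + (-1 : k) • y) = 0 := by
      rw [map_add, map_smul, hxy, neg_one_smul, add_neg_cancel]
    have h1 := cyclePlacement_injective L φ hb hL hind _ (mk_eq_zero_of_average _ h0)
    calc x = x + ((-1 : k) + 1) • y := by rw [neg_add_cancel, zero_smul, add_zero]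
      _ = y := by rw [add_smul, ← add_assoc, h1, one_smul, zero_add]
  have hFsurj : Function.Surjective F := by
    intro y
    obtain ⟨y, rfl⟩ := Representation.Coinvariants.mk_surjective _ y
    obtain ⟨x, hx⟩ := exists_cyclePlacement_eq L φ hb hL hspan
      (dihedralAverage_mem_traceless y.2) fun d => dihedralTensorRep_dihedralAverage d y.1
    refine ⟨x, ?_⟩
    rw [hF, LinearMap.comp_apply, ← mk_average, ← mk_average y]
    exact congrArg _ (Subtype.ext hx)
  exact ⟨(Representation.IntertwiningMap.ofBijective ⟨F, hFs⟩ ⟨hFi, hFsurj⟩).symm⟩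

end Decomposition

section Enumeration

/-- The weakly decreasing sequences of length `t` with entries at most `m` and with sum `n`. -/
def boundedPartitions : ℕ → ℕ → ℕ → List (List ℕ)
  | 0, _, n => if n = 0 then [[]] else []
  | t + 1, m, n => (List.range (min m n + 1)).flatMap fun a =>
      (boundedPartitions t a (n - a)).map (a :: ·)

theorem map_range_mem_boundedPartitions (t m n : ℕ) (c : ℕ → ℕ) (hc : Antitone c) (hm : c 0 ≤ m)
    (hn : ∑ i ∈ Finset.range t, c i = n) :
    (List.range t).map c ∈ boundedPartitions t m n := by
  induction t generalizing m n c with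
  | zero =>
    rw [Finset.sum_range_zero] at hn
    simp [boundedPartitions, ← hn]
  | succ t ih =>
    rw [Finset.sum_range_succ'] at hn
    rw [List.range_succ_eq_map, List.map_cons, List.map_map, boundedPartitions,
      List.mem_flatMap]
    refine ⟨c 0, List.mem_range.2 (by omega), List.mem_map_of_mem
      (ih _ _ _ ?_ ?_ (Nat.eq_sub_of_add_eq hn))⟩
    · exact fun i j hij => hc (Nat.succ_le_succ hij)
    · exact hc (Nat.zero_le 1)

/-- The words of length `n` in which the letter `i` occurs `ν i` times. -/
def wordsOfCount : ℕ → List ℕ → List (List ℕ)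
  | 0, _ => [[]]
  | n + 1, ν => (List.range ν.length).flatMap fun i => if ν.getD i 0 = 0 then [] else
      (wordsOfCount n (ν.set i (ν.getD i 0 - 1))).map (i :: ·)

theorem mem_wordsOfCount (l : List ℕ) (ν : List ℕ) (h : ∀ i, l.count i = ν.getD i 0) :
    l ∈ wordsOfCount l.length ν := by
  induction l generalizing ν with
  | nil => simp [wordsOfCount]
  | cons a l ih =>
    have ha := h a
    rw [List.count_cons_self] at ha
    have hlt : a < ν.length := by
      by_contra hlt
      rw [List.getD_eq_default _ _ (not_lt.1 hlt)] at ha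
      omega
    rw [List.length_cons, wordsOfCount, List.mem_flatMap]
    refine ⟨a, List.mem_range.2 hlt, ?_⟩
    rw [if_neg (by omega)]
    refine List.mem_map_of_mem (ih _ fun i => ?_)
    have hi := h i
    rcases eq_or_ne a i with rfl | hai
    · simp only [List.getD_eq_getElem?_getD, List.getElem?_set_self hlt, Option.getD_some] at *
      omega
    · rw [List.count_cons_of_ne hai] at hi
      rw [hi]
      simp only [List.getD_eq_getElem?_getD, List.getElem?_set_ne hai]

end Enumeration

section Certificate

/-- A formal linear combination of words. -/
abbrev WordRow := List (ℤ × List ℕ)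

/-- A linear functional on formal linear combinations of words. -/
def evalRow {k : Type*} [Ring k] (X : List ℕ → k) (r : WordRow) : k :=
  (r.map fun t => (t.1 : k) * X t.2).sum

/-- The relation that expresses that a function is killed by the operator `j ↦ i`. -/
def raiseRow (i j : ℕ) (l : List ℕ) : WordRow :=
  ((List.range l.length).filter fun p => l.getD p 0 = i).map fun p => (1, l.set p j)

/-- The images of a word under the dihedral group, with signs. -/
def dihedralImages (ε : ℤ) (l : List ℕ) : WordRow :=
  (List.range l.length).flatMap fun n => [(1, l.rotate n), (ε, (l.rotate n).reverse)]

/-- The number with the given decimal digits. -/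
def wordCode (l : List ℕ) : ℕ := l.foldl (fun c a => 10 * c + a) 0

/-- The least image of a word under the dihedral group, with its sign. The sign is `0` for a word
that is its own negative. -/
def canonicalWord (ε : ℤ) (l : List ℕ) : ℤ × List ℕ :=
  if (-1, l) ∈ dihedralImages ε l then (0, l)
  else (dihedralImages ε l).foldl (fun t u => if wordCode u.2 < wordCode t.2 then u else t) (1, l)

/-- Addition of a term to a formal linear combination. -/
def insertTerm (t : ℤ × List ℕ) : WordRow → WordRow
  | [] => [t]
  | u :: r => if u.2 = t.2 then (u.1 + t.1, u.2) :: r else u :: insertTerm t r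

/-- The normal form of a linear combination modulo the dihedral symmetries and the words in `Z`. -/
def reduceRow (ε : ℤ) (Z : List (List ℕ)) (r : WordRow) : WordRow :=
  (((r.map fun t => ((canonicalWord ε t.2).1 * t.1, (canonicalWord ε t.2).2)).filter
    fun t => t.2 ∉ Z).foldr insertTerm []).filter fun t => t.1 ≠ 0

/-- A linear combination of raising relations. -/
def combineRows (c : List (ℤ × ℕ × ℕ × List ℕ)) : WordRow :=
  c.flatMap fun t => if t.2.1 < t.2.2.1 then
    (raiseRow t.2.1 t.2.2.1 t.2.2.2).map fun u => (t.1 * u.1, u.2) else []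

/-- Adds to the list `Z` a word that is forced to vanish by a combination of relations. -/
def extendZeros (ε : ℤ) (Z : List (List ℕ)) (c : List (ℤ × ℕ × ℕ × List ℕ)) : List (List ℕ) :=
  match reduceRow ε Z (combineRows c) with
  | [t] => t.2 :: Z
  | _ => Z

/-- Whether the words in `P` and the given sequence of combinations of relations force all words
of length `n + 1` to vanish. By rotation it suffices to consider words that start with `0`. -/
def isComplete (n : ℕ) (ε : ℤ) (P : List (List ℕ)) (C : List (List (ℤ × ℕ × ℕ × List ℕ))) : Bool :=
  (boundedPartitions (n + 1) (n + 1) (n + 1)).all fun ν =>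
    (wordsOfCount n (ν.set 0 (ν.getD 0 0 - 1))).all fun l =>
      (canonicalWord ε (0 :: l)).1 = 0 ||
        (canonicalWord ε (0 :: l)).2 ∈ C.foldl (extendZeros ε) P

/-- A function on words that is invariant under the dihedral group, is killed by the raising
operators, and is supported on words with dominant weight. -/
structure IsCyclicHighest {k : Type*} [Ring k] (s : ℕ) (ε : ℤ) (X : List ℕ → k) : Prop where
  length_eq : ∀ l, X l ≠ 0 → l.length = s
  rotate : ∀ l, X (l.rotate 1) = X l
  reverse : ∀ l, X l.reverse = ε * X l
  raise : ∀ i j l, i < j → evalRow X (raiseRow i j l) = 0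
  count_le : ∀ l i, X l ≠ 0 → l.count (i + 1) ≤ l.count i

variable {k : Type*} [Field k] {X : List ℕ → k} {s : ℕ} {ε : ℤ}

@[simp]
theorem evalRow_nil : evalRow X [] = 0 := by simp [evalRow]

@[simp]
theorem evalRow_cons (t : ℤ × List ℕ) (r : WordRow) :
    evalRow X (t :: r) = t.1 * X t.2 + evalRow X r := by simp [evalRow]

theorem evalRow_append (r r' : WordRow) : evalRow X (r ++ r') = evalRow X r + evalRow X r' := by
  simp [evalRow]

theorem evalRow_map_mul (c : ℤ) (r : WordRow) :
    evalRow X (r.map fun u => (c * u.1, u.2)) = c * evalRow X r := by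
  induction r with
  | nil => simp
  | cons t r ih => simp [ih, mul_add, mul_assoc]

theorem evalRow_map {f : ℤ × List ℕ → ℤ × List ℕ}
    (hf : ∀ t, ((f t).1 : k) * X (f t).2 = t.1 * X t.2) (r : WordRow) :
    evalRow X (r.map f) = evalRow X r := by
  induction r with
  | nil => simp
  | cons t r ih => simp [ih, hf]

theorem evalRow_filter {p : ℤ × List ℕ → Bool} (hp : ∀ t, p t = false → (t.1 : k) * X t.2 = 0)
    (r : WordRow) : evalRow X (r.filter p) = evalRow X r := by
  induction r with
  | nil => simp
  | cons t r ih =>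
    rw [List.filter_cons]
    split_ifs with h
    · simp [ih]
    · rw [ih, evalRow_cons, hp t (by simpa using h), zero_add]

theorem evalRow_insertTerm (t : ℤ × List ℕ) (r : WordRow) :
    evalRow X (insertTerm t r) = t.1 * X t.2 + evalRow X r := by
  induction r with
  | nil => simp [insertTerm]
  | cons u r ih =>
    rw [insertTerm]
    split_ifs with h
    · simp only [evalRow_cons, ← h]
      push_cast
      ring
    · simp only [evalRow_cons, ih]
      ring

theorem evalRow_foldr_insertTerm (r : WordRow) :
    evalRow X (r.foldr insertTerm []) = evalRow X r := by
  induction r with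
  | nil => rfl
  | cons t r ih => rw [List.foldr_cons, evalRow_insertTerm, ih, evalRow_cons]

namespace IsCyclicHighest

variable (hX : IsCyclicHighest s ε X) (hε : ε * ε = 1)

include hX in
theorem rotate_eq (l : List ℕ) (n : ℕ) : X (l.rotate n) = X l := by
  induction n with
  | zero => rw [List.rotate_zero]
  | succ n ih => rw [← List.rotate_rotate, hX.rotate, ih]

include hX hε in
theorem eq_of_mem_dihedralImages {l : List ℕ} {t : ℤ × List ℕ} (ht : t ∈ dihedralImages ε l) :
    X l = t.1 * X t.2 := by
  obtain ⟨n, -, ht⟩ := List.mem_flatMap.1 ht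
  have hε' : (ε : k) * ε = 1 := by exact_mod_cast congrArg (Int.cast (R := k)) hε
  simp only [List.mem_cons, List.not_mem_nil, or_false] at ht
  rcases ht with rfl | rfl
  · simp [hX.rotate_eq]
  · simp [hX.reverse, hX.rotate_eq, ← mul_assoc, hε']

include hX hε in
theorem eq_canonicalWord [CharZero k] (l : List ℕ) :
    X l = (canonicalWord ε l).1 * X (canonicalWord ε l).2 := by
  rw [canonicalWord]
  split_ifs with h
  · have := hX.eq_of_mem_dihedralImages hε h
    simp only [Int.cast_zero, zero_mul]
    simp only [Int.cast_neg, Int.cast_one, neg_mul, one_mul] at this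
    exact self_eq_neg.1 this
  · have key : ∀ (r : WordRow) (u : ℤ × List ℕ), X l = u.1 * X u.2 →
        (∀ t ∈ r, X l = (t.1 : k) * X t.2) →
        X l = ((r.foldl (fun t u => if wordCode u.2 < wordCode t.2 then u else t) u).1 : k) *
          X (r.foldl (fun t u => if wordCode u.2 < wordCode t.2 then u else t) u).2 := by
      intro r
      induction r with
      | nil => exact fun u hu _ => hu
      | cons t r ih =>
        intro u hu hr
        rw [List.foldl_cons]
        refine ih _ ?_ fun t ht => hr t (List.mem_cons_of_mem _ ht)
        split_ifs
        exacts [hr t List.mem_cons_self, hu]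
    exact key _ _ (by simp) fun t ht => hX.eq_of_mem_dihedralImages hε ht

include hX hε in
theorem evalRow_reduceRow [CharZero k] {Z : List (List ℕ)} (hZ : ∀ l ∈ Z, X l = 0) (r : WordRow) :
    evalRow X (reduceRow ε Z r) = evalRow X r := by
  rw [reduceRow, evalRow_filter, evalRow_foldr_insertTerm, evalRow_filter, evalRow_map]
  · intro t
    rw [hX.eq_canonicalWord hε t.2]
    push_cast
    ring
  · intro t ht
    rw [hZ t.2 (by simpa using ht), mul_zero]
  · intro t ht
    rw [show t.1 = 0 by simpa using ht]
    simp

include hX in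
theorem evalRow_combineRows (c : List (ℤ × ℕ × ℕ × List ℕ)) : evalRow X (combineRows c) = 0 := by
  induction c with
  | nil => rfl
  | cons t c ih =>
    rw [combineRows, List.flatMap_cons, evalRow_append]
    refine (congrArg₂ _ ?_ ih).trans (add_zero 0)
    split_ifs with h
    · rw [evalRow_map_mul, hX.raise _ _ _ h, mul_zero]
    · rfl

include hX hε in
theorem eq_zero_of_mem_extendZeros [CharZero k] {Z : List (List ℕ)} (hZ : ∀ l ∈ Z, X l = 0)
    (c : List (ℤ × ℕ × ℕ × List ℕ)) : ∀ l ∈ extendZeros ε Z c, X l = 0 := by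
  have h := hX.evalRow_reduceRow hε hZ (combineRows c)
  rw [hX.evalRow_combineRows] at h
  rw [extendZeros]
  split
  · rename_i t ht
    rw [ht, evalRow_cons, evalRow_nil, add_zero] at h
    have ht0 : t.1 ≠ 0 := by
      have : t ∈ reduceRow ε Z (combineRows c) := by rw [ht]; exact List.mem_cons_self
      rw [reduceRow, List.mem_filter] at this
      simpa using this.2
    intro l hl
    rcases List.mem_cons.1 hl with rfl | hl
    · exact (mul_eq_zero.1 h).resolve_left (Int.cast_ne_zero.2 ht0)
    · exact hZ l hl
  · exact hZ

include hX in
theorem count_antitone {l : List ℕ} (hl : X l ≠ 0) : Antitone (l.count ·) :=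
  antitone_nat_of_succ_le fun i => hX.count_le l i hl

include hX in
theorem lt_of_mem {l : List ℕ} (hl : X l ≠ 0) {a : ℕ} (ha : a ∈ l) : a < s := by
  have h : List.range (a + 1) ⊆ l := by
    intro i hi
    have h1 := hX.count_antitone hl (Nat.lt_succ_iff.1 (List.mem_range.1 hi))
    exact List.count_pos_iff.1 (lt_of_lt_of_le (List.count_pos_iff.2 ha) h1)
  have := (List.subperm_of_subset List.nodup_range h).length_le
  rw [List.length_range, hX.length_eq l hl] at this
  exact this

include hX in
theorem exists_cons_ne_zero {l : List ℕ} (hs : s ≠ 0) (hl : X l ≠ 0) : ∃ l', X (0 :: l') ≠ 0 := by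
  have h0 : 0 ∈ l := by
    obtain ⟨a, ha⟩ := List.exists_mem_of_length_pos (l := l)
      ((hX.length_eq l hl).symm ▸ Nat.pos_of_ne_zero hs)
    exact List.count_pos_iff.1 (lt_of_lt_of_le (List.count_pos_iff.2 ha)
      (hX.count_antitone hl (Nat.zero_le a)))
  obtain ⟨l₁, l₂, rfl⟩ := List.append_of_mem h0
  refine ⟨l₂ ++ l₁, ?_⟩
  rwa [← List.cons_append, ← List.rotate_append_length_eq, hX.rotate_eq]

end IsCyclicHighest

theorem IsCyclicHighest.eq_zero_of_isComplete [CharZero k] {n : ℕ}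
    (hX : IsCyclicHighest (n + 1) ε X) (hε : ε * ε = 1) {P : List (List ℕ)}
    (hP : ∀ l ∈ P, X l = 0) {C : List (List (ℤ × ℕ × ℕ × List ℕ))}
    (hC : isComplete n ε P C = true) (l : List ℕ) : X l = 0 := by
  by_contra hl'
  obtain ⟨l, hl⟩ := hX.exists_cons_ne_zero n.succ_ne_zero hl'
  have hZ : ∀ l ∈ C.foldl (extendZeros ε) P, X l = 0 := by
    clear hC
    induction C generalizing P with
    | nil => exact hP
    | cons c C ih => exact ih (hX.eq_zero_of_mem_extendZeros hε hP c)
  have hanti := hX.count_antitone hl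
  have hlen : l.length = n := Nat.succ_injective (hX.length_eq _ hl)
  set ν := (List.range (n + 1)).map ((0 :: l).count ·) with hν
  have h1 : ν ∈ boundedPartitions (n + 1) (n + 1) (n + 1) := by
    refine map_range_mem_boundedPartitions _ _ _ _ hanti
      (List.count_le_length.trans (hX.length_eq _ hl).le) ?_
    have := Multiset.sum_count_eq_card (s := Finset.range (n + 1)) (m := ((0 :: l : List ℕ) : Multiset ℕ))
      fun a ha => Finset.mem_range.2 (hX.lt_of_mem hl ha)
    simpa only [Multiset.coe_count, Multiset.coe_card, hX.length_eq _ hl] using this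
  have hcount : ∀ i, (0 :: l).count i = ν.getD i 0 := by
    intro i
    by_cases hi : i < n + 1
    · simp [hν, hi]
    · rw [List.getD_eq_default _ _ (by simpa [hν] using hi), List.count_eq_zero]
      exact fun h => hi (hX.lt_of_mem hl h)
  have h2 : l ∈ wordsOfCount n (ν.set 0 (ν.getD 0 0 - 1)) := by
    rw [← hlen]
    refine mem_wordsOfCount l _ fun i => ?_
    have hi := hcount i
    rcases eq_or_ne 0 i with rfl | h0i
    · rw [List.count_cons_self] at hi
      rw [List.getD_eq_getElem?_getD, List.getElem?_set_self (by simp [hν]), Option.getD_some]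
      omega
    · rw [List.count_cons_of_ne h0i] at hi
      rw [hi, List.getD_eq_getElem?_getD, List.getD_eq_getElem?_getD, List.getElem?_set_ne h0i]
  rw [isComplete, List.all_eq_true] at hC
  have h3 := List.all_eq_true.1 (hC _ h1) _ h2
  refine hl ((hX.eq_canonicalWord hε _).trans ?_)
  rw [Bool.or_eq_true, decide_eq_true_eq, decide_eq_true_eq] at h3
  rcases h3 with h3 | h3
  · rw [h3, Int.cast_zero, zero_mul]
  · rw [hZ _ h3, mul_zero]

end Certificate

/-- Combinations of raising relations that determine the dihedral highest vectors in degree `4`. -/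
def raisingCertificateFour : List (List (ℤ × ℕ × ℕ × List ℕ)) :=
  [[(-1, 1, 3, [0, 2, 1, 1]), (1, 0, 2, [3, 0, 0, 1])], [(1, 0, 1, [0, 0, 2, 3])],
    [(1, 0, 2, [0, 0, 1, 3])]]

/-- Combinations of raising relations that determine the dihedral highest vectors in degree `5`. -/
def raisingCertificateFive : List (List (ℤ × ℕ × ℕ × List ℕ)) :=
  [[(1, 0, 1, [0, 0, 0, 0, 0])], [(1, 0, 1, [0, 0, 0, 0, 1])], [(1, 1, 2, [0, 0, 0, 1, 1])],
    [(1, 1, 2, [0, 0, 1, 0, 1])], [(1, 0, 2, [0, 0, 0, 1, 1])], [(1, 1, 2, [0, 0, 1, 1, 1])],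
    [(1, 1, 2, [0, 1, 0, 1, 1])], [(1, 1, 2, [0, 0, 1, 3, 1])], [(1, 1, 2, [0, 1, 1, 0, 3])],
    [(1, 1, 3, [0, 0, 1, 1, 2])], [(1, 1, 3, [0, 0, 1, 2, 1])], [(1, 1, 3, [0, 1, 0, 1, 2])],
    [(1, 1, 3, [0, 1, 1, 0, 2])], [(1, 0, 1, [0, 0, 2, 3, 4])], [(1, 0, 2, [0, 0, 1, 4, 3])],
    [(1, 0, 2, [0, 1, 0, 3, 4])], [(1, 0, 3, [0, 0, 1, 2, 4])], [(1, 0, 3, [0, 0, 2, 1, 4])],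
    [(1, 0, 3, [0, 1, 2, 0, 4])], [(1, 0, 3, [0, 1, 4, 0, 2])], [(1, 0, 4, [0, 0, 1, 3, 2])],
    [(1, 0, 4, [0, 1, 0, 2, 3])], [(1, 1, 2, [0, 1, 3, 4, 1])], [(1, 1, 2, [0, 1, 4, 1, 3])]]

/-- Combinations of raising relations that determine the dihedral highest vectors in degree `6`. -/
def raisingCertificateSix : List (List (ℤ × ℕ × ℕ × List ℕ)) :=
  [[(2, 0, 1, [0, 0, 0, 0, 1, 2]), (1, 0, 1, [0, 0, 0, 1, 0, 2]), (1, 1, 2, [0, 0, 1, 0, 1, 1])],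
    [(1, 0, 1, [0, 0, 0, 0, 1, 2])], [(1, 0, 1, [0, 0, 0, 1, 0, 2])],
    [(1, 1, 2, [0, 0, 0, 1, 1, 3])], [(1, 1, 3, [0, 0, 0, 1, 1, 2])],
    [(1, 0, 3, [0, 0, 0, 0, 1, 2]), (1, 1, 2, [0, 0, 1, 1, 0, 3])], [(1, 0, 3, [0, 0, 0, 0, 1, 2])],
    [(1, 1, 3, [0, 0, 1, 0, 1, 2])], [(1, 1, 3, [0, 0, 1, 0, 2, 1])],
    [(1, 2, 3, [0, 0, 1, 2, 0, 2])], [(1, 2, 3, [0, 0, 2, 0, 1, 2])],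
    [(1, 0, 1, [0, 0, 0, 2, 0, 3])], [(1, 0, 1, [0, 0, 2, 0, 1, 2])],
    [(1, 0, 1, [0, 0, 0, 1, 2, 2]), (1, 0, 1, [0, 0, 1, 0, 2, 2])], [(1, 0, 1, [0, 0, 0, 1, 2, 2])],
    [(1, 0, 2, [0, 0, 0, 1, 1, 2])], [(1, 0, 2, [0, 0, 1, 0, 1, 2])],
    [(1, 2, 3, [0, 0, 1, 1, 2, 2])], [(1, 2, 3, [0, 1, 2, 0, 1, 2])],
    [(1, 0, 1, [0, 0, 2, 0, 1, 3])], [(1, 0, 2, [0, 0, 0, 1, 1, 3])],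
    [(1, 0, 3, [0, 0, 0, 1, 1, 2])], [(1, 0, 3, [0, 0, 1, 1, 0, 2])],
    [(1, 1, 2, [0, 0, 1, 1, 1, 3])], [(1, 1, 2, [0, 1, 1, 0, 1, 3])],
    [(1, 1, 3, [0, 0, 1, 1, 1, 2])], [(1, 1, 3, [0, 0, 1, 1, 2, 1])],
    [(1, 0, 1, [0, 0, 0, 1, 2, 3])], [(1, 0, 1, [0, 0, 0, 1, 3, 2])],
    [(1, 0, 1, [0, 0, 0, 2, 1, 3])],
    [(-1, 2, 3, [2, 0, 4, 1, 0, 2]), (1, 1, 4, [3, 0, 1, 1, 0, 2])],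
    [(1, 1, 2, [0, 1, 3, 0, 1, 4])], [(1, 1, 3, [0, 1, 1, 0, 2, 4])],
    [(1, 1, 3, [0, 1, 2, 0, 4, 1])], [(1, 1, 4, [0, 1, 1, 0, 2, 3])],
    [(1, 1, 4, [0, 1, 2, 0, 3, 1])], [(1, 1, 3, [2, 1, 1, 4, 0, 0]), (1, 2, 4, [0, 0, 2, 1, 3, 2])],
    [(1, 0, 1, [0, 0, 2, 0, 3, 4])], [(1, 0, 3, [0, 0, 2, 0, 1, 4])],
    [(1, 0, 3, [0, 0, 2, 1, 0, 4])], [(1, 1, 2, [0, 0, 1, 1, 3, 4])],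
    [(1, 1, 2, [0, 0, 1, 3, 1, 4])], [(1, 1, 2, [0, 1, 0, 1, 4, 3])],
    [(1, 1, 2, [0, 1, 1, 3, 0, 4])], [(1, 1, 3, [0, 0, 1, 1, 2, 4])],
    [(1, 1, 3, [0, 0, 1, 2, 1, 4])], [(1, 1, 3, [0, 1, 0, 1, 4, 2])],
    [(1, 1, 3, [0, 1, 1, 2, 0, 4])], [(1, 1, 4, [0, 0, 1, 1, 2, 3])],
    [(1, 1, 4, [0, 0, 1, 1, 3, 2])], [(1, 1, 4, [0, 0, 1, 2, 1, 3])],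
    [(1, 1, 4, [0, 0, 1, 3, 1, 2])], [(1, 1, 4, [0, 1, 0, 1, 2, 3])],
    [(1, 1, 4, [0, 1, 0, 1, 3, 2])], [(1, 1, 4, [0, 1, 1, 2, 0, 3])],
    [(1, 1, 4, [0, 1, 1, 3, 0, 2])], [(1, 2, 4, [0, 0, 2, 1, 2, 3])],
    [(1, 2, 4, [0, 0, 2, 2, 1, 3])], [(1, 2, 4, [0, 1, 2, 2, 0, 3])],
    [(1, 2, 4, [0, 1, 3, 2, 0, 2])],
    [(1, 1, 2, [3, 5, 1, 0, 1, 4]), (-1, 4, 5, [2, 4, 3, 4, 1, 0])],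
    [(1, 0, 1, [0, 0, 2, 5, 3, 4])], [(1, 0, 2, [0, 0, 1, 4, 3, 5])],
    [(1, 0, 2, [0, 1, 0, 4, 3, 5])], [(1, 0, 3, [0, 1, 2, 4, 0, 5])],
    [(1, 0, 3, [0, 1, 2, 5, 0, 4])], [(1, 0, 3, [0, 1, 4, 0, 5, 2])],
    [(1, 0, 3, [0, 2, 1, 4, 0, 5])], [(1, 0, 4, [0, 0, 1, 2, 3, 5])],
    [(1, 0, 4, [0, 0, 1, 2, 5, 3])], [(1, 0, 4, [0, 0, 1, 3, 2, 5])],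
    [(1, 0, 4, [0, 0, 2, 1, 3, 5])], [(1, 0, 4, [0, 0, 3, 1, 2, 5])],
    [(1, 0, 4, [0, 1, 0, 2, 5, 3])], [(1, 0, 4, [0, 1, 2, 0, 3, 5])],
    [(1, 0, 4, [0, 1, 2, 0, 5, 3])], [(1, 0, 5, [0, 0, 1, 2, 4, 3])],
    [(1, 0, 5, [0, 0, 2, 1, 3, 4])], [(1, 0, 5, [0, 0, 2, 1, 4, 3])],
    [(1, 0, 5, [0, 0, 2, 3, 1, 4])], [(1, 0, 5, [0, 0, 3, 1, 2, 4])],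
    [(1, 0, 5, [0, 0, 3, 2, 1, 4])], [(1, 0, 5, [0, 1, 2, 0, 3, 4])],
    [(1, 0, 5, [0, 1, 2, 3, 0, 4])], [(1, 0, 5, [0, 1, 2, 4, 0, 3])],
    [(1, 0, 5, [0, 1, 3, 2, 0, 4])], [(1, 0, 5, [0, 1, 4, 2, 0, 3])],
    [(1, 0, 5, [0, 1, 4, 3, 0, 2])], [(1, 1, 2, [0, 1, 1, 3, 4, 5])],
    [(1, 1, 2, [0, 1, 1, 5, 3, 4])], [(1, 1, 2, [0, 1, 1, 5, 4, 3])],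
    [(1, 1, 2, [0, 1, 3, 1, 4, 5])], [(1, 1, 2, [0, 1, 4, 3, 5, 1])],
    [(1, 1, 2, [0, 1, 5, 1, 4, 3])], [(1, 1, 2, [0, 4, 1, 3, 1, 5])],
    [(1, 1, 2, [0, 4, 3, 1, 1, 5])], [(1, 1, 3, [0, 1, 2, 4, 1, 5])],
    [(1, 1, 3, [0, 1, 2, 4, 5, 1])], [(1, 1, 3, [0, 1, 2, 5, 1, 4])],
    [(1, 1, 3, [0, 1, 2, 5, 4, 1])], [(1, 1, 3, [0, 1, 4, 1, 2, 5])],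
    [(1, 1, 3, [0, 1, 4, 2, 1, 5])], [(1, 1, 3, [0, 1, 4, 5, 1, 2])],
    [(1, 1, 3, [0, 1, 5, 1, 2, 4])], [(1, 1, 3, [0, 1, 5, 2, 1, 4])],
    [(1, 1, 3, [0, 1, 5, 4, 1, 2])], [(1, 1, 3, [0, 2, 1, 4, 1, 5])],
    [(1, 1, 3, [0, 2, 1, 5, 1, 4])], [(1, 1, 4, [0, 1, 1, 3, 5, 2])],
    [(1, 1, 4, [0, 1, 2, 5, 1, 3])], [(1, 1, 4, [0, 1, 2, 5, 3, 1])],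
    [(1, 1, 4, [0, 1, 3, 1, 2, 5])], [(1, 1, 4, [0, 1, 3, 5, 1, 2])],
    [(1, 1, 4, [0, 2, 1, 1, 3, 5])], [(1, 1, 4, [0, 2, 1, 3, 1, 5])],
    [(1, 1, 4, [0, 2, 1, 5, 1, 3])], [(1, 1, 4, [0, 2, 5, 1, 1, 3])],
    [(1, 1, 4, [0, 3, 1, 1, 2, 5])], [(1, 1, 5, [0, 1, 3, 4, 1, 2])],
    [(1, 1, 5, [0, 2, 1, 1, 3, 4])]]

section WordFunction

variable {k H : Type*} [Field k] [AddCommGroup H] [Module k H] {g : ℕ}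
  {b : Module.Basis (Fin g ⊕ Fin g) k H} {n : ℕ}

/-- The coordinates of a tensor at the words in the vectors `p_i`, extended by zero. -/
noncomputable def wordCoord {ι : Type*} [Fintype ι] [DecidableEq ι] (b : Module.Basis (Fin g ⊕ Fin g) k H)
    (x : ⨂[k] _ : ι, H) (w : ι → ℕ) : k :=
  if h : ∀ a, w a < g then coord b x fun a => Sum.inl ⟨w a, h a⟩ else 0

section

variable {ι : Type*} [Fintype ι] [DecidableEq ι] {x : ⨂[k] _ : ι, H}

theorem wordCoord_val (w : ι → Fin g) :
    wordCoord b x (fun a => (w a : ℕ)) = coord b x fun a => Sum.inl (w a) := by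
  rw [wordCoord, dif_pos fun a => (w a).2]

theorem raise_wordCoord (hx : IsHighestVector b x) {i j : ℕ} (hij : i < j) (w : ι → ℕ) :
    raise i j (wordCoord b x) w = 0 := by
  by_cases hj : j < g
  · by_cases hw : ∀ a, w a < g
    · refine Eq.trans (Finset.sum_congr rfl fun a _ => ?_)
        (hx.isHighest ⟨i, hij.trans hj⟩ ⟨j, hj⟩ hij fun a => ⟨w a, hw a⟩)
      simp only [Fin.mk.injEq]
      refine if_congr Iff.rfl ?_ rfl
      refine Eq.trans (congrArg _ ?_) (wordCoord_val _)
      funext c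
      rcases eq_or_ne c a with rfl | h
      · simp
      · simp [h]
    · push Not at hw
      obtain ⟨a, ha⟩ := hw
      refine Finset.sum_eq_zero fun c _ => ?_
      split_ifs with hc
      · rw [wordCoord, dif_neg]
        intro h
        have h1 := h a
        rcases eq_or_ne a c with rfl | hac
        · omega
        · rw [update_of_ne hac] at h1
          omega
      · rfl
  · refine Finset.sum_eq_zero fun c _ => ?_
    split_ifs with hc
    · rw [wordCoord, dif_neg]
      intro h
      have h1 := h c
      rw [update_self] at h1
      exact hj h1
    · rfl

theorem cnt_succ_le_of_wordCoord_ne_zero [CharZero k] (hx : IsHighestVector b x) {w : ι → ℕ}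
    (hw : wordCoord b x w ≠ 0) (i : ℕ) : cnt w (i + 1) ≤ cnt w i := by
  rw [wordCoord] at hw
  split_ifs at hw with h
  · by_cases hi : i + 1 < g
    · have := hx.isHighest.cnt_antitone (w := fun a => ⟨w a, h a⟩) hw
        (show (⟨i, by omega⟩ : Fin g) ≤ ⟨i + 1, hi⟩ from Nat.le_succ i)
      simpa only [cnt, Fin.mk.injEq] using this
    · refine le_of_eq_of_le ?_ (Nat.zero_le _)
      rw [cnt, Finset.card_eq_zero, Finset.filter_eq_empty_iff]
      intro a _ ha
      have := h a
      omega
  · exact absurd rfl hw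

end

theorem dihedralSign_r {s : ℕ} (i : ZMod s) : dihedralSign s (.r i) = 1 := rfl

theorem dihedralSign_sr {s : ℕ} (i : ZMod s) : dihedralSign s (.sr i) = (-1) ^ (s + 1) := rfl

theorem wordCoord_comp_dihedralPerm {s : ℕ} [NeZero s] {x : ⨂[k] _ : ZMod s, H}
    (hx : ∀ d, dihedralTensorRep k H s d x = x) (d : DihedralGroup s) (w : ZMod s → ℕ) :
    wordCoord b x w = ((dihedralSign s d : ℤ) : k) * wordCoord b x (w ∘ dihedralPerm s d) := by
  unfold wordCoord
  by_cases h : ∀ a, w a < g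
  · rw [dif_pos h]
    conv_lhs => rw [← hx d, coord_dihedralTensorRep]
    have h' : ∀ a, (w ∘ dihedralPerm s d) a < g := fun a => h _
    rw [dif_pos h']
    rfl
  · rw [dif_neg h, dif_neg, mul_zero]
    intro h'
    refine h fun a => ?_
    have := h' ((dihedralPerm s d).symm a)
    rwa [comp_apply, Equiv.apply_symm_apply] at this

/-- The positions `0, …, n` on the cycle. -/
def cyclePos (n : ℕ) : Fin (n + 1) ≃ ZMod (n + 1) := Equiv.refl _

theorem dihedralPerm_r_cyclePos {a c : Fin (n + 1)} (h : ((a : ℕ) + 1) % (n + 1) = c) :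
    dihedralPerm (n + 1) (.r 1) (cyclePos n a) = cyclePos n c := by
  have h1 : a + 1 = c := by
    refine Fin.ext ?_
    rw [Fin.val_add, Fin.val_one', Nat.add_mod_mod, h]
  exact h1

theorem dihedralPerm_sr_cyclePos {a c : Fin (n + 1)} (h : (a : ℕ) + c = n) :
    dihedralPerm (n + 1) (.sr 1) (cyclePos n a) = cyclePos n c := by
  have h1 : -(a + 1) = c := by
    rw [neg_eq_iff_add_eq_zero]
    refine Fin.ext ?_
    rw [Fin.val_add, Fin.val_add, Fin.val_one', Nat.add_mod_mod, Nat.mod_add_mod,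
      show (a : ℕ) + 1 + c = n + 1 by omega]
    simp
  exact h1

/-- The list of the letters of a word on the cycle. -/
def cycleList (w : ZMod (n + 1) → ℕ) : List ℕ := List.ofFn fun a => w (cyclePos n a)

theorem length_cycleList (w : ZMod (n + 1) → ℕ) : (cycleList w).length = n + 1 := List.length_ofFn

theorem getD_cycleList (w : ZMod (n + 1) → ℕ) (a : Fin (n + 1)) :
    (cycleList w).getD a 0 = w (cyclePos n a) := by
  rw [cycleList, List.getD_eq_getElem _ _ (by rw [List.length_ofFn]; exact a.2), List.getElem_ofFn]

theorem exists_eq_cycleList {l : List ℕ} (hl : l.length = n + 1) :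
    ∃ w : ZMod (n + 1) → ℕ, l = cycleList w := by
  refine ⟨fun a => l[((cyclePos n).symm a : ℕ)]'(hl.symm ▸ ((cyclePos n).symm a).2),
    List.ext_getElem (by rw [length_cycleList, hl]) fun i h1 h2 => ?_⟩
  simp only [cycleList, List.getElem_ofFn, Equiv.symm_apply_apply]

theorem rotate_cycleList (w : ZMod (n + 1) → ℕ) :
    (cycleList w).rotate 1 = cycleList (w ∘ dihedralPerm (n + 1) (.r 1)) := by
  refine List.ext_getElem (by rw [List.length_rotate, length_cycleList, length_cycleList])
    fun i h1 h2 => ?_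
  simp only [cycleList, List.getElem_rotate, List.getElem_ofFn, comp_apply]
  refine congrArg w (dihedralPerm_r_cyclePos ?_).symm
  simp only [List.length_ofFn]

theorem reverse_cycleList (w : ZMod (n + 1) → ℕ) :
    (cycleList w).reverse = cycleList (w ∘ dihedralPerm (n + 1) (.sr 1)) := by
  refine List.ext_getElem (by rw [List.length_reverse, length_cycleList, length_cycleList])
    fun i h1 h2 => ?_
  rw [length_cycleList] at h2
  simp only [cycleList, List.getElem_reverse, List.getElem_ofFn, comp_apply]
  refine congrArg w (dihedralPerm_sr_cyclePos ?_).symm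
  simp only [List.length_ofFn]
  omega

theorem set_cycleList (w : ZMod (n + 1) → ℕ) (a : Fin (n + 1)) (j : ℕ) :
    (cycleList w).set a j = cycleList (update w (cyclePos n a) j) := by
  refine List.ext_getElem (by rw [List.length_set, length_cycleList, length_cycleList])
    fun i h1 h2 => ?_
  simp only [cycleList, List.getElem_set, List.getElem_ofFn, update_apply,
    (cyclePos n).injective.eq_iff, Fin.ext_iff, eq_comm]

theorem count_cycleList (w : ZMod (n + 1) → ℕ) (i : ℕ) : (cycleList w).count i = cnt w i := by
  have h : ∀ l : List ℕ, l.count i = (l.map fun a => if a = i then 1 else 0).sum := by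
    intro l
    induction l with
    | nil => rfl
    | cons a l ih => simp [List.count_cons, ih, add_comm]
  rw [h, cycleList, List.map_ofFn, List.sum_ofFn, cnt, Finset.card_filter]
  exact Equiv.sum_comp (cyclePos n) _

theorem evalRow_raiseRow_cycleList {k : Type*} [Field k] (X : List ℕ → k) (i j : ℕ)
    (w : ZMod (n + 1) → ℕ) :
    evalRow X (raiseRow i j (cycleList w)) = raise i j (fun w => X (cycleList w)) w := by
  have h : ∀ L : List ℕ, evalRow X ((L.filter fun p => (cycleList w).getD p 0 = i).map
      fun p => (1, (cycleList w).set p j)) = (L.map fun p => if (cycleList w).getD p 0 = i then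
        X ((cycleList w).set p j) else 0).sum := by
    intro L
    induction L with
    | nil => rfl
    | cons p L ih =>
      rw [List.map_cons, List.sum_cons, ← ih, List.filter_cons]
      simp only [decide_eq_true_eq]
      split_ifs <;> simp
  have h' : ∀ F : ℕ → k, ((List.range (n + 1)).map F).sum = ∑ p ∈ Finset.range (n + 1), F p :=
    fun F => rfl
  rw [raiseRow, h, length_cycleList, h', Finset.sum_range, raise,
    ← Equiv.sum_comp (cyclePos n)]
  simp only [getD_cycleList, set_cycleList]

/-- The coordinates of a tensor as a function on lists. -/
noncomputable def listCoord (b : Module.Basis (Fin g ⊕ Fin g) k H) (x : ⨂[k] _ : ZMod (n + 1), H)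
    (l : List ℕ) : k :=
  if l.length = n + 1 then wordCoord b x fun a => l.getD ((cyclePos n).symm a) 0 else 0

theorem listCoord_cycleList (x : ⨂[k] _ : ZMod (n + 1), H) (w : ZMod (n + 1) → ℕ) :
    listCoord b x (cycleList w) = wordCoord b x w := by
  rw [listCoord, if_pos (length_cycleList w)]
  simp only [getD_cycleList, Equiv.apply_symm_apply]

theorem isCyclicHighest_listCoord [CharZero k] {x : ⨂[k] _ : ZMod (n + 1), H}
    (hx : IsHighestVector b x) (hd : ∀ d, dihedralTensorRep k H (n + 1) d x = x) :
    IsCyclicHighest (n + 1) ((-1) ^ (n + 2)) (listCoord b x) where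
  length_eq l hl := by
    by_contra h
    exact hl (if_neg h)
  rotate l := by
    by_cases hl : l.length = n + 1
    · obtain ⟨w, rfl⟩ := exists_eq_cycleList hl
      rw [rotate_cycleList, listCoord_cycleList, listCoord_cycleList, wordCoord_comp_dihedralPerm hd (.r 1) w]
      simp [dihedralSign_r]
    · rw [listCoord, listCoord, if_neg hl, if_neg (by rwa [List.length_rotate])]
  reverse l := by
    by_cases hl : l.length = n + 1
    · obtain ⟨w, rfl⟩ := exists_eq_cycleList hl
      rw [reverse_cycleList, listCoord_cycleList, listCoord_cycleList, wordCoord_comp_dihedralPerm hd (.sr 1) w]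
      simp [dihedralSign_sr, ← mul_assoc, ← mul_pow]
    · rw [listCoord, listCoord, if_neg hl, if_neg (by rwa [List.length_reverse]), mul_zero]
  raise i j l hij := by
    by_cases hl : l.length = n + 1
    · obtain ⟨w, rfl⟩ := exists_eq_cycleList hl
      rw [evalRow_raiseRow_cycleList]
      simp only [listCoord_cycleList]
      rw [raise_wordCoord hx hij]
    · refine List.sum_eq_zero fun y hy => ?_
      simp only [raiseRow, List.map_map, List.mem_map, comp_apply] at hy
      obtain ⟨p, -, rfl⟩ := hy
      rw [listCoord, if_neg (by rwa [List.length_set]), mul_zero]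
  count_le l i hl := by
    obtain ⟨w, rfl⟩ := exists_eq_cycleList (n := n) (l := l) (by
      by_contra h
      exact hl (if_neg h))
    rw [count_cycleList, count_cycleList]
    rw [listCoord_cycleList] at hl
    exact cnt_succ_le_of_wordCoord_ne_zero hx hl i

end WordFunction

section HighestVectors

variable {k H : Type*} [Field k] [AddCommGroup H] [Module k H] {g : ℕ}
  {b : Module.Basis (Fin g ⊕ Fin g) k H} {ι ι' : Type*} [Fintype ι] [DecidableEq ι] [Fintype ι']
  [DecidableEq ι']

theorem raise_comp_equiv {L R : Type*} [DecidableEq L] [CommRing R]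
    (i j : L) (x : (ι → L) → R) (e : ι ≃ ι') (w : ι' → L) :
    raise i j (fun w => x (w ∘ e)) w = raise i j x (w ∘ e) := by
  refine (Equiv.sum_comp e _).symm.trans (Finset.sum_congr rfl fun a _ => ?_)
  refine if_congr Iff.rfl (congrArg x (funext fun c => ?_)) rfl
  simp only [comp_apply, update_apply, e.injective.eq_iff]

variable (b ι) in
/-- The space of highest vectors. -/
noncomputable def highestVectors : Submodule k (⨂[k] _ : ι, H) where
  carrier := {x | IsHighestVector b x}
  add_mem' {x y} hx hy := by
    refine ⟨fun w a m h => ?_, fun i j hij w => ?_⟩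
    · rw [map_add, Pi.add_apply, hx.eq_zero w a m h, hy.eq_zero w a m h, add_zero]
    · refine Eq.trans ?_ ((congrArg₂ (· + ·) (hx.isHighest i j hij w)
        (hy.isHighest i j hij w)).trans (add_zero 0))
      simp only [raise, ← Finset.sum_add_distrib, map_add, Pi.add_apply]
      exact Finset.sum_congr rfl fun a _ => by split_ifs <;> simp
  zero_mem' := ⟨fun w a m h => by simp, fun i j hij w => by simp [raise]⟩
  smul_mem' c x hx := by
    refine ⟨fun w a m h => ?_, fun i j hij w => ?_⟩
    · rw [map_smul, Pi.smul_apply, hx.eq_zero w a m h, smul_zero]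
    · refine Eq.trans ?_ ((congrArg (c * ·) (hx.isHighest i j hij w)).trans (mul_zero c))
      simp only [raise, Finset.mul_sum, map_smul, Pi.smul_apply, smul_eq_mul, mul_ite, mul_zero]

theorem IsHighestVector.reindex {x : ⨂[k] _ : ι, H} (hx : IsHighestVector b x) (e : ι ≃ ι') :
    IsHighestVector b (PiTensorProduct.reindex k (fun _ => H) e x) := by
  have h : ∀ w, coord b (PiTensorProduct.reindex k (fun _ => H) e x) w = coord b x (w ∘ e) :=
    coord_reindex b e x
  refine ⟨fun w a m hw => ?_, fun i j hij w => ?_⟩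
  · rw [h]
    exact hx.eq_zero _ (e.symm a) m (by rw [comp_apply, Equiv.apply_symm_apply, hw])
  · simp only [h]
    exact (raise_comp_equiv i j (fun w : ι → Fin g => coord b x fun a => Sum.inl (w a)) e w).trans
      (hx.isHighest i j hij _)

theorem averagedVector_mem_highestVectors [CharZero k] {s : ℕ} [NeZero s] {μ : YoungDiagram}
    (hμ : ∀ c : μ.cells, c.1.1 < g) (φ : μ.cells ≃ ZMod s) :
    averagedVector b φ ∈ highestVectors b (ZMod s) := by
  rw [averagedVector, dihedralAverage_apply]
  refine Submodule.smul_mem _ _ (Submodule.sum_mem _ fun d _ => ?_)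
  exact Submodule.smul_mem _ ((dihedralSign s d : ℤ) : k)
    (((isHighestVector_highestWeightVector hμ).reindex φ).reindex (dihedralPerm s d))

end HighestVectors

section Evaluation

variable {k H : Type*} [Field k] [AddCommGroup H] [Module k H] {g : ℕ}
  {b : Module.Basis (Fin g ⊕ Fin g) k H} {μ : YoungDiagram}

theorem exists_mem_columnGroup_of_coord_ne_zero (hμ : ∀ c : μ.cells, c.1.1 < g)
    {w : μ.cells → Fin g ⊕ Fin g} (hw : coord b (highestWeightVector b μ) w ≠ 0) :
    ∃ σ ∈ columnGroup μ, w = fun c => Sum.inl (rowWord hμ (σ c)) := by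
  by_contra! h
  refine hw ?_
  rw [coord_highestWeightVector hμ, finsum_eq_zero_of_forall_eq_zero, Int.cast_zero]
  exact fun σ => if_neg (h σ.1 σ.2)

/-- The product of the signs of the differences of the values of a function. -/
def differenceSign {n : ℕ} (f : Fin n → ℕ) : ℤ :=
  ∏ j, ∏ i ∈ Finset.Iio j, ((f j : ℤ) - f i).sign

theorem differenceSign_comp {n : ℕ} (f : Fin n → ℕ) (σ : Equiv.Perm (Fin n)) :
    differenceSign (f ∘ σ) = Equiv.Perm.sign σ * differenceSign f := by
  refine σ.prod_Iio_comp_eq_sign_mul_prod (f := fun i j => ((f j : ℤ) - f i).sign) fun i j => ?_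
  rw [← Int.sign_neg, neg_sub]

theorem differenceSign_mul_self {n : ℕ} {f : Fin n → ℕ} (hf : Injective f) :
    differenceSign f * differenceSign f = 1 := by
  simp only [differenceSign, ← Finset.prod_mul_distrib]
  refine Finset.prod_eq_one fun j _ => Finset.prod_eq_one fun i hi => ?_
  have : (f j : ℤ) - f i ≠ 0 := sub_ne_zero.2
    (Nat.cast_injective.ne (hf.ne (Finset.mem_Iio.1 hi).ne'))
  rcases this.lt_or_gt with h | h
  · rw [Int.sign_eq_neg_one_of_neg h]; rfl
  · rw [Int.sign_eq_one_of_pos h]; rfl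

theorem differenceSign_eq_zero {n : ℕ} {f : Fin n → ℕ} (hf : ¬Injective f) :
    differenceSign f = 0 := by
  rw [Injective] at hf
  push Not at hf
  obtain ⟨i, j, h, hij⟩ := hf
  wlog hlt : i < j generalizing i j
  · exact this j i h.symm hij.symm (lt_of_le_of_ne (not_lt.1 hlt) hij.symm)
  refine Finset.prod_eq_zero (Finset.mem_univ j) (Finset.prod_eq_zero (Finset.mem_Iio.2 hlt) ?_)
  rw [h, sub_self, Int.sign_zero]

/-- The coordinate of a highest weight vector at a word `w`, where the positions of the word are
identified with cells by `r`. -/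
def cellSign {n : ℕ} (r : Fin n → ℕ × ℕ) (w : Fin n → ℕ) : ℤ :=
  if ∀ a, ∃ a', (w a, (r a).2) = r a' then
    differenceSign (fun a => Nat.pair (w a) (r a).2) *
      differenceSign fun a => Nat.pair (r a).1 (r a).2
  else 0

theorem cellSign_eq_sign {n : ℕ} {r : Fin n → ℕ × ℕ} (hr : Injective r) {w : Fin n → ℕ}
    {σ : Equiv.Perm (Fin n)} (hσ : ∀ a, (w a, (r a).2) = r (σ a)) :
    cellSign r w = Equiv.Perm.sign σ := by
  have h : (fun a => Nat.pair (w a) (r a).2) = (fun a => Nat.pair (r a).1 (r a).2) ∘ σ := by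
    funext a
    simp only [comp_apply, ← hσ]
  rw [cellSign, if_pos fun a => ⟨_, hσ a⟩, h, differenceSign_comp, mul_assoc,
    differenceSign_mul_self, mul_one]
  intro a c hac
  have := Nat.pair_eq_pair.1 hac
  exact hr (Prod.ext this.1 this.2)

theorem cellSign_eq_zero {n : ℕ} {r : Fin n → ℕ × ℕ} {w : Fin n → ℕ}
    (h : ¬∃ σ : Equiv.Perm (Fin n), ∀ a, (w a, (r a).2) = r (σ a)) : cellSign r w = 0 := by
  rw [cellSign]
  split_ifs with hc
  · choose σ hσ using hc
    rw [differenceSign_eq_zero, zero_mul]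
    intro hinj
    have hσi : Injective σ := by
      intro a c hac
      refine hinj ?_
      have := (hσ a).trans ((congrArg r hac).trans (hσ c).symm)
      exact Nat.pair_eq_pair.2 (Prod.ext_iff.1 this)
    exact h ⟨Equiv.ofBijective σ (Finite.injective_iff_bijective.1 hσi), hσ⟩
  · rfl

theorem coord_highestWeightVector_eq_cellSign (hμ : ∀ c : μ.cells, c.1.1 < g) {n : ℕ}
    (e : Fin n ≃ μ.cells) (w : μ.cells → Fin g) :
    coord b (highestWeightVector b μ) (fun c => Sum.inl (w c)) =
      (cellSign (fun a => (e a).1) fun a => w (e a) : k) := by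
  by_cases h : ∃ σ : Equiv.Perm (Fin n), ∀ a, ((w (e a) : ℕ), (e a).1.2) = (e (σ a)).1
  · obtain ⟨σ, hσ⟩ := h
    rw [cellSign_eq_sign (r := fun a => (e a).1) (Subtype.val_injective.comp e.injective) hσ]
    have hw : (fun c => (Sum.inl (w c) : Fin g ⊕ Fin g)) =
        (fun c => Sum.inl (rowWord hμ c)) ∘ (e.permCongr σ) := by
      funext c
      refine congrArg _ (Fin.ext ?_)
      have := congrArg Prod.fst (hσ (e.symm c))
      simpa [rowWord] using this
    rw [hw, coord_highestWeightVector_comp hμ, coord_highestWeightVector_rowWord, mul_one,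
      Equiv.Perm.sign_permCongr]
    intro c
    have := congrArg Prod.snd (hσ (e.symm c))
    simpa using this.symm
  · rw [cellSign_eq_zero h, Int.cast_zero]
    by_contra hne
    obtain ⟨σ, hσ, hw⟩ := exists_mem_columnGroup_of_coord_ne_zero hμ hne
    refine h ⟨e.symm.permCongr σ, fun a => ?_⟩
    have h1 := Sum.inl_injective (congrFun hw (e a))
    simp only [Equiv.permCongr_apply, Equiv.symm_symm, Equiv.apply_symm_apply]
    exact Prod.ext (congrArg Fin.val h1) (hσ (e a)).symm

end Evaluation

section Pivots

variable {k H : Type*} [Field k] [AddCommGroup H] [Module k H] {g : ℕ}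
  {b : Module.Basis (Fin g ⊕ Fin g) k H} {ω : LinearMap.BilinForm k H} {n : ℕ}

/-- The sum of the signed coordinates of a highest weight vector over the dihedral images of a
word. -/
def cellSignSum (r : Fin (n + 1) → ℕ × ℕ) (w : Fin (n + 1) → ℕ) : ℤ :=
  ∑ d, (dihedralSign (n + 1) d : ℤ) *
    cellSign r fun a => w ((cyclePos n).symm (dihedralPerm (n + 1) d (cyclePos n a)))

theorem wordCoord_averagedVector {μ : YoungDiagram} (hμ : ∀ c : μ.cells, c.1.1 < g)
    (e : Fin (n + 1) ≃ μ.cells) {w : Fin (n + 1) → ℕ} (hw : ∀ a, w a < g) :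
    wordCoord b (averagedVector b (e.symm.trans (cyclePos n))) (w ∘ (cyclePos n).symm) =
      (Fintype.card (DihedralGroup (n + 1)) : k)⁻¹ *
        (cellSignSum (fun a => (e a).1) w : k) := by
  have hw' : ∀ a, (w ∘ (cyclePos n).symm) a < g := fun a => hw _
  rw [wordCoord, dif_pos hw', coord_averagedVector, cellSignSum, Int.cast_sum]
  refine congrArg _ (Finset.sum_congr rfl fun d _ => ?_)
  rw [Int.cast_mul]
  refine congrArg _ ((coord_highestWeightVector_eq_cellSign hμ e fun c =>
    ⟨_, hw' (dihedralPerm (n + 1) d (cyclePos n (e.symm c)))⟩).trans ?_)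
  simp only [Equiv.symm_apply_apply, comp_apply]

/-- The bijection of `Fin s` with the cells of a diagram given by a list of the cells. -/
noncomputable def cellEquiv {μ : YoungDiagram} {s : ℕ} {r : Fin s → ℕ × ℕ} (hr : Injective r)
    (hμ : Finset.univ.image r = μ.cells) : Fin s ≃ μ.cells :=
  Equiv.ofBijective (fun a => ⟨r a, hμ ▸ Finset.mem_image_of_mem r (Finset.mem_univ a)⟩)
    ⟨fun a c h => hr (congrArg Subtype.val h), fun c => by
      obtain ⟨a, -, ha⟩ := Finset.mem_image.1 (hμ.symm ▸ c.2 : c.1 ∈ Finset.univ.image r)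
      exact ⟨a, Subtype.ext ha⟩⟩

theorem nonempty_equiv_irrepSum_of_pivots [CharZero k] (hb : IsSymplecticBasis ω b)
    (L : List YoungDiagram) {m : ℕ} (hm : m ≤ g) (r : Fin L.length → Fin (n + 1) → ℕ × ℕ)
    (hr : ∀ i, Injective (r i)) (hL : ∀ i, Finset.univ.image (r i) = (L.get i).cells)
    (hrow : ∀ i a, (r i a).1 < m) (w : Fin L.length → Fin (n + 1) → ℕ) (hw : ∀ i a, w i a < m)
    (hdiag : ∀ i, cellSignSum (r i) (w i) ≠ 0)
    (htri : ∀ i j, j < i → cellSignSum (r i) (w j) = 0)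
    {C : List (List (ℤ × ℕ × ℕ × List ℕ))}
    (hC : isComplete n ((-1) ^ (n + 2)) (List.ofFn fun i => List.ofFn (w i)) C = true) :
    Nonempty ((dihedralCoinvariants ω (n + 1)).Equiv (irrepSum ω b L)) := by
  have hLg : ∀ i : Fin L.length, ∀ c : (L.get i).cells, c.1.1 < g := by
    intro i c
    obtain ⟨a, -, ha⟩ := Finset.mem_image.1 ((hL i).symm ▸ c.2 : c.1 ∈ Finset.univ.image (r i))
    rw [← ha]
    exact (hrow i a).trans_le hm
  set φ : ∀ i, (L.get i).cells ≃ ZMod (n + 1) :=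
    fun i => (cellEquiv (hr i) (hL i)).symm.trans (cyclePos n) with hφ
  have hwg : ∀ i a, w i a < g := fun i a => (hw i a).trans_le hm
  set M : Matrix (Fin L.length) (Fin L.length) k := fun i j =>
    wordCoord b (averagedVector b (φ i)) (w j ∘ (cyclePos n).symm) with hM
  have hMe : ∀ i j, M i j = (Fintype.card (DihedralGroup (n + 1)) : k)⁻¹ *
      (cellSignSum (r i) (w j) : k) :=
    fun i j => wordCoord_averagedVector (hLg i) (cellEquiv (hr i) (hL i)) (hwg j)
  have hdet : IsUnit M.det := by
    rw [Matrix.det_of_isUpperTriangular (fun i j hij => by rw [hMe, htri i j hij]; simp),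
      isUnit_iff_ne_zero, Finset.prod_ne_zero_iff]
    intro i _
    rw [hMe]
    exact mul_ne_zero (inv_ne_zero (Nat.cast_ne_zero.2 Fintype.card_ne_zero))
      (Int.cast_ne_zero.2 (hdiag i))
  have hsum : ∀ (c : Fin L.length → k) j, wordCoord b (∑ i, c i • averagedVector b (φ i))
      (w j ∘ (cyclePos n).symm) = Matrix.vecMul c M j := by
    intro c j
    have hwj : ∀ a, (w j ∘ (cyclePos n).symm) a < g := fun a => hwg j _
    simp only [Matrix.vecMul, dotProduct, hM, wordCoord, dif_pos hwj, map_sum, map_smul,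
      Finset.sum_apply, Pi.smul_apply, smul_eq_mul]
  refine nonempty_equiv_irrepSum L φ hb hLg (fun c hc => ?_) fun x hx hxd => ?_
  · refine Matrix.eq_zero_of_vecMul_eq_zero hdet.ne_zero (funext fun j => ?_)
    rw [← hsum, hc]
    simp [wordCoord]
  · set v : Fin L.length → k := fun j => wordCoord b x (w j ∘ (cyclePos n).symm) with hv
    set c := Matrix.vecMul v M⁻¹ with hc
    refine ⟨c, ?_⟩
    have hcM : Matrix.vecMul c M = v := by
      rw [hc, Matrix.vecMul_vecMul, Matrix.nonsing_inv_mul _ hdet, Matrix.vecMul_one]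
    set y := x - ∑ i, c i • averagedVector b (φ i) with hy
    have hyh : IsHighestVector b y := Submodule.sub_mem (highestVectors b _) hx
      (Submodule.sum_mem _ fun i _ => Submodule.smul_mem _ _
        (averagedVector_mem_highestVectors (hLg i) (φ i)))
    have hyd : ∀ d, dihedralTensorRep k H (n + 1) d y = y := by
      intro d
      rw [hy, map_sub, hxd, map_sum]
      simp only [map_smul, averagedVector, dihedralTensorRep_dihedralAverage]
    have hX := isCyclicHighest_listCoord hyh hyd
    have hε : ((-1 : ℤ) ^ (n + 2)) * (-1) ^ (n + 2) = 1 := by rw [← mul_pow]; simp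
    have hlist : ∀ u : Fin (n + 1) → ℕ, List.ofFn u = cycleList (u ∘ (cyclePos n).symm) := by
      intro u
      simp only [cycleList, comp_apply, Equiv.symm_apply_apply]
    have h0 := hX.eq_zero_of_isComplete hε (P := List.ofFn fun i => List.ofFn (w i)) (by
      intro l hl
      obtain ⟨j, rfl⟩ := (List.mem_ofFn' _ _).1 hl
      change listCoord b y (List.ofFn (w j)) = 0
      rw [hlist, listCoord_cycleList]
      have h1 := hsum c j
      have hwj : ∀ a, (w j ∘ (cyclePos n).symm) a < g := fun a => hwg j _
      rw [hcM, hv] at h1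
      simp only [wordCoord, dif_pos hwj] at h1 ⊢
      rw [hy, map_sub, Pi.sub_apply, h1, sub_self]) hC
    refine sub_eq_zero.1 (eq_zero_of_coord b fun u => ?_)
    by_cases hu : ∃ a m, u a = Sum.inr m
    · obtain ⟨a, m, ham⟩ := hu
      exact hyh.eq_zero u a m ham
    · obtain ⟨u, rfl⟩ := exists_eq_inl hu
      rw [← hy, ← wordCoord_val, ← listCoord_cycleList]
      exact h0 _

end Pivots

section Cases

variable {k H : Type*} [Field k] [CharZero k] [AddCommGroup H] [Module k H] {g : ℕ}
  {b : Module.Basis (Fin g ⊕ Fin g) k H} {ω : LinearMap.BilinForm k H}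

theorem nonempty_equiv_irrepSum_four (hb : IsSymplecticBasis ω b) (hg : 3 ≤ g) :
    Nonempty ((dihedralCoinvariants ω 4).Equiv (irrepSum ω b [part [2, 1, 1]])) := by
  refine nonempty_equiv_irrepSum_of_pivots (n := 3) hb [part [2, 1, 1]] hg
    (![![(0, 0), (0, 1), (1, 0), (2, 0)]] : Fin 1 → Fin 4 → ℕ × ℕ)
    ?_ ?_ ?_ (![![0, 0, 1, 2]] : Fin 1 → Fin 4 → ℕ) ?_ ?_ ?_ (C := raisingCertificateFour) ?_
  all_goals decide +kernel

set_option maxHeartbeats 1000000 in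
theorem nonempty_equiv_irrepSum_five (hb : IsSymplecticBasis ω b) (hg : 5 ≤ g) :
    Nonempty ((dihedralCoinvariants ω 5).Equiv
      (irrepSum ω b [part [5], part [3, 2], part [2, 2, 1], part [1, 1, 1, 1, 1]])) := by
  refine nonempty_equiv_irrepSum_of_pivots (n := 4) hb _ hg
    (![![(0, 0), (0, 1), (0, 2), (0, 3), (0, 4)],
      ![(0, 0), (0, 1), (0, 2), (1, 0), (1, 1)],
      ![(0, 0), (0, 1), (1, 0), (1, 1), (2, 0)],
      ![(0, 0), (1, 0), (2, 0), (3, 0), (4, 0)]] : Fin 4 → Fin 5 → ℕ × ℕ) ?_ ?_ ?_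
    (![![0, 0, 0, 0, 0], ![0, 0, 0, 1, 1], ![0, 0, 1, 1, 2], ![0, 1, 2, 3, 4]] :
      Fin 4 → Fin 5 → ℕ) ?_ ?_ ?_ (C := raisingCertificateFive) ?_
  all_goals decide +kernel

set_option maxHeartbeats 2000000 in
theorem nonempty_equiv_irrepSum_six (hb : IsSymplecticBasis ω b) (hg : 4 ≤ g) :
    Nonempty ((dihedralCoinvariants ω 6).Equiv
      (irrepSum ω b [part [3, 3], part [4, 1, 1], part [4, 1, 1], part [3, 2, 1],
        part [3, 1, 1, 1], part [2, 2, 1, 1]])) := by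
  refine nonempty_equiv_irrepSum_of_pivots (n := 5) hb _ hg
    (![![(0, 0), (0, 1), (0, 2), (1, 1), (1, 2), (1, 0)],
      ![(0, 0), (0, 1), (0, 2), (0, 3), (1, 0), (2, 0)],
      ![(0, 0), (0, 1), (1, 0), (0, 2), (2, 0), (0, 3)],
      ![(0, 0), (0, 1), (0, 2), (1, 0), (1, 1), (2, 0)],
      ![(0, 0), (0, 1), (1, 0), (0, 2), (2, 0), (3, 0)],
      ![(0, 0), (0, 1), (1, 1), (1, 0), (2, 0), (3, 0)]] : Fin 6 → Fin 6 → ℕ × ℕ) ?_ ?_ ?_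
    (![![0, 0, 1, 0, 1, 1], ![0, 0, 0, 0, 1, 2], ![0, 0, 0, 1, 0, 2], ![0, 0, 0, 1, 1, 2],
      ![0, 0, 0, 1, 2, 3], ![0, 0, 1, 1, 2, 3]] : Fin 6 → Fin 6 → ℕ) ?_ ?_ ?_
    (C := raisingCertificateSix) ?_
  all_goals decide +kernel

omit [CharZero k] in
/-- The sum over a list with one element. -/
theorem nonempty_equiv_irrep_of_singleton (μ : YoungDiagram) :
    Nonempty ((irrepSum ω b [μ]).Equiv (irrep ω b μ)) := by
  set F : (irrepSub ω b μ).toSubmodule →ₗ[k]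
      ⨁ i : Fin [μ].length, (irrepSub ω b ([μ].get i)).toSubmodule :=
    DirectSum.lof k (Fin [μ].length) (fun i => (irrepSub ω b ([μ].get i)).toSubmodule) 0 with hF
  have hFs : ∀ f : Sp ω, F ∘ₗ irrep ω b μ f = irrepSum ω b [μ] f ∘ₗ F := by
    intro f
    refine LinearMap.ext fun x => ?_
    have h := DirectSum.lmap_lof (R := k) (fun i : Fin [μ].length => irrep ω b ([μ].get i) f) 0 x
    exact h.symm
  have hFb : Function.Bijective F := by
    refine ⟨DirectSum.of_injective (β := fun i : Fin [μ].length =>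
      (irrepSub ω b ([μ].get i)).toSubmodule) 0, fun y => ⟨y 0, ?_⟩⟩
    refine DFinsupp.ext fun i => ?_
    have hi : i = 0 := Fin.fin_one_eq_zero i
    subst hi
    exact DirectSum.of_eq_same (β := fun i : Fin [μ].length =>
      (irrepSub ω b ([μ].get i)).toSubmodule) 0 (y 0)
  exact ⟨(Representation.IntertwiningMap.ofBijective ⟨F, hFs⟩ hFb).symm⟩

theorem irrep_part_isIrreducible (hb : IsSymplecticBasis ω b) {m : ℕ} (hm : m ≤ g)
    {μ : YoungDiagram} (hμ : ∀ c ∈ μ.cells, c.1 < m) : (irrep ω b μ).IsIrreducible :=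
  irrep_isIrreducible hb fun c => (hμ c.1 c.2).trans_le hm

end Cases

end SpDihedral

theorem mainTheorem10 {k : Type*} [Field k] [CharZero k] {H : Type*} [AddCommGroup H] [Module k H]
    (ω : LinearMap.BilinForm k H) (g : ℕ) (b : Module.Basis (Fin g ⊕ Fin g) k H)
    (hb : IsSymplecticBasis ω b) :
    (3 ≤ g →
      (irrep ω b (part [2, 1, 1])).IsIrreducible ∧
      Nonempty ((dihedralCoinvariants ω 4).Equiv (irrep ω b (part [2, 1, 1])))) ∧
    (5 ≤ g →
      (∀ μ ∈ [part [5], part [3, 2], part [2, 2, 1], part [1, 1, 1, 1, 1]],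
        (irrep ω b μ).IsIrreducible) ∧
      Nonempty ((dihedralCoinvariants ω 5).Equiv
        (irrepSum ω b [part [5], part [3, 2], part [2, 2, 1], part [1, 1, 1, 1, 1]]))) ∧
    (4 ≤ g →
      (∀ μ ∈ [part [3, 3], part [4, 1, 1], part [4, 1, 1], part [3, 2, 1], part [3, 1, 1, 1],
          part [2, 2, 1, 1]], (irrep ω b μ).IsIrreducible) ∧
      Nonempty ((dihedralCoinvariants ω 6).Equiv
        (irrepSum ω b [part [3, 3], part [4, 1, 1], part [4, 1, 1], part [3, 2, 1],
          part [3, 1, 1, 1], part [2, 2, 1, 1]]))) := by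
  refine ⟨fun hg => ⟨?_, ?_⟩, fun hg => ⟨?_, nonempty_equiv_irrepSum_five hb hg⟩,
    fun hg => ⟨?_, nonempty_equiv_irrepSum_six hb hg⟩⟩
  · exact irrep_part_isIrreducible hb hg (by decide +kernel)
  · obtain ⟨e⟩ := nonempty_equiv_irrepSum_four hb hg
    obtain ⟨e'⟩ := nonempty_equiv_irrep_of_singleton (ω := ω) (b := b) (part [2, 1, 1])
    exact ⟨e.trans e'⟩
  · have h : ∀ μ ∈ [part [5], part [3, 2], part [2, 2, 1], part [1, 1, 1, 1, 1]],
        ∀ c ∈ μ.cells, c.1 < 5 := by decide +kernel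
    exact fun μ hμ => irrep_part_isIrreducible hb hg (h μ hμ)
  · have h : ∀ μ ∈ [part [3, 3], part [4, 1, 1], part [4, 1, 1], part [3, 2, 1],
        part [3, 1, 1, 1], part [2, 2, 1, 1]], ∀ c ∈ μ.cells, c.1 < 4 := by decide +kernel
    exact fun μ hμ => irrep_part_isIrreducible hb hg (h μ hμ)
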